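/- Let $(G,H)$ be a rooted graph, i.e. $H$ is a finite simple graph, and $G$ is the subgraph of $H$ induced by a nonempty set of labelled root vertices $V(G)=\{1,\dots,v_G\}\subseteq V(H)$. Write $v_F,e_F$ for the numbers of vertices and edges of a graph $F$, and assume $e_H>e_G$. For a subgraph $J$ with $G\subsetneq J\subseteq H$ let $d(G,J)=\frac{e_J-e_G}{v_J-v_G}$ (note that $v_J>v_G$, as $G$ is induced). Call $(G,H)$ strictly balanced if $d(G,J)<d(G,H)$ for all $G\subsetneq J\subsetneq H$, and grounded if some root vertex is adjacent in $H$ to some non-root vertex. For a tuple $\mathbf x=(x_1,\dots,x_{v_G})$ of distinct vertices from $[n]=\{1,\dots,n\}$, a $(G,H)$-extension of $\mathbf x$ is a copy (as a subgraph) of the graph $(V(H),E(H)\setminus E(G))$ in which each root $j$ is mapped onto $x_j$. Let $X_{\mathbf x}$ be the number of $(G,H)$-extensions of $\mathbf x$ in the binomial random graph $G(n,p)$, and let $\mu=\mathbb E X_{\mathbf x}$, which does not depend on $\mathbf x$. Maxima below are over all tuples $\mathbf x$ of $v_G$ distinct vertices from $[n]$. Suppose that $(G,H)$ is strictly balanced.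 Then there are constants $c,C,\alpha>0$, depending only on $(G,H)$, such that for all sequences $p=p(n)\in[0,1]$ and $\varepsilon=\varepsilon(n)\in[n^{-\alpha},1]$ (for all large $n$) the following holds. (i) If $(G,H)$ is grounded, then $$\lim_{n\to\infty}\Pr\Bigl(\max_{\mathbf x}|X_{\mathbf x}-\mu|<\varepsilon\mu\Bigr)=\begin{cases}0&\text{if }\varepsilon^2\mu\le c\log n\text{ for all large }n,\\ 1&\text{if }\varepsilon^2\mu\ge C\log n\text{ for all large }n.\end{cases}$$ (ii) If $(G,H)$ is not grounded, then $$\lim_{n\to\infty}\Pr\Bigl(\max_{\mathbf x}|X_{\mathbf x}-\mu|<\varepsilon\mu\Bigr)=\begin{cases}0&\text{if }\varepsilon^2\mu\to0,\\ 1&\text{if }\varepsilon^2\mu\to\infty.\end{cases}$$ In particular, this answers Spencer's question. For fixed $\varepsilon\in(0,1]$ call $K$ sufficient for $\varepsilon$ if $\Pr(\max_{\mathbf x}|X_{\mathbf x}-\mu|<\varepsilon\mu)\to1$ for every $p=p(n)\in[0,1]$ with $\mu\ge K\log n$ for all large $n$. If $(G,H)$ is grounded then, with the same constants $c,C$ and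 for every fixed $\varepsilon\in(0,1]$, the constant $C\varepsilon^{-2}$ is sufficient for $\varepsilon$ and every $K$ that is sufficient for $\varepsilon$ satisfies $K\ge c\,\varepsilon^{-2}$; that is, the optimal constant is $K(\varepsilon)=\Theta(\varepsilon^{-2})$. -/

import Mathlib

open MeasureTheory Filter Topology SimpleGraph

/-- A rooted graph `(G, H)` on the vertex set `V = V(H)`: the graph `H` together with an injective
labelling of its root vertices; `G` is the subgraph of `H` induced by the roots. -/
structure RootedGraph (V : Type*) where
  /-- the graph `H` -/
  graph : SimpleGraph V
  /-- the number `v_G` of root vertices -/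
  numRoots : ℕ
  /-- the labelling of the root vertices -/
  root : Fin numRoots ↪ V

namespace RootedGraph

variable {V : Type*}

/-- The induced subgraph `G` of `H` spanned by the root vertices. -/
def rootSubgraph (R : RootedGraph V) : R.graph.Subgraph :=
  (⊤ : R.graph.Subgraph).induce (Set.range R.root)

/-- The density `d(G, J) = (e_J - e_G) / (v_J - v_G)`. -/
noncomputable def density (R : RootedGraph V) (J : R.graph.Subgraph) : ℚ :=
  ((J.edgeSet.ncard : ℚ) - (R.rootSubgraph.edgeSet.ncard : ℚ)) /
    ((J.verts.ncard : ℚ) - (R.rootSubgraph.verts.ncard : ℚ))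

/-- `(G, H)` is strictly balanced if `d(G, J) < d(G, H)` for all `G ⊊ J ⊊ H`. -/
def StrictlyBalanced (R : RootedGraph V) : Prop :=
  ∀ J : R.graph.Subgraph, R.rootSubgraph < J → J < ⊤ → R.density J < R.density ⊤

/-- `(G, H)` is grounded if some root vertex is adjacent to some non-root vertex. -/
def Grounded (R : RootedGraph V) : Prop :=
  ∃ (j : Fin R.numRoots) (w : V), w ∉ Set.range R.root ∧ R.graph.Adj (R.root j) w

/-- The graph `H_G = (V(H), E(H) \ E(G))`. -/
def extensionGraph (R : RootedGraph V) : SimpleGraph V :=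
  R.graph.deleteEdges R.rootSubgraph.edgeSet

/-- The `(G, H)`-extensions of the tuple `x` in the graph `Γ`: the copies of `H_G` in `Γ` (unlabelled,
that is, as subgraphs of `Γ`) in which the `j`-th root is mapped onto `x j` for every `j`. -/
def extensions (R : RootedGraph V) {n : ℕ} (Γ : SimpleGraph (Fin n))
    (x : Fin R.numRoots ↪ Fin n) : Set Γ.Subgraph :=
  {S | ∃ f : Copy R.extensionGraph Γ, (∀ j, f (R.root j) = x j) ∧ f.toSubgraph = S}

/-- The extension count `X_x` of the root tuple `x` in the graph `Γ`. -/
noncomputable def extensionCount (R : RootedGraph V) {n : ℕ} (Γ : SimpleGraph (Fin n))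
    (x : Fin R.numRoots ↪ Fin n) : ℕ :=
  (R.extensions Γ x).ncard

/-- The expected extension count `μ = 𝔼 X_x` in the binomial random graph `G(n, p)`. It is computed
at the first root tuple, and does not depend on the root tuple by `integral_extensionCount`
(if `n` is smaller than the number of roots there is no root tuple). -/
noncomputable def mu (R : RootedGraph V) (n : ℕ) (p : unitInterval) : ℝ :=
  if h : R.numRoots ≤ n then
    ∫ Γ, (R.extensionCount Γ (Fin.castLEEmb h) : ℝ) ∂(binomialRandom (Fin n) p)
  else 0

theorem extensionCount_le_map (R : RootedGraph V) {n : ℕ} (σ : Equiv.Perm (Fin n))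
    (Γ : SimpleGraph (Fin n)) (x : Fin R.numRoots ↪ Fin n) :
    R.extensionCount Γ x ≤
      R.extensionCount (Γ.map σ.toEmbedding) (x.trans σ.toEmbedding) := by
  classical
  set φ : Γ ≃g Γ.map σ.toEmbedding := SimpleGraph.Iso.map σ Γ with hφ
  refine Set.ncard_le_ncard_of_injOn (fun S : Γ.Subgraph => S.map φ.toHom) ?_ ?_ (Set.toFinite _)
  · rintro S ⟨f, hf, rfl⟩
    refine ⟨φ.toCopy.comp f, fun j => ?_, ?_⟩
    · change φ (f (R.root j)) = _
      rw [hf]; rfl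
    · simp only [Copy.toSubgraph, ← Subgraph.map_comp]
      rfl
  · intro S _ T _ h
    have hv : φ '' S.verts = φ '' T.verts := congrArg Subgraph.verts h
    have ha : ∀ a b, (S.map φ.toHom).Adj (φ a) (φ b) ↔ (T.map φ.toHom).Adj (φ a) (φ b) := by
      intro a b
      rw [show S.map φ.toHom = T.map φ.toHom from h]
    refine Subgraph.ext (Set.image_injective.2 φ.injective hv) ?_
    ext a b
    have hmap : ∀ U : Γ.Subgraph, (U.map φ.toHom).Adj (φ a) (φ b) ↔ U.Adj a b := fun U =>
      Relation.map_apply_apply φ.injective φ.injective U.Adj a b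
    rw [← hmap S, ← hmap T]
    exact ha a b

theorem extensionCount_map (R : RootedGraph V) {n : ℕ} (σ : Equiv.Perm (Fin n))
    (Γ : SimpleGraph (Fin n)) (x : Fin R.numRoots ↪ Fin n) :
    R.extensionCount (Γ.map σ.toEmbedding) (x.trans σ.toEmbedding) = R.extensionCount Γ x := by
  refine le_antisymm ?_ (R.extensionCount_le_map σ Γ x)
  have h := R.extensionCount_le_map σ.symm (Γ.map σ.toEmbedding) (x.trans σ.toEmbedding)
  have h1 : (Γ.map σ.toEmbedding).map σ.symm.toEmbedding = Γ := by
    rw [SimpleGraph.map_map]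
    convert SimpleGraph.map_id (G := Γ) using 2
    ext; simp
  have h2 : (x.trans σ.toEmbedding).trans σ.symm.toEmbedding = x := by
    ext; simp
  rwa [h1, h2] at h

/-- The expected extension count is the same for all root tuples. -/
theorem integral_extensionCount (R : RootedGraph V) {n : ℕ} (p : unitInterval)
    (x : Fin R.numRoots ↪ Fin n) :
    ∫ Γ, (R.extensionCount Γ x : ℝ) ∂(binomialRandom (Fin n) p) = R.mu n p := by
  classical
  have h : R.numRoots ≤ n := by simpa using Fintype.card_le_of_embedding x
  rw [mu, dif_pos h]
  obtain ⟨σ, hσ⟩ : ∃ σ : Equiv.Perm (Fin n), (Fin.castLEEmb h).trans σ.toEmbedding = x := by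
    let e : Set.range (Fin.castLEEmb h) ≃ Set.range x :=
      (Equiv.ofInjective _ (Fin.castLEEmb h).injective).symm.trans (Equiv.ofInjective _ x.injective)
    refine ⟨e.extendSubtype, ?_⟩
    ext j
    have := e.extendSubtype_apply_of_mem (Fin.castLEEmb h j) ⟨j, rfl⟩
    have h3 : (Equiv.ofInjective _ (Fin.castLEEmb h).injective).symm
        ⟨Fin.castLEEmb h j, ⟨j, rfl⟩⟩ = j := Equiv.ofInjective_symm_apply _ j
    change ((e.extendSubtype (Fin.castLEEmb h j) : Fin n) : ℕ) = _
    rw [this]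
    simp only [e, Equiv.trans_apply]
    rw [h3]
    rfl
  have hsing : MeasurableSingletonClass (SimpleGraph (Fin n)) := ⟨fun Γ => by
    rw [← measurableEmbedding_edgeSet.measurableSet_image]
    simp⟩
  have hfin : Fintype (SimpleGraph (Fin n)) := Fintype.ofFinite _
  rw [integral_fintype .of_finite, integral_fintype .of_finite]
  symm
  refine Fintype.sum_equiv σ.simpleGraph _ _ fun Γ => ?_
  have hΓ : σ.simpleGraph Γ = Γ.map σ.toEmbedding := by
    exact SimpleGraph.comap_symm Γ σ
  rw [hΓ, ← hσ, extensionCount_map]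
  congr 1
  have hc : (Γ.map σ.toEmbedding).edgeSet.ncard = Γ.edgeSet.ncard := by
    rw [← Nat.card_coe_set_eq, ← Nat.card_coe_set_eq]
    exact (Nat.card_congr (SimpleGraph.Iso.map σ Γ).mapEdgeSet).symm
  simp only [Measure.real, binomialRandom_singleton, hc]

/-- The probability that `max_x |X_x - μ| < ε μ` in `G(n, p)`, the maximum being over all tuples `x`
of distinct vertices. -/
noncomputable def concentrationProb (R : RootedGraph V) (n : ℕ) (p : unitInterval) (ε : ℝ) : ℝ :=
  (binomialRandom (Fin n) p).real
    {Γ | ∀ x : Fin R.numRoots ↪ Fin n, |(R.extensionCount Γ x : ℝ) - R.mu n p| < ε * R.mu n p}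

/-- `K` is an admissible constant for `ε`: the condition `μ ≥ K log n` suffices for
`max_x |X_x - μ| < ε μ` to hold with probability tending to one. -/
def SufficientConstant (R : RootedGraph V) (ε K : ℝ) : Prop :=
  ∀ p : ℕ → unitInterval, (∀ᶠ n : ℕ in atTop, K * Real.log n ≤ R.mu n (p n)) →
    Tendsto (fun n : ℕ => R.concentrationProb n (p n) ε) atTop (𝓝 1)

end RootedGraph

/-! Let `v` and `e` be the numbers of non-root vertices and of edges outside `G`, and put `Λ = n ^ v
* p ^ e`, which equals `μ` up to constants. No non-root vertex is isolated in the extension graph,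
so an extension is determined by its edge set. Hence `X_x` counts the members of a family of
`e`-element sets contained in a random set with independent elements.

Everything rests on one consequence of strict balance. If an extension meets a given bounded
structure in `w ≥ 1` non-root vertices and `S` edges, and is not contained in it, then `S * v < e *
w`. By integrality, `n ^ w * p ^ S` is then at least a fixed power `n ^ gap`, provided `Λ ≥ n ^
(-gap)`. Conditionally on one extension, the others that overlap it therefore have total weight only
`O(Λ * n ^ (-gap))`. This single estimate feeds four tools: - Janson's inequality for the lower
tail; - a moment bound for the upper tail, counting sequences of edge-disjoint extensions while the
number of extensions through one edge is bounded by the same counting method; - Chebyshev's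
inequality; - a Chen–Stein bound that compares point probabilities with Poisson weights, also
jointly with a second count.

Grounded case. If `ε ^ 2 * μ ≥ C * log n`, both tails are `O(n ^ (-v_G - 1))`, and a union bound
over at most `n ^ v_G` tuples suffices. If `ε ^ 2 * μ ≤ c * log n`, then `μ` is at most a small
power of `n`, and some integer `k` with `|k - μ| ≥ ε * μ` has Poisson weight at least a small
negative power of `n`. About `n / v_G` disjoint root tuples have nearly uncorrelated counts, because
a grounded extension uses its roots and so disjoint tuples share few extensions. By the second
moment method some count equals `k`.

Case that is not grounded. The extensions of `x` are then copies of a fixed graph that avoid `x`, so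
two counts differ only by copies through the root vertices, and few copies share a vertex.
Concentration of one count, by Chebyshev, gives concentration of all. Conversely, let `ε ^ 2 * μ →
0`. If `ε * μ ≥ 1/2`, the allowed window contains `O(ε * μ)` integers of probability about `1 / √μ`
each. Otherwise all counts are equal and positive, which forces at least about `n` copies, far above
the mean.

Optimality of `ε ^ (-2)` follows by choosing `p` with `μ = K' * log n` for some `K'` between `K` and
`c / ε ^ 2`. -/

namespace BernoulliSet

/-! ### Expectation and probability for a random set with independent elements -/

set_option linter.unusedSectionVars false

variable {ι : Type*} [Fintype ι] [DecidableEq ι]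

/-- The weight of `s` in the random set containing each `i` independently with probability `π i`. -/
noncomputable def weight (π : ι → ℝ) (s : Finset ι) : ℝ := ∏ i, if i ∈ s then π i else 1 - π i

/-- Expectation with respect to the random set with marginals `π`. -/
noncomputable def expect (π : ι → ℝ) (F : Finset ι → ℝ) : ℝ := ∑ s, weight π s * F s

/-- Probability with respect to the random set with marginals `π`. -/
noncomputable def prob (π : ι → ℝ) (A : Set (Finset ι)) : ℝ := expect π (A.indicator fun _ => 1)

theorem weight_nonneg {π : ι → ℝ} (hπ : ∀ i, π i ∈ Set.Icc (0 : ℝ) 1) (s : Finset ι) :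
    0 ≤ weight π s :=
  Finset.prod_nonneg fun i _ => by
    have := hπ i
    split_ifs
    · exact this.1
    · linarith [this.2]

theorem sum_weight (π : ι → ℝ) : ∑ s, weight π s = 1 := by
  have h := Finset.prod_add π (fun i => 1 - π i) Finset.univ
  simp only [add_sub_cancel, Finset.prod_const_one, Finset.powerset_univ] at h
  rw [h]
  refine Finset.sum_congr rfl fun s _ => ?_
  rw [weight, Finset.prod_ite]
  congr 1
  · exact Finset.prod_congr (by ext; simp) fun _ _ => rfl
  · exact Finset.prod_congr (by ext; simp) fun _ _ => rfl

theorem expect_const (π : ι → ℝ) (c : ℝ) : expect π (fun _ => c) = c := by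
  rw [expect, ← Finset.sum_mul, sum_weight, one_mul]

theorem expect_add (π : ι → ℝ) (F G : Finset ι → ℝ) :
    expect π (fun s => F s + G s) = expect π F + expect π G := by
  simp only [expect, mul_add, Finset.sum_add_distrib]

theorem expect_sub (π : ι → ℝ) (F G : Finset ι → ℝ) :
    expect π (fun s => F s - G s) = expect π F - expect π G := by
  simp only [expect, mul_sub, Finset.sum_sub_distrib]

theorem expect_mul_left (π : ι → ℝ) (c : ℝ) (F : Finset ι → ℝ) :
    expect π (fun s => c * F s) = c * expect π F := by
  simp only [expect, Finset.mul_sum]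
  exact Finset.sum_congr rfl fun _ _ => by ring

theorem expect_mul_right (π : ι → ℝ) (c : ℝ) (F : Finset ι → ℝ) :
    expect π (fun s => F s * c) = expect π F * c := by
  simp only [mul_comm _ c, expect_mul_left]

theorem expect_sum {κ : Type*} (π : ι → ℝ) (t : Finset κ) (F : κ → Finset ι → ℝ) :
    expect π (fun s => ∑ k ∈ t, F k s) = ∑ k ∈ t, expect π (F k) := by
  simp only [expect, Finset.mul_sum]
  exact Finset.sum_comm

theorem expect_mono {π : ι → ℝ} (hπ : ∀ i, π i ∈ Set.Icc (0 : ℝ) 1) {F G : Finset ι → ℝ}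
    (h : ∀ s, F s ≤ G s) : expect π F ≤ expect π G :=
  Finset.sum_le_sum fun s _ => mul_le_mul_of_nonneg_left (h s) (weight_nonneg hπ s)

theorem expect_nonneg {π : ι → ℝ} (hπ : ∀ i, π i ∈ Set.Icc (0 : ℝ) 1) {F : Finset ι → ℝ}
    (h : ∀ s, 0 ≤ F s) : 0 ≤ expect π F :=
  Finset.sum_nonneg fun s _ => mul_nonneg (weight_nonneg hπ s) (h s)

theorem abs_expect_le {π : ι → ℝ} (hπ : ∀ i, π i ∈ Set.Icc (0 : ℝ) 1) (F : Finset ι → ℝ) :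
    |expect π F| ≤ expect π (fun s => |F s|) := by
  refine (Finset.abs_sum_le_sum_abs _ _).trans (Finset.sum_le_sum fun s _ => ?_)
  rw [abs_mul, abs_of_nonneg (weight_nonneg hπ s)]

theorem prob_nonneg {π : ι → ℝ} (hπ : ∀ i, π i ∈ Set.Icc (0 : ℝ) 1) (A : Set (Finset ι)) :
    0 ≤ prob π A :=
  expect_nonneg hπ fun s => Set.indicator_nonneg (fun _ _ => zero_le_one) s

theorem prob_mono {π : ι → ℝ} (hπ : ∀ i, π i ∈ Set.Icc (0 : ℝ) 1) {A B : Set (Finset ι)}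
    (h : A ⊆ B) : prob π A ≤ prob π B :=
  expect_mono hπ fun s => Set.indicator_le_indicator_of_subset h (fun _ => zero_le_one) s

theorem prob_le_one {π : ι → ℝ} (hπ : ∀ i, π i ∈ Set.Icc (0 : ℝ) 1) (A : Set (Finset ι)) :
    prob π A ≤ 1 := by
  refine (expect_mono hπ (G := fun _ => 1) fun s => ?_).trans (expect_const π 1).le
  exact Set.indicator_le_self' (fun _ _ => zero_le_one) s

theorem prob_union_le {π : ι → ℝ} (hπ : ∀ i, π i ∈ Set.Icc (0 : ℝ) 1) (A B : Set (Finset ι)) :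
    prob π (A ∪ B) ≤ prob π A + prob π B := by
  rw [prob, prob, prob, ← expect_add]
  refine expect_mono hπ fun s => ?_
  by_cases hA : s ∈ A <;> by_cases hB : s ∈ B <;> simp [hA, hB]

theorem prob_biUnion_le {κ : Type*} {π : ι → ℝ} (hπ : ∀ i, π i ∈ Set.Icc (0 : ℝ) 1)
    (t : Finset κ) (A : κ → Set (Finset ι)) :
    prob π {s | ∃ k ∈ t, s ∈ A k} ≤ ∑ k ∈ t, prob π (A k) := by
  simp only [prob]
  rw [← expect_sum]
  refine expect_mono hπ fun s => ?_
  by_cases h : ∃ k ∈ t, s ∈ A k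
  · obtain ⟨k, hk, hs⟩ := h
    rw [Set.indicator_of_mem (show s ∈ {s | ∃ k ∈ t, s ∈ A k} from ⟨k, hk, hs⟩)]
    have := Finset.single_le_sum (f := fun k => (A k).indicator (fun _ => (1 : ℝ)) s)
      (fun k _ => Set.indicator_nonneg (fun _ _ => zero_le_one) s) hk
    simpa [hs] using this
  · rw [Set.indicator_of_notMem (show s ∉ {s | ∃ k ∈ t, s ∈ A k} from h)]
    exact Finset.sum_nonneg fun k _ => Set.indicator_nonneg (fun _ _ => zero_le_one) s

theorem prob_compl (π : ι → ℝ) (A : Set (Finset ι)) : prob π Aᶜ = 1 - prob π A := by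
  rw [prob, prob, ← expect_const π 1, ← expect_sub]
  congr 1
  ext s
  by_cases hA : s ∈ A <;> simp [hA, expect_const]

/-- Markov's inequality. -/
theorem prob_mul_le_expect {π : ι → ℝ} (hπ : ∀ i, π i ∈ Set.Icc (0 : ℝ) 1) {A : Set (Finset ι)}
    {F : Finset ι → ℝ} {c : ℝ} (hF : ∀ s, 0 ≤ F s) (h : ∀ s ∈ A, c ≤ F s) :
    prob π A * c ≤ expect π F := by
  rw [prob, ← expect_mul_right]
  refine expect_mono hπ fun s => ?_
  by_cases hA : s ∈ A
  · simpa [hA] using h s hA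
  · simpa [hA] using hF s

/-- The factor of the weight at `a` splits off. Summing over pairs consisting of a set containing
`a` and the same set without `a`, the two factors `π a` and `1 - π a` add up to one on the right. -/
theorem expect_ite_mem (π : ι → ℝ) (a : ι) (F : Finset ι → ℝ) :
    expect π (fun s => if a ∈ s then F s else 0) = π a * expect π (fun s => F (insert a s)) := by
  set r : Finset ι → ℝ := fun s => ∏ i ∈ Finset.univ.erase a, if i ∈ s then π i else 1 - π i with hr
  have hw : ∀ s, weight π s = (if a ∈ s then π a else 1 - π a) * r s := fun s =>
    (Finset.mul_prod_erase _ _ (Finset.mem_univ a)).symm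
  have hri : ∀ s, r (insert a s) = r s := fun s =>
    Finset.prod_congr rfl fun i hi => by
      have : i ≠ a := Finset.ne_of_mem_erase hi
      simp [this]
  simp only [expect, hw]
  have h1 : ∀ G : Finset ι → ℝ, ∑ s, G s =
      ∑ s ∈ Finset.univ.filter (a ∈ ·), (G s + G (s.erase a)) := fun G => by
    rw [← Finset.sum_filter_add_sum_filter_not Finset.univ (a ∈ ·) G, Finset.sum_add_distrib]
    congr 1
    refine Finset.sum_nbij' (fun s => insert a s) (fun s => s.erase a) ?_ ?_ ?_ ?_ ?_ <;>
      simp +contextual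
  rw [h1, h1, Finset.mul_sum]
  refine Finset.sum_congr rfl fun s hs => ?_
  have ha : a ∈ s := (Finset.mem_filter.1 hs).2
  have hre : r (s.erase a) = r s := by rw [← hri, Finset.insert_erase ha]
  simp only [ha, if_true, Finset.notMem_erase, if_false, mul_zero, add_zero, hre,
    Finset.insert_eq_of_mem, Finset.insert_erase ha]
  ring

/-- Conditioning on `S ⊆ s` amounts to adding `S` to the random set. -/
theorem expect_ite_subset (π : ι → ℝ) (S : Finset ι) (F : Finset ι → ℝ) :
    expect π (fun s => if S ⊆ s then F s else 0) =
      (∏ i ∈ S, π i) * expect π (fun s => F (s ∪ S)) := by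
  induction S using Finset.induction_on generalizing F with
  | empty => simp
  | insert a S ha ih =>
    rw [Finset.prod_insert ha]
    have : (fun s => if insert a S ⊆ s then F s else 0) =
        fun s => if a ∈ s then (if S ⊆ s then F s else 0) else 0 := by
      ext s
      simp only [Finset.insert_subset_iff]
      split_ifs <;> simp_all
    rw [this, expect_ite_mem]
    have : (fun s => if S ⊆ insert a s then F (insert a s) else 0) =
        fun s => if S ⊆ s then F (insert a s) else 0 := by
      ext s
      simp only [Finset.subset_insert_iff_of_notMem ha]
    rw [this, ih, mul_assoc]
    simp only [Finset.union_insert]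

/-- At each coordinate both sides have the same two factors. This is the lattice condition of the
FKG inequality, with equality. -/
theorem weight_mul_weight (π : ι → ℝ) (s t : Finset ι) :
    weight π s * weight π t = weight π (s ⊓ t) * weight π (s ⊔ t) := by
  simp only [weight, ← Finset.prod_mul_distrib]
  refine Finset.prod_congr rfl fun i _ => ?_
  by_cases hs : i ∈ s <;> by_cases ht : i ∈ t <;> simp [hs, ht, mul_comm]

/-- Harris's inequality for decreasing functions with values at most `1`. -/
theorem expect_mul_expect_le {π : ι → ℝ} (hπ : ∀ i, π i ∈ Set.Icc (0 : ℝ) 1)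
    {F G : Finset ι → ℝ} (hF : Antitone F) (hG : Antitone G) (hF1 : ∀ s, F s ≤ 1)
    (hG1 : ∀ s, G s ≤ 1) : expect π F * expect π G ≤ expect π (fun s => F s * G s) := by
  -- `fkg` needs nonnegative monotone functions, hence the passage to `1 - F` and `1 - G`; this is
  -- where the bound by one enters.
  have h := fkg (μ := weight π) (f := fun s => 1 - F s) (g := fun s => 1 - G s) (weight_nonneg hπ)
    (fun s => sub_nonneg.2 (hF1 s)) (fun s => sub_nonneg.2 (hG1 s))
    (fun s t hst => sub_le_sub_left (hF hst) 1) (fun s t hst => sub_le_sub_left (hG hst) 1)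
    (fun s t => (weight_mul_weight π s t).le)
  rw [sum_weight, one_mul] at h
  change expect π (fun s => 1 - F s) * expect π (fun s => 1 - G s) ≤
    expect π (fun s => (1 - F s) * (1 - G s)) at h
  have h2 : (fun s => (1 - F s) * (1 - G s)) = fun s => 1 - F s - (G s - F s * G s) := by
    ext s; ring
  rw [h2, expect_sub, expect_sub, expect_sub, expect_sub π G, expect_const, expect_sub] at h
  rw [expect_const] at h
  nlinarith

/-! ### Counting the members of a family: Chen–Stein estimate, variance, Janson's inequality -/

/-- The number of members of the family `𝓕` contained in `s`. -/
def numIn (𝓕 : Finset (Finset ι)) (s : Finset ι) : ℕ := (𝓕.filter (· ⊆ s)).card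

/-- The probability `∏ i ∈ S, π i` that the random set contains `S`. -/
noncomputable def wt (π : ι → ℝ) (S : Finset ι) : ℝ := ∏ i ∈ S, π i

theorem wt_nonneg {π : ι → ℝ} (hπ : ∀ i, π i ∈ Set.Icc (0 : ℝ) 1) (S : Finset ι) : 0 ≤ wt π S :=
  Finset.prod_nonneg fun i _ => (hπ i).1

theorem wt_le_one {π : ι → ℝ} (hπ : ∀ i, π i ∈ Set.Icc (0 : ℝ) 1) (S : Finset ι) : wt π S ≤ 1 :=
  Finset.prod_le_one (fun i _ => (hπ i).1) fun i _ => (hπ i).2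

theorem wt_union_of_disjoint (π : ι → ℝ) {S T : Finset ι} (h : Disjoint S T) :
    wt π (S ∪ T) = wt π S * wt π T := Finset.prod_union h

theorem wt_union (π : ι → ℝ) (S T : Finset ι) : wt π (S ∪ T) = wt π S * wt π (T \ S) := by
  rw [← Finset.union_sdiff_self_eq_union, wt_union_of_disjoint π Finset.disjoint_sdiff]

theorem numIn_eq_sum (𝓕 : Finset (Finset ι)) (s : Finset ι) :
    (numIn 𝓕 s : ℝ) = ∑ i ∈ 𝓕, if i ⊆ s then (1 : ℝ) else 0 := by
  simp [numIn]

theorem numIn_mono (𝓕 : Finset (Finset ι)) {s t : Finset ι} (h : s ⊆ t) :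
    numIn 𝓕 s ≤ numIn 𝓕 t :=
  Finset.card_le_card fun j hj => by
    rw [Finset.mem_filter] at hj ⊢
    exact ⟨hj.1, hj.2.trans h⟩

theorem expect_ite_subset_one (π : ι → ℝ) (S : Finset ι) :
    expect π (fun s => if S ⊆ s then (1 : ℝ) else 0) = wt π S := by
  rw [expect_ite_subset, expect_const, mul_one, wt]

theorem expect_numIn (π : ι → ℝ) (𝓕 : Finset (Finset ι)) :
    expect π (fun s => (numIn 𝓕 s : ℝ)) = ∑ i ∈ 𝓕, wt π i := by
  simp only [numIn_eq_sum, expect_sum, expect_ite_subset_one]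

/-- Since conditioning on `i ⊆ s` amounts to adding `i`, this is the product rule for the event that
both `i` and `j` are present. -/
theorem wt_mul_expect_subset_union (π : ι → ℝ) (i j : Finset ι) :
    wt π i * expect π (fun s => if j ⊆ s ∪ i then (1 : ℝ) else 0) = wt π (i ∪ j) := by
  rw [wt, ← expect_ite_subset π i fun s => if j ⊆ s then (1 : ℝ) else 0, ← expect_ite_subset_one]
  congr 1
  ext s
  simp only [Finset.union_subset_iff]
  split_ifs <;> simp_all

/-- The total weight of the pairs of overlapping members of `𝓕` and `𝓖`, for a given `i`. -/
noncomputable def overlap (π : ι → ℝ) (𝓖 : Finset (Finset ι)) (i : Finset ι) : ℝ :=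
  ∑ j ∈ 𝓖 with ¬Disjoint i j, wt π (i ∪ j)

/-- Adding `i` can complete only those members that meet `i`, and the hypothesis excludes them. -/
theorem numIn_union_eq_of_forall {𝓖 : Finset (Finset ι)} {s i : Finset ι}
    (h : ∀ j ∈ 𝓖, ¬Disjoint i j → ¬j ⊆ s ∪ i) : numIn 𝓖 (s ∪ i) = numIn 𝓖 s := by
  refine congrArg Finset.card (Finset.filter_congr fun j hj => ⟨fun hjs => ?_, fun hjs =>
    hjs.trans Finset.subset_union_left⟩)
  by_cases hd : Disjoint i j
  · exact (hd.symm.left_le_of_le_sup_right hjs)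
  · exact absurd hjs (h j hj hd)

theorem numIn_union_of_mem {𝓕 : Finset (Finset ι)} {s i : Finset ι} (hi : i ∈ 𝓕) (his : ¬i ⊆ s)
    (h : ∀ j ∈ 𝓕.erase i, ¬Disjoint i j → ¬j ⊆ s ∪ i) : numIn 𝓕 (s ∪ i) = numIn 𝓕 s + 1 := by
  have h1 : ∀ t, numIn 𝓕 t = numIn (𝓕.erase i) t + if i ⊆ t then 1 else 0 := fun t => by
    unfold numIn
    conv_lhs => rw [← Finset.insert_erase hi, Finset.filter_insert]
    split_ifs with hit
    · rw [Finset.card_insert_of_notMem (by simp)]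
    · rfl
  rw [h1, h1 s, numIn_union_eq_of_forall h]
  simp [his]

/-- The Chen–Stein estimate for the number of members of `𝓕` in the random set, jointly with the
number of members of another family `𝓖`. -/
theorem abs_expect_stein_le {π : ι → ℝ} (hπ : ∀ i, π i ∈ Set.Icc (0 : ℝ) 1)
    (𝓕 𝓖 : Finset (Finset ι)) {f g : ℕ → ℝ} {M : ℝ} (hf : ∀ k, |f k| ≤ M) (hg : ∀ k, |g k| ≤ 1) :
    |expect π (fun s => g (numIn 𝓖 s) * ((∑ i ∈ 𝓕, wt π i) * f (numIn 𝓕 s + 1) -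
        numIn 𝓕 s * f (numIn 𝓕 s)))| ≤
      2 * M * ∑ i ∈ 𝓕, (overlap π (𝓕.erase i) i + wt π i ^ 2 + overlap π 𝓖 i) := by
  have hM : 0 ≤ M := (abs_nonneg _).trans (hf 0)
  -- The factor `numIn 𝓕 s` is a sum of indicators of `i ⊆ s`, and each indicator is traded for the
  -- weight of `i` and the coupled set `s ∪ i`.
  have key : expect π (fun s => g (numIn 𝓖 s) * ((∑ i ∈ 𝓕, wt π i) * f (numIn 𝓕 s + 1) -
        numIn 𝓕 s * f (numIn 𝓕 s))) =
      ∑ i ∈ 𝓕, wt π i * expect π (fun s => g (numIn 𝓖 s) * f (numIn 𝓕 s + 1) -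
        g (numIn 𝓖 (s ∪ i)) * f (numIn 𝓕 (s ∪ i))) := by
    simp only [expect_sub, mul_sub]
    rw [Finset.sum_sub_distrib]
    congr 1
    · rw [← Finset.sum_mul, ← expect_mul_left]
      congr 1; ext s; ring
    · have h1 : ∀ i ∈ 𝓕, wt π i * expect π (fun s => g (numIn 𝓖 (s ∪ i)) * f (numIn 𝓕 (s ∪ i))) =
          expect π (fun s => if i ⊆ s then g (numIn 𝓖 s) * f (numIn 𝓕 s) else 0) := fun i _ =>
        (expect_ite_subset π i fun s => g (numIn 𝓖 s) * f (numIn 𝓕 s)).symm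
      rw [Finset.sum_congr rfl h1, ← expect_sum]
      congr 1; ext s
      rw [numIn_eq_sum, Finset.sum_mul, Finset.mul_sum]
      refine Finset.sum_congr rfl fun i _ => ?_
      split_ifs <;> ring
  rw [key, Finset.mul_sum]
  refine (Finset.abs_sum_le_sum_abs _ _).trans (Finset.sum_le_sum fun i hi => ?_)
  rw [abs_mul, abs_of_nonneg (wt_nonneg hπ i)]
  -- The two terms coincide unless `i` is already present or adding `i` completes another member
  -- that meets `i`. In each exceptional case one of the counts on the right is at least one, and
  -- the trivial bound `2 * M` applies.
  have hpt : ∀ s, |g (numIn 𝓖 s) * f (numIn 𝓕 s + 1) - g (numIn 𝓖 (s ∪ i)) * f (numIn 𝓕 (s ∪ i))| ≤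
      2 * M * ((∑ j ∈ (𝓕.erase i) with ¬Disjoint i j, if j ⊆ s ∪ i then (1 : ℝ) else 0) +
        (if i ⊆ s then 1 else 0) + ∑ j ∈ 𝓖 with ¬Disjoint i j, if j ⊆ s ∪ i then (1 : ℝ) else 0) := by
    intro s
    have hn1 : ∀ 𝓗 : Finset (Finset ι), 0 ≤ ∑ j ∈ 𝓗, if j ⊆ s ∪ i then (1 : ℝ) else 0 := fun 𝓗 =>
      Finset.sum_nonneg fun _ _ => by positivity
    have hn2 : (0 : ℝ) ≤ if i ⊆ s then 1 else 0 := by positivity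
    have hbd : |g (numIn 𝓖 s) * f (numIn 𝓕 s + 1) -
        g (numIn 𝓖 (s ∪ i)) * f (numIn 𝓕 (s ∪ i))| ≤ 2 * M := by
      have h2 : ∀ a b, |g a * f b| ≤ M := fun a b => by
        rw [abs_mul]
        calc |g a| * |f b| ≤ 1 * M := mul_le_mul (hg a) (hf b) (abs_nonneg _) zero_le_one
          _ = M := one_mul M
      calc _ ≤ |g (numIn 𝓖 s) * f (numIn 𝓕 s + 1)| +
            |g (numIn 𝓖 (s ∪ i)) * f (numIn 𝓕 (s ∪ i))| := abs_sub _ _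
        _ ≤ 2 * M := by linarith [h2 (numIn 𝓖 s) (numIn 𝓕 s + 1), h2 (numIn 𝓖 (s ∪ i)) (numIn 𝓕 (s ∪ i))]
    have hone : ∀ 𝓗 : Finset (Finset ι), ∀ j ∈ 𝓗, j ⊆ s ∪ i →
        1 ≤ ∑ j ∈ 𝓗, if j ⊆ s ∪ i then (1 : ℝ) else 0 := fun 𝓗 j hj hjs => by
      have := Finset.single_le_sum (f := fun j => if j ⊆ s ∪ i then (1 : ℝ) else 0)
        (fun _ _ => by positivity) hj
      simpa [hjs] using this
    have hlarge : ∀ x : ℝ, 1 ≤ x → |g (numIn 𝓖 s) * f (numIn 𝓕 s + 1) -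
        g (numIn 𝓖 (s ∪ i)) * f (numIn 𝓕 (s ∪ i))| ≤ 2 * M * x := fun x hx =>
      hbd.trans (by nlinarith)
    by_cases his : i ⊆ s
    · refine hlarge _ ?_
      simp only [his, if_true]
      linarith [hn1 (𝓕.erase i |>.filter fun j => ¬Disjoint i j),
        hn1 (𝓖.filter fun j => ¬Disjoint i j)]
    by_cases h1 : ∃ j ∈ 𝓕.erase i, ¬Disjoint i j ∧ j ⊆ s ∪ i
    · obtain ⟨j, hj, hd, hjs⟩ := h1
      refine hlarge _ ?_
      linarith [hone (𝓕.erase i |>.filter fun j => ¬Disjoint i j) j (Finset.mem_filter.2 ⟨hj, hd⟩) hjs,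
        hn1 (𝓖.filter fun j => ¬Disjoint i j)]
    by_cases h2 : ∃ j ∈ 𝓖, ¬Disjoint i j ∧ j ⊆ s ∪ i
    · obtain ⟨j, hj, hd, hjs⟩ := h2
      refine hlarge _ ?_
      linarith [hone (𝓖.filter fun j => ¬Disjoint i j) j (Finset.mem_filter.2 ⟨hj, hd⟩) hjs,
        hn1 (𝓕.erase i |>.filter fun j => ¬Disjoint i j)]
    push Not at h1 h2
    rw [numIn_union_of_mem hi his h1, numIn_union_eq_of_forall h2, sub_self, abs_zero]
    have := hn1 (𝓕.erase i |>.filter fun j => ¬Disjoint i j)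
    have := hn1 (𝓖.filter fun j => ¬Disjoint i j)
    positivity
  calc wt π i * |expect π (fun s => g (numIn 𝓖 s) * f (numIn 𝓕 s + 1) -
          g (numIn 𝓖 (s ∪ i)) * f (numIn 𝓕 (s ∪ i)))|
      ≤ wt π i * expect π (fun s => 2 * M *
        ((∑ j ∈ (𝓕.erase i) with ¬Disjoint i j, if j ⊆ s ∪ i then (1 : ℝ) else 0) +
        (if i ⊆ s then 1 else 0) +
        ∑ j ∈ 𝓖 with ¬Disjoint i j, if j ⊆ s ∪ i then (1 : ℝ) else 0)) :=
        mul_le_mul_of_nonneg_left ((abs_expect_le hπ _).trans (expect_mono hπ hpt)) (wt_nonneg hπ i)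
    _ = 2 * M * (overlap π (𝓕.erase i) i + wt π i ^ 2 + overlap π 𝓖 i) := by
        rw [expect_mul_left, expect_add, expect_add, expect_sum, expect_sum,
          expect_ite_subset_one, mul_left_comm, mul_add (wt π i), mul_add (wt π i),
          Finset.mul_sum, Finset.mul_sum]
        simp only [wt_mul_expect_subset_union, overlap, pow_two]

/-- The variance of the number of members of `𝓕` in the random set. -/
theorem variance_numIn_le {π : ι → ℝ} (hπ : ∀ i, π i ∈ Set.Icc (0 : ℝ) 1)
    (𝓕 : Finset (Finset ι)) :
    expect π (fun s => ((numIn 𝓕 s : ℝ) - ∑ i ∈ 𝓕, wt π i) ^ 2) ≤ ∑ i ∈ 𝓕, overlap π 𝓕 i := by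
  have h1 : expect π (fun s => ((numIn 𝓕 s : ℝ) - ∑ i ∈ 𝓕, wt π i) ^ 2) =
      expect π (fun s => (numIn 𝓕 s : ℝ) * numIn 𝓕 s) - (∑ i ∈ 𝓕, wt π i) ^ 2 := by
    have : (fun s => ((numIn 𝓕 s : ℝ) - ∑ i ∈ 𝓕, wt π i) ^ 2) = fun s =>
        (numIn 𝓕 s : ℝ) * numIn 𝓕 s - (2 * (∑ i ∈ 𝓕, wt π i) * numIn 𝓕 s -
          (∑ i ∈ 𝓕, wt π i) ^ 2) := by ext s; ring
    rw [this, expect_sub, expect_sub, expect_mul_left, expect_numIn, expect_const]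
    ring
  have h2 : expect π (fun s => (numIn 𝓕 s : ℝ) * numIn 𝓕 s) =
      ∑ i ∈ 𝓕, ∑ j ∈ 𝓕, wt π (i ∪ j) := by
    simp only [numIn_eq_sum, Finset.sum_mul_sum, expect_sum]
    refine Finset.sum_congr rfl fun i _ => Finset.sum_congr rfl fun j _ => ?_
    rw [← expect_ite_subset_one]
    congr 1; ext s
    simp only [Finset.union_subset_iff]
    split_ifs <;> simp_all
  rw [h1, h2, pow_two, Finset.sum_mul_sum, ← Finset.sum_sub_distrib]
  refine Finset.sum_le_sum fun i _ => ?_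
  rw [← Finset.sum_sub_distrib, overlap, Finset.sum_filter]
  refine Finset.sum_le_sum fun j _ => ?_
  -- Disjoint pairs are independent and contribute nothing; for the others the product of the means
  -- is dropped.
  split_ifs with h
  · rw [wt_union_of_disjoint π h, sub_self]
  · linarith [mul_nonneg (wt_nonneg hπ i) (wt_nonneg hπ j)]

theorem numIn_union_split (𝓕 : Finset (Finset ι)) (s i : Finset ι) :
    numIn 𝓕 (s ∪ i) = numIn (𝓕.filter (Disjoint i)) s +
      numIn (𝓕.filter fun j => ¬Disjoint i j) (s ∪ i) := by
  have h : numIn (𝓕.filter (Disjoint i)) s = numIn (𝓕.filter (Disjoint i)) (s ∪ i) :=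
    (numIn_union_eq_of_forall fun j hj hd => absurd (Finset.mem_filter.1 hj).2 hd).symm
  rw [h]
  unfold numIn
  rw [Finset.filter_comm, Finset.filter_comm (fun j => ¬Disjoint i j),
    Finset.card_filter_add_card_filter_not]

theorem exp_neg_numIn_antitone (𝓕 : Finset (Finset ι)) {t : ℝ} (ht : 0 ≤ t) (i : Finset ι) :
    Antitone fun s => Real.exp (-t * numIn 𝓕 (s ∪ i)) := fun s u h => by
  refine Real.exp_le_exp.2 ?_
  have : (numIn 𝓕 (s ∪ i) : ℝ) ≤ numIn 𝓕 (u ∪ i) :=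
    Nat.cast_le.2 (numIn_mono 𝓕 (Finset.union_subset_union_left h))
  nlinarith

theorem exp_neg_numIn_le_one (𝓕 : Finset (Finset ι)) {t : ℝ} (ht : 0 ≤ t) (s : Finset ι) :
    Real.exp (-t * numIn 𝓕 s) ≤ 1 := by
  rw [Real.exp_le_one_iff]
  have : (0 : ℝ) ≤ numIn 𝓕 s := Nat.cast_nonneg _
  nlinarith

/-- The differential inequality behind Janson's inequality. -/
theorem mul_expect_exp_le {π : ι → ℝ} (hπ : ∀ i, π i ∈ Set.Icc (0 : ℝ) 1)
    (𝓕 : Finset (Finset ι)) {t : ℝ} (ht : 0 ≤ t) :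
    (∑ i ∈ 𝓕, wt π i - t * ∑ i ∈ 𝓕, overlap π 𝓕 i) * expect π (fun s => Real.exp (-t * numIn 𝓕 s)) ≤
      expect π (fun s => numIn 𝓕 s * Real.exp (-t * numIn 𝓕 s)) := by
  have h1 : expect π (fun s => numIn 𝓕 s * Real.exp (-t * numIn 𝓕 s)) =
      ∑ i ∈ 𝓕, wt π i * expect π (fun s => Real.exp (-t * numIn 𝓕 (s ∪ i))) := by
    have h1 : ∀ i ∈ 𝓕, wt π i * expect π (fun s => Real.exp (-t * numIn 𝓕 (s ∪ i))) =
        expect π (fun s => if i ⊆ s then Real.exp (-t * numIn 𝓕 s) else 0) := fun i _ =>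
      (expect_ite_subset π i fun s => Real.exp (-t * numIn 𝓕 s)).symm
    rw [Finset.sum_congr rfl h1, ← expect_sum]
    congr 1; ext s
    conv_lhs => rw [numIn_eq_sum, Finset.sum_mul]
    rw [← numIn_eq_sum]
    refine Finset.sum_congr rfl fun i _ => ?_
    split_ifs <;> ring
  rw [h1, Finset.mul_sum, ← Finset.sum_sub_distrib, Finset.sum_mul]
  refine Finset.sum_le_sum fun i _ => ?_
  set Φ := expect π (fun s => Real.exp (-t * numIn 𝓕 s)) with hΦ
  have hΦ0 : 0 ≤ Φ := expect_nonneg hπ fun s => (Real.exp_pos _).le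
  set 𝓐 := 𝓕.filter (Disjoint i)
  set 𝓑 := 𝓕.filter fun j => ¬Disjoint i j
  -- Members disjoint from `i` do not notice the added `i`. Harris's inequality decouples them from
  -- those that meet `i`, for which `exp (-y) ≥ 1 - y` is enough.
  have hsplit : (fun s => Real.exp (-t * numIn 𝓕 (s ∪ i))) =
      fun s => Real.exp (-t * numIn 𝓐 s) * Real.exp (-t * numIn 𝓑 (s ∪ i)) := by
    ext s
    rw [← Real.exp_add, show numIn 𝓕 (s ∪ i) = numIn 𝓐 s + numIn 𝓑 (s ∪ i) from
      numIn_union_split 𝓕 s i]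
    push_cast
    ring_nf
  have hA : Antitone fun s => Real.exp (-t * numIn 𝓐 s) := by
    simpa using exp_neg_numIn_antitone 𝓐 ht ∅
  have hH := expect_mul_expect_le hπ hA (exp_neg_numIn_antitone 𝓑 ht i)
    (exp_neg_numIn_le_one 𝓐 ht) (fun s => exp_neg_numIn_le_one 𝓑 ht _)
  rw [← hsplit] at hH
  have hAΦ : Φ ≤ expect π (fun s => Real.exp (-t * numIn 𝓐 s)) := by
    refine expect_mono hπ fun s => Real.exp_le_exp.2 ?_
    have : (numIn 𝓐 s : ℝ) ≤ numIn 𝓕 s := Nat.cast_le.2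
      (Finset.card_le_card (Finset.filter_subset_filter _ (Finset.filter_subset _ _)))
    nlinarith
  have hB : 1 - t * expect π (fun s => (numIn 𝓑 (s ∪ i) : ℝ)) ≤
      expect π (fun s => Real.exp (-t * numIn 𝓑 (s ∪ i))) := by
    rw [← expect_const π 1, ← expect_mul_left, ← expect_sub]
    refine expect_mono hπ fun s => ?_
    have := Real.add_one_le_exp (-t * numIn 𝓑 (s ∪ i))
    linarith
  have hB0 : 0 ≤ expect π (fun s => Real.exp (-t * numIn 𝓑 (s ∪ i))) :=
    expect_nonneg hπ fun s => (Real.exp_pos _).le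
  have hov : wt π i * expect π (fun s => (numIn 𝓑 (s ∪ i) : ℝ)) = overlap π 𝓕 i := by
    simp only [numIn_eq_sum, expect_sum, Finset.mul_sum, wt_mul_expect_subset_union, overlap, 𝓑]
  calc (wt π i - t * overlap π 𝓕 i) * Φ
      = wt π i * (Φ * (1 - t * expect π (fun s => (numIn 𝓑 (s ∪ i) : ℝ)))) := by rw [← hov]; ring
    _ ≤ wt π i * (Φ * expect π (fun s => Real.exp (-t * numIn 𝓑 (s ∪ i)))) := by
        have := wt_nonneg hπ i
        gcongr
    _ ≤ wt π i * (expect π (fun s => Real.exp (-t * numIn 𝓐 s)) *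
          expect π (fun s => Real.exp (-t * numIn 𝓑 (s ∪ i)))) := by
        have := wt_nonneg hπ i
        gcongr
    _ ≤ _ := mul_le_mul_of_nonneg_left hH (wt_nonneg hπ i)

/-- The Laplace transform bound behind Janson's inequality. -/
theorem expect_exp_neg_le {π : ι → ℝ} (hπ : ∀ i, π i ∈ Set.Icc (0 : ℝ) 1)
    (𝓕 : Finset (Finset ι)) {t : ℝ} (ht : 0 ≤ t) :
    expect π (fun s => Real.exp (-t * numIn 𝓕 s)) ≤
      Real.exp (-t * ∑ i ∈ 𝓕, wt π i + t ^ 2 * (∑ i ∈ 𝓕, overlap π 𝓕 i) / 2) := by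
  set μ := ∑ i ∈ 𝓕, wt π i
  set Δ := ∑ i ∈ 𝓕, overlap π 𝓕 i
  set Φ : ℝ → ℝ := fun t => expect π (fun s => Real.exp (-t * numIn 𝓕 s)) with hΦ
  have hd : ∀ t, HasDerivAt Φ (-expect π (fun s => numIn 𝓕 s * Real.exp (-t * numIn 𝓕 s))) t := by
    intro t
    have : HasDerivAt Φ (∑ s, weight π s * (Real.exp (-t * numIn 𝓕 s) * (-1 * numIn 𝓕 s))) t := by
      refine HasDerivAt.fun_sum fun s _ => HasDerivAt.const_mul _ ?_
      exact ((hasDerivAt_neg t).mul_const _).exp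
    convert this using 1
    rw [expect, ← Finset.sum_neg_distrib]
    exact Finset.sum_congr rfl fun s _ => by ring
  -- Integrating factor: the differential inequality reads `Φ' ≤ -(μ - t * Δ) * Φ` for `t ≥ 0`, so
  -- `G` decreases from `G 0 = 1`.
  set G : ℝ → ℝ := fun t => Φ t * Real.exp (t * μ - t ^ 2 * Δ / 2) with hG
  have hdG : ∀ t, HasDerivAt G (-expect π (fun s => numIn 𝓕 s * Real.exp (-t * numIn 𝓕 s)) *
      Real.exp (t * μ - t ^ 2 * Δ / 2) +
      Φ t * (Real.exp (t * μ - t ^ 2 * Δ / 2) * (μ - t * Δ))) t := by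
    intro t
    refine (hd t).mul (HasDerivAt.exp ?_)
    have : HasDerivAt (fun t => t * μ - t ^ 2 * Δ / 2) _ t := ((hasDerivAt_id t).mul_const μ).sub
      ((((hasDerivAt_id t).pow 2).mul_const Δ).div_const 2)
    exact this.congr_deriv (by simp; ring)
  have hanti : AntitoneOn G (Set.Ici 0) := by
    refine antitoneOn_of_deriv_nonpos (convex_Ici 0)
      (fun t _ => (hdG t).continuousAt.continuousWithinAt)
      (fun t _ => (hdG t).differentiableAt.differentiableWithinAt) fun t ht => ?_
    rw [interior_Ici] at ht
    rw [(hdG t).deriv]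
    have h1 := mul_expect_exp_le hπ 𝓕 (le_of_lt (Set.mem_Ioi.1 ht))
    have h2 := Real.exp_pos (t * μ - t ^ 2 * Δ / 2)
    change (μ - t * Δ) * Φ t ≤ _ at h1
    nlinarith
  have h := hanti (Set.mem_Ici.2 le_rfl) (Set.mem_Ici.2 ht) ht
  have h0 : G 0 = 1 := by simp [hG, hΦ, expect_const]
  rw [h0] at h
  have h3 : Φ t = G t * Real.exp (-t * μ + t ^ 2 * Δ / 2) := by
    simp only [hG]
    rw [mul_assoc, ← Real.exp_add]
    ring_nf
    simp
  change Φ t ≤ _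
  rw [h3]
  exact mul_le_of_le_one_left (Real.exp_pos _).le h

/-- Janson's inequality for the lower tail. -/
theorem prob_numIn_le_sub {π : ι → ℝ} (hπ : ∀ i, π i ∈ Set.Icc (0 : ℝ) 1)
    (𝓕 : Finset (Finset ι)) {a D : ℝ} (ha : 0 ≤ a) (hD : 0 < D)
    (hΔ : ∑ i ∈ 𝓕, overlap π 𝓕 i ≤ D) :
    prob π {s | (numIn 𝓕 s : ℝ) ≤ ∑ i ∈ 𝓕, wt π i - a} ≤ Real.exp (-(a ^ 2 / (2 * D))) := by
  set μ := ∑ i ∈ 𝓕, wt π i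
  -- The choice `t = a / D` minimises the resulting exponent `-t * a + t ^ 2 * D / 2`.
  have ht : 0 ≤ a / D := by positivity
  have h1 := prob_mul_le_expect hπ (A := {s | (numIn 𝓕 s : ℝ) ≤ μ - a})
    (F := fun s => Real.exp (-(a / D) * numIn 𝓕 s)) (c := Real.exp (-(a / D) * (μ - a)))
    (fun s => (Real.exp_pos _).le) (fun s hs => Real.exp_le_exp.2
      (mul_le_mul_of_nonpos_left hs (neg_nonpos.2 ht)))
  have h2 := h1.trans (expect_exp_neg_le hπ 𝓕 ht)
  rw [← le_div_iff₀ (Real.exp_pos _), ← Real.exp_sub] at h2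
  refine h2.trans (Real.exp_le_exp.2 ?_)
  have h3 : (a / D) ^ 2 * (∑ i ∈ 𝓕, overlap π 𝓕 i) / 2 ≤ (a / D) ^ 2 * D / 2 := by gcongr
  have h4 : (a / D) ^ 2 * D / 2 = a ^ 2 / (2 * D) := by field_simp
  have h5 : a / D * a = 2 * (a ^ 2 / (2 * D)) := by field_simp
  change -(a / D) * μ + _ - _ ≤ _
  linarith

/-! ### Upper tails by counting sequences of members -/

/-- The number of sequences of `k` members of `𝓕` contained in `s`, each of which is admissible
(with respect to `ok`) for the union of `U` and its predecessors. -/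
noncomputable def seqCount (𝓕 : Finset (Finset ι)) (ok : Finset ι → Finset ι → Prop)
    [∀ U, DecidablePred (ok U)] : ℕ → Finset ι → Finset ι → ℝ
  | 0, _, _ => 1
  | k + 1, U, s => ∑ j ∈ 𝓕 with ok U j ∧ j ⊆ s, seqCount 𝓕 ok k (U ∪ j) s

section seqCount

variable {𝓕 : Finset (Finset ι)} {ok : Finset ι → Finset ι → Prop} [∀ U, DecidablePred (ok U)]
  {e N : ℕ} {U₀ : Finset ι}

/-- A sequence is built greedily with at least `a` choices at each step. The slack `e` in the budget
reflects that the union including the last member is never used to choose again, so only the earlier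
unions need at most `N` elements. -/
theorem pow_le_seqCount (he : ∀ j ∈ 𝓕, j.card ≤ e) {a : ℝ} (ha : 0 ≤ a) {s : Finset ι}
    (hs : ∀ U, U₀ ⊆ U → U.card ≤ N → a ≤ (𝓕.filter fun j => ok U j ∧ j ⊆ s).card) (k : ℕ)
    (U : Finset ι) (hU : U₀ ⊆ U) (hUN : U.card + e * k ≤ N + e) : a ^ k ≤ seqCount 𝓕 ok k U s := by
  induction k generalizing U with
  | zero => simp [seqCount]
  | succ k ih =>
    rw [seqCount, pow_succ']
    rw [Nat.mul_succ] at hUN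
    have h1 : ∀ j ∈ 𝓕.filter (fun j => ok U j ∧ j ⊆ s), a ^ k ≤ seqCount 𝓕 ok k (U ∪ j) s :=
      fun j hj => ih _ (hU.trans Finset.subset_union_left) (by
        have := Finset.card_union_le U j
        have := he j (Finset.mem_filter.1 hj).1
        omega)
    have h2 := Finset.card_nsmul_le_sum _ _ _ h1
    rw [nsmul_eq_mul] at h2
    exact (mul_le_mul_of_nonneg_right (hs U hU (by omega)) (pow_nonneg ha k)).trans h2

/-- Each new member `j` multiplies the weight by that of `j \ U`, the elements not yet exposed, and
these factors sum to at most `η` whatever was chosen before. -/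
theorem expect_seqCount_le {π : ι → ℝ} (hπ : ∀ i, π i ∈ Set.Icc (0 : ℝ) 1)
    (he : ∀ j ∈ 𝓕, j.card ≤ e) {η : ℝ}
    (h : ∀ U, U₀ ⊆ U → U.card ≤ N → ∑ j ∈ 𝓕 with ok U j, wt π (j \ U) ≤ η) (k : ℕ)
    (U : Finset ι) (hU : U₀ ⊆ U) (hUN : U.card + e * k ≤ N + e) :
    expect π (fun s => if U ⊆ s then seqCount 𝓕 ok k U s else 0) ≤ wt π U * η ^ k := by
  induction k generalizing U with
  | zero => simp [seqCount, expect_ite_subset_one]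
  | succ k ih =>
    rw [Nat.mul_succ] at hUN
    have hη : 0 ≤ η := (Finset.sum_nonneg fun _ _ => wt_nonneg hπ _).trans (h U hU (by omega))
    have h1 : (fun s => if U ⊆ s then seqCount 𝓕 ok (k + 1) U s else 0) = fun s =>
        ∑ j ∈ 𝓕 with ok U j, if U ∪ j ⊆ s then seqCount 𝓕 ok k (U ∪ j) s else 0 := by
      ext s
      rw [seqCount, ← Finset.filter_filter, Finset.sum_filter (fun j => j ⊆ s)]
      simp only [Finset.union_subset_iff]
      split_ifs with hUs
      · exact Finset.sum_congr rfl fun j _ => by simp [hUs]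
      · simp [hUs]
    rw [h1, expect_sum]
    calc ∑ j ∈ 𝓕 with ok U j, expect π (fun s => if U ∪ j ⊆ s then
            seqCount 𝓕 ok k (U ∪ j) s else 0)
        ≤ ∑ j ∈ 𝓕 with ok U j, wt π U * wt π (j \ U) * η ^ k := by
          refine Finset.sum_le_sum fun j hj => ?_
          rw [← wt_union]
          refine ih _ (hU.trans Finset.subset_union_left) ?_
          have := Finset.card_union_le U j
          have := he j (Finset.mem_filter.1 hj).1
          omega
      _ = wt π U * η ^ k * ∑ j ∈ 𝓕 with ok U j, wt π (j \ U) := by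
          rw [Finset.mul_sum]
          exact Finset.sum_congr rfl fun _ _ => by ring
      _ ≤ wt π U * η ^ k * η := by
          have := wt_nonneg hπ U
          exact mul_le_mul_of_nonneg_left (h U hU (by omega)) (by positivity)
      _ = wt π U * η ^ (k + 1) := by ring

/-- Markov's inequality for the number of sequences started at `U₀`, with its greedy lower bound on
`A`. -/
theorem prob_mul_pow_le {π : ι → ℝ} (hπ : ∀ i, π i ∈ Set.Icc (0 : ℝ) 1)
    (he : ∀ j ∈ 𝓕, j.card ≤ e) {η a : ℝ} (ha : 0 ≤ a)
    (h : ∀ U, U₀ ⊆ U → U.card ≤ N → ∑ j ∈ 𝓕 with ok U j, wt π (j \ U) ≤ η) (k : ℕ)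
    (hN : U₀.card + e * k ≤ N + e) {A : Set (Finset ι)} (hA : ∀ s ∈ A, U₀ ⊆ s ∧
      ∀ U, U₀ ⊆ U → U.card ≤ N → a ≤ (𝓕.filter fun j => ok U j ∧ j ⊆ s).card) :
    prob π A * a ^ k ≤ wt π U₀ * η ^ k := by
  refine le_trans (prob_mul_le_expect hπ (fun s => ?_) fun s hs => ?_)
    (expect_seqCount_le hπ he h k U₀ subset_rfl hN)
  · have hnn : ∀ (k : ℕ) (U : Finset ι), 0 ≤ seqCount 𝓕 ok k U s := fun k => by
      induction k with
      | zero => exact fun U => by simp [seqCount]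
      | succ k ih => exact fun U => Finset.sum_nonneg fun j _ => ih _
    split_ifs
    · exact hnn k U₀
    · exact le_rfl
  · rw [if_pos (hA s hs).1]
    exact pow_le_seqCount he ha (hA s hs).2 k U₀ subset_rfl hN

end seqCount

/-- The upper tail of the number of members of `𝓕`, on the event that no element of the ground set
is in more than `D` of them. -/
theorem prob_upper_tail_mul_pow_le {π : ι → ℝ} (hπ : ∀ i, π i ∈ Set.Icc (0 : ℝ) 1)
    {𝓕 : Finset (Finset ι)} {e : ℕ} (he : ∀ j ∈ 𝓕, j.card ≤ e) {a D : ℝ} (ha : 0 ≤ a) (hD : 0 ≤ D)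
    (k : ℕ) :
    prob π {s | a + e * k * D ≤ numIn 𝓕 s ∧ ∀ f, (numIn (𝓕.filter (f ∈ ·)) s : ℝ) ≤ D} * a ^ k ≤
      (∑ i ∈ 𝓕, wt π i) ^ k := by
  -- Sequences of pairwise disjoint members. The at most `e * k` elements already used block at most
  -- `D` members each, so at least `a` choices always remain.
  have h := prob_mul_pow_le (𝓕 := 𝓕) (ok := fun U j => Disjoint U j) (N := e * k) (U₀ := ∅) hπ he ha
    (η := ∑ i ∈ 𝓕, wt π i) (fun U _ _ => ?_) k (by simp)
    (A := {s | a + e * k * D ≤ numIn 𝓕 s ∧ ∀ f, (numIn (𝓕.filter (f ∈ ·)) s : ℝ) ≤ D})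
    (fun s hs => ⟨Finset.empty_subset _, fun U _ hU => ?_⟩)
  · simpa [wt] using h
  · calc ∑ j ∈ 𝓕 with Disjoint U j, wt π (j \ U) = ∑ j ∈ 𝓕 with Disjoint U j, wt π j :=
          Finset.sum_congr rfl fun j hj => by
            rw [Finset.sdiff_eq_self_of_disjoint (Finset.mem_filter.1 hj).2.symm]
      _ ≤ _ := Finset.sum_le_sum_of_subset_of_nonneg (Finset.filter_subset _ _)
          fun _ _ _ => wt_nonneg hπ _
  · obtain ⟨h1, h2⟩ := hs
    have h3 : 𝓕.filter (· ⊆ s) ⊆ (𝓕.filter fun j => Disjoint U j ∧ j ⊆ s) ∪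
        U.biUnion fun f => (𝓕.filter (f ∈ ·)).filter (· ⊆ s) := fun j hj => by
      rw [Finset.mem_filter] at hj
      by_cases hd : Disjoint U j
      · exact Finset.mem_union_left _ (Finset.mem_filter.2 ⟨hj.1, hd, hj.2⟩)
      · obtain ⟨f, hfU, hfj⟩ := Finset.not_disjoint_iff.1 hd
        refine Finset.mem_union_right _ (Finset.mem_biUnion.2 ⟨f, hfU, ?_⟩)
        simp [hj, hfj]
    have h4 := (Finset.card_le_card h3).trans ((Finset.card_union_le _ _).trans
      (Nat.add_le_add_left Finset.card_biUnion_le _))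
    have h5 : ((𝓕.filter (· ⊆ s)).card : ℝ) ≤ ((𝓕.filter fun j => Disjoint U j ∧ j ⊆ s).card : ℝ) +
        ∑ f ∈ U, (((𝓕.filter (f ∈ ·)).filter (· ⊆ s)).card : ℝ) := by exact_mod_cast h4
    have h6 : ∑ f ∈ U, (((𝓕.filter (f ∈ ·)).filter (· ⊆ s)).card : ℝ) ≤ U.card * D := by
      rw [← nsmul_eq_mul]
      exact Finset.sum_le_card_nsmul _ _ _ fun f _ => h2 f
    have h7 : (U.card : ℝ) * D ≤ e * k * D := by
      have : (U.card : ℝ) ≤ e * k := by exact_mod_cast hU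
      gcongr
    have h8 : a + e * k * D ≤ ((𝓕.filter (· ⊆ s)).card : ℝ) := h1
    linarith

/-- A bound for the probability that many members of `𝓕` in the random set contain a given
element. -/
theorem prob_degree_mul_pow_le {π : ι → ℝ} (hπ : ∀ i, π i ∈ Set.Icc (0 : ℝ) 1)
    {𝓕 : Finset (Finset ι)} {e : ℕ} (he : ∀ j ∈ 𝓕, j.card ≤ e) {a η : ℝ} (ha : 0 < a) (f : ι)
    (k : ℕ) (h : ∀ U : Finset ι, f ∈ U → U.card ≤ 1 + e * k →
      ∑ j ∈ 𝓕 with f ∈ j ∧ ¬j ⊆ U, wt π (j \ U) ≤ η) :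
    prob π {s | a + 2 ^ (1 + e * k) ≤ (numIn (𝓕.filter (f ∈ ·)) s : ℝ)} * a ^ k ≤ η ^ k := by
  have hη : 0 ≤ η := (Finset.sum_nonneg fun _ _ => wt_nonneg hπ _).trans
    (h {f} (Finset.mem_singleton_self f) (by simp))
  -- Members through `f` always overlap, so each is only required to contain something new. At most
  -- `2 ^ (1 + e * k)` members lie inside the union already built, which is the additive term in the
  -- threshold.
  refine (prob_mul_pow_le (𝓕 := 𝓕.filter (f ∈ ·)) (ok := fun U j => ¬j ⊆ U) (N := 1 + e * k)
    (U₀ := {f}) hπ (fun j hj => he j (Finset.mem_filter.1 hj).1) ha.le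
    (η := η) (fun U hU hUc => ?_) k (by simp)
    (fun s hs => ⟨?_, fun U _ hU => ?_⟩)).trans
    (mul_le_of_le_one_left (pow_nonneg hη k) (wt_le_one hπ _))
  · rw [Finset.filter_filter]
    exact h U (Finset.singleton_subset_iff.1 hU) hUc
  · have hpos : (0 : ℝ) < numIn (𝓕.filter (f ∈ ·)) s := lt_of_lt_of_le (by positivity) hs
    obtain ⟨j, hj⟩ := Finset.card_pos.1 (Nat.cast_pos.1 hpos)
    rw [Finset.mem_filter, Finset.mem_filter] at hj
    exact Finset.singleton_subset_iff.2 (hj.2 hj.1.2)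
  · have h3 : (𝓕.filter (f ∈ ·)).filter (· ⊆ s) ⊆
        ((𝓕.filter (f ∈ ·)).filter fun j => ¬j ⊆ U ∧ j ⊆ s) ∪ U.powerset := fun j hj => by
      rw [Finset.mem_filter] at hj
      by_cases hd : j ⊆ U
      · exact Finset.mem_union_right _ (Finset.mem_powerset.2 hd)
      · exact Finset.mem_union_left _ (Finset.mem_filter.2 ⟨hj.1, hd, hj.2⟩)
    have h4 := (Finset.card_le_card h3).trans (Finset.card_union_le _ _)
    rw [Finset.card_powerset] at h4
    have h5 : (2 : ℝ) ^ U.card ≤ 2 ^ (1 + e * k) := pow_le_pow_right₀ one_le_two hU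
    have h6 : (((𝓕.filter (f ∈ ·)).filter (· ⊆ s)).card : ℝ) ≤
        (((𝓕.filter (f ∈ ·)).filter fun j => ¬j ⊆ U ∧ j ⊆ s).card : ℝ) + 2 ^ U.card := by
      exact_mod_cast h4
    have h8 : a + 2 ^ (1 + e * k) ≤ (((𝓕.filter (f ∈ ·)).filter (· ⊆ s)).card : ℝ) := hs
    linarith

end BernoulliSet

/-! ### Poisson weights and the Stein equation -/

namespace BernoulliSet

/-- The Poisson weight `exp (-l) * l ^ k / k!`. -/
noncomputable def poissonWeight (l : ℝ) (k : ℕ) : ℝ := Real.exp (-l) * (l ^ k / k.factorial)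

theorem poissonWeight_nonneg {l : ℝ} (hl : 0 ≤ l) (k : ℕ) : 0 ≤ poissonWeight l k := by
  unfold poissonWeight; positivity

theorem hasSum_pow_div_factorial (l : ℝ) : HasSum (fun k : ℕ => l ^ k / k.factorial) (Real.exp l) := by
  rw [Real.exp_eq_exp_ℝ]
  exact NormedSpace.expSeries_div_hasSum_exp l

theorem poissonWeight_le_one {l : ℝ} (hl : 0 ≤ l) (k : ℕ) : poissonWeight l k ≤ 1 := by
  have h := le_hasSum (hasSum_pow_div_factorial l) k fun _ _ => by positivity
  calc poissonWeight l k ≤ Real.exp (-l) * Real.exp l := mul_le_mul_of_nonneg_left h (Real.exp_pos _).le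
    _ = 1 := by rw [← Real.exp_add]; simp

/-- The head sum in the solution of the Stein equation. -/
theorem factorial_div_pow_mul_sum_le {l : ℝ} (hl : 0 < l) {k : ℕ} (hk : (k : ℝ) ≤ l) :
    k.factorial / l ^ (k + 1) * ∑ j ∈ Finset.range (k + 1), l ^ j / j.factorial ≤ 1 + 1 / l := by
  rw [Finset.mul_sum]
  calc ∑ j ∈ Finset.range (k + 1), k.factorial / l ^ (k + 1) * (l ^ j / j.factorial)
      ≤ ∑ j ∈ Finset.range (k + 1), 1 / l := by
        refine Finset.sum_le_sum fun j hj => ?_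
        have hjk : j ≤ k := Nat.lt_succ_iff.1 (Finset.mem_range.1 hj)
        have h1 : (k.factorial : ℝ) ≤ j.factorial * l ^ (k - j) := by
          have h2 := Nat.factorial_mul_descFactorial (Nat.sub_le k j)
          rw [Nat.sub_sub_self hjk] at h2
          rw [← h2]
          push_cast
          gcongr
          calc (k.descFactorial (k - j) : ℝ) ≤ (k : ℝ) ^ (k - j) := by
                exact_mod_cast Nat.descFactorial_le_pow k (k - j)
            _ ≤ l ^ (k - j) := by gcongr
        have h3 : l ^ (k + 1) = l ^ (k - j) * l ^ j * l := by
          rw [← pow_add, ← pow_succ]; congr 1; omega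
        have hj0 : (0 : ℝ) < j.factorial := by positivity
        rw [h3, div_mul_div_comm, div_le_div_iff₀ (by positivity) hl]
        calc (k.factorial : ℝ) * l ^ j * l ≤ (j.factorial * l ^ (k - j)) * l ^ j * l := by gcongr
          _ = _ := by ring
    _ = (k + 1) / l := by simp; ring
    _ ≤ 1 + 1 / l := by
        rw [add_div]
        gcongr
        exact (div_le_one hl).2 hk

/-- The terms are dominated by `(1 / (k + 1)) * (l / (k + 1)) ^ i`, with geometric sum `1 / (k + 1 -
l) ≤ 1`. -/
theorem abs_tail_le {l : ℝ} (hl : 0 < l) {k : ℕ} (hk : l ≤ k) {h : ℕ → ℝ} (hh : ∀ j, |h j| ≤ 1) :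
    |k.factorial / l ^ (k + 1) * ∑' i : ℕ, h (i + (k + 1)) * (l ^ (i + (k + 1)) /
      (i + (k + 1)).factorial)| ≤ 1 := by
  rw [← tsum_mul_left, ← Real.norm_eq_abs]
  have hk1 : l / (k + 1) < 1 := by rw [div_lt_one (by positivity)]; linarith
  have hgeo := (hasSum_geometric_of_lt_one (by positivity) hk1).mul_left (1 / (k + 1 : ℝ))
  refine (tsum_of_norm_bounded hgeo fun i => ?_).trans ?_
  · rw [Real.norm_eq_abs, abs_mul, abs_mul, abs_of_pos (show (0 : ℝ) < k.factorial / l ^ (k + 1) by positivity),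
      abs_of_pos (show (0 : ℝ) < l ^ (i + (k + 1)) / (i + (k + 1)).factorial by positivity)]
    have h1 : (k.factorial : ℝ) * (k + 1) ^ (i + 1) ≤ (i + (k + 1)).factorial := by
      have := Nat.factorial_mul_pow_le_factorial (m := k) (n := i + 1)
      rw [show k + (i + 1) = i + (k + 1) by ring] at this
      exact_mod_cast this
    calc (k.factorial : ℝ) / l ^ (k + 1) * (|h (i + (k + 1))| * (l ^ (i + (k + 1)) / (i + (k + 1)).factorial))
        ≤ k.factorial / l ^ (k + 1) * (1 * (l ^ (i + (k + 1)) / (k.factorial * (k + 1) ^ (i + 1)))) := by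
          gcongr
          exact hh _
      _ = 1 / (k + 1) * (l / (k + 1)) ^ i := by
          have : (k.factorial : ℝ) ≠ 0 := by positivity
          rw [div_pow, pow_add l, pow_succ]
          field_simp
          ring
  · have : (0 : ℝ) < k + 1 - l := by linarith
    have h2 : 1 / (k + 1 : ℝ) * (1 - l / (k + 1))⁻¹ = 1 / (k + 1 - l) := by
      have : (1 - l / (k + 1)) = (k + 1 - l) / (k + 1) := by field_simp
      rw [this]
      field_simp
    rw [h2, div_le_one (by linarith)]
    linarith

/-- Solutions of the Stein equation for the indicator function of a point. -/
theorem exists_stein_solution {l : ℝ} (hl : 0 < l) (m : ℕ) :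
    ∃ f : ℕ → ℝ, (∀ k, |f k| ≤ 1 + 1 / l) ∧
      ∀ k : ℕ, l * f (k + 1) - k * f k = (if k = m then 1 else 0) - poissonWeight l m := by
  set a : ℕ → ℝ := fun k => l ^ k / k.factorial with ha
  have ha0 : ∀ k, 0 < a k := fun k => by simp only [ha]; positivity
  set h : ℕ → ℝ := fun k => (if k = m then 1 else 0) - poissonWeight l m with hh
  have hh1 : ∀ k, |h k| ≤ 1 := fun k => by
    have h0 := poissonWeight_nonneg hl.le m
    have h1 := poissonWeight_le_one hl.le m
    simp only [hh]
    rw [abs_le]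
    split_ifs <;> constructor <;> linarith
  -- `h` has Poisson mean zero, so a head sum is minus the complementary tail. The solution is
  -- bounded through the head for `k ≤ l` and through the tail for `k ≥ l`.
  have hsum : HasSum (fun k => h k * a k) 0 := by
    have h1 := (hasSum_ite_eq m (a m)).sub ((hasSum_pow_div_factorial l).mul_left (poissonWeight l m))
    have h2 : a m - poissonWeight l m * Real.exp l = 0 := by
      rw [poissonWeight, mul_right_comm, ← Real.exp_add]
      simp [ha]
    rw [h2] at h1
    have h3 : (fun k => h k * a k) = fun k =>
        (if k = m then a m else 0) - poissonWeight l m * (l ^ k / k.factorial) := by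
      ext k
      simp only [hh, sub_mul, ha]
      split_ifs with hkm
      · rw [hkm]; ring
      · ring
    rw [h3]
    exact h1
  -- This is the recursion `l * f (k + 1) = k * f k + h k` solved forwards. The truncated `k - 1` at
  -- `k = 0` is harmless because the sum is empty there.
  set f : ℕ → ℝ := fun k => (k - 1).factorial / l ^ k * ∑ j ∈ Finset.range k, h j * a j with hf
  refine ⟨f, fun k => ?_, fun k => ?_⟩
  · cases k with
    | zero => simp [hf]; positivity
    | succ k =>
      simp only [hf, Nat.add_sub_cancel]
      rcases le_total (k : ℝ) l with hk | hk
      · refine le_trans ?_ (factorial_div_pow_mul_sum_le hl hk)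
        rw [abs_mul, abs_of_pos (show (0 : ℝ) < k.factorial / l ^ (k + 1) by positivity)]
        gcongr
        refine (Finset.abs_sum_le_sum_abs _ _).trans (Finset.sum_le_sum fun j _ => ?_)
        rw [abs_mul, abs_of_pos (ha0 j)]
        exact mul_le_of_le_one_left (ha0 j).le (hh1 j)
      · have h1 := hsum.summable.sum_add_tsum_nat_add (k + 1)
        rw [hsum.tsum_eq] at h1
        rw [eq_neg_of_add_eq_zero_left h1, mul_neg, abs_neg]
        refine (abs_tail_le hl hk hh1).trans ?_
        have : 0 < 1 / l := by positivity
        linarith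
  · simp only [hf, Nat.add_sub_cancel, Finset.sum_range_succ]
    have hk0 : (k.factorial : ℝ) ≠ 0 := by positivity
    have h1 : l * (k.factorial / l ^ (k + 1) * (∑ j ∈ Finset.range k, h j * a j + h k * a k)) =
        k.factorial / l ^ k * ∑ j ∈ Finset.range k, h j * a j + h k := by
      simp only [ha]
      field_simp
      ring
    rw [h1]
    cases k with
    | zero => simp [hh]
    | succ k =>
      rw [Nat.add_sub_cancel, Nat.factorial_succ]
      push_cast
      ring

/-- A crude Stirling bound; the inductive step is `e ≤ (1 + 1 / k) ^ (k + 1)`. -/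
theorem factorial_le_mul_pow {k : ℕ} (hk : 1 ≤ k) :
    (k.factorial : ℝ) ≤ Real.exp 1 * k * (k ^ k * Real.exp (-k)) := by
  induction k, hk using Nat.le_induction with
  | base => simp [← Real.exp_add]
  | succ k hk ih =>
    have hk0 : (0 : ℝ) < k := by exact_mod_cast hk
    have h1 : Real.exp 1 ≤ ((k + 1) / k : ℝ) ^ (k + 1) := by
      have h2 : (1 : ℝ) ≤ (k + 1 : ℕ) * Real.log ((k + 1) / k) := by
        have := Real.one_sub_inv_le_log_of_pos (show (0 : ℝ) < (k + 1) / k by positivity)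
        have h3 : (1 : ℝ) - ((k + 1 : ℝ) / k)⁻¹ = 1 / (k + 1) := by field_simp; ring
        rw [h3, div_le_iff₀ (by positivity)] at this
        push_cast
        linarith
      rw [← Real.log_pow] at h2
      exact (Real.le_log_iff_exp_le (by positivity)).1 h2
    rw [div_pow, le_div_iff₀ (by positivity)] at h1
    rw [Nat.factorial_succ]
    push_cast
    calc ((k : ℝ) + 1) * k.factorial ≤ (k + 1) * (Real.exp 1 * k * (k ^ k * Real.exp (-k))) := by gcongr
      _ = (k + 1) * (Real.exp 1 * k ^ (k + 1)) * Real.exp (-k) := by ring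
      _ ≤ (k + 1) * (k + 1) ^ (k + 1) * Real.exp (-k) := by gcongr
      _ = Real.exp 1 * (k + 1) * ((k + 1) ^ (k + 1) * Real.exp (-(k + 1))) := by
          rw [neg_add, Real.exp_add, Real.exp_neg 1]
          field_simp

/-- After Stirling, `log (k / l) ≤ k / l - 1` produces exactly the exponent `-(k - l) ^ 2 / l`. The
loss of a factor two against the Gaussian exponent only affects constants. -/
theorem le_poissonWeight {l : ℝ} (hl : 0 < l) {k : ℕ} (hk : 1 ≤ k) :
    Real.exp (-((k - l) ^ 2 / l)) / (Real.exp 1 * k) ≤ poissonWeight l k := by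
  have hk0 : (0 : ℝ) < k := by exact_mod_cast hk
  have h1 : (k : ℝ) ^ k ≤ l ^ k * Real.exp (k * (k / l - 1)) := by
    have h2 : (k : ℝ) / l ≤ Real.exp (k / l - 1) := by
      have := Real.add_one_le_exp ((k : ℝ) / l - 1)
      linarith
    rw [Real.exp_nat_mul, ← mul_pow]
    gcongr
    rwa [div_le_iff₀' hl] at h2
  rw [poissonWeight, ← mul_div_assoc, div_le_div_iff₀ (by positivity) (by positivity)]
  calc Real.exp (-((k - l) ^ 2 / l)) * k.factorial
      ≤ Real.exp (-((k - l) ^ 2 / l)) * (Real.exp 1 * k * (k ^ k * Real.exp (-k))) := by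
        gcongr
        exact factorial_le_mul_pow hk
    _ ≤ Real.exp (-((k - l) ^ 2 / l)) * (Real.exp 1 * k *
          (l ^ k * Real.exp (k * (k / l - 1)) * Real.exp (-k))) := by gcongr
    _ = (Real.exp (-((k - l) ^ 2 / l)) * Real.exp (k * (k / l - 1)) * Real.exp (-k)) * l ^ k *
          (Real.exp 1 * k) := by ring
    _ = Real.exp (-l) * l ^ k * (Real.exp 1 * k) := by
        rw [← Real.exp_add, ← Real.exp_add]
        congr 3
        field_simp
        ring

/-- For fixed `k` the weight is largest at `l = k`, and Stirling's lower bound for `k!` applies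
there. -/
theorem poissonWeight_le {l : ℝ} (hl : 0 < l) {k : ℕ} (hk : 1 ≤ k) :
    poissonWeight l k ≤ 1 / √k := by
  have hk0 : (0 : ℝ) < k := by exact_mod_cast hk
  have h1 : l ^ k * Real.exp (-l) ≤ (k / Real.exp 1) ^ k := by
    have h2 : l / k ≤ Real.exp (l / k - 1) := by
      have := Real.add_one_le_exp (l / k - 1)
      linarith
    have h3 : (l / k) ^ k ≤ Real.exp (l / k - 1) ^ k := by gcongr
    rw [← Real.exp_nat_mul, div_pow, div_le_iff₀ (by positivity)] at h3
    have h4 : Real.exp (k * (l / k - 1)) = Real.exp l * Real.exp (-k) := by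
      rw [← Real.exp_add]; congr 1; field_simp; ring
    have h5 : (k / Real.exp 1) ^ k = k ^ k * Real.exp (-k) := by
      rw [div_pow, ← Real.exp_nat_mul, mul_one, Real.exp_neg, div_eq_mul_inv]
    rw [h4] at h3
    rw [h5]
    calc l ^ k * Real.exp (-l) ≤ Real.exp l * Real.exp (-k) * k ^ k * Real.exp (-l) := by gcongr
      _ = (Real.exp l * Real.exp (-l)) * (k ^ k * Real.exp (-k)) := by ring
      _ = _ := by rw [← Real.exp_add]; simp
  have h6 : √k * (k / Real.exp 1) ^ k ≤ k.factorial := by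
    refine le_trans ?_ (Stirling.le_factorial_stirling k)
    gcongr
    have := Real.pi_gt_three
    nlinarith
  rw [poissonWeight, ← mul_div_assoc, div_le_div_iff₀ (by positivity) (by positivity), one_mul]
  calc Real.exp (-l) * l ^ k * √k = √k * (l ^ k * Real.exp (-l)) := by ring
    _ ≤ √k * (k / Real.exp 1) ^ k := by gcongr
    _ ≤ _ := h6

end BernoulliSet

/-! ### Strict balance, and extensions as edge sets of placements -/

namespace RootedGraph

variable {V : Type*} [Finite V] (R : RootedGraph V)

/-- The set of non-root vertices. -/
noncomputable def nonroots : Finset V := (Set.toFinite (Set.range R.root)ᶜ).toFinset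

/-- The edge set of the extension graph. -/
noncomputable def extEdges : Finset (Sym2 V) := (Set.toFinite R.extensionGraph.edgeSet).toFinset

theorem mem_nonroots {a : V} : a ∈ R.nonroots ↔ a ∉ Set.range R.root := by
  simp [nonroots]

theorem mem_extEdges {d : Sym2 V} : d ∈ R.extEdges ↔ d ∈ R.extensionGraph.edgeSet := by
  simp [extEdges]

theorem extensionGraph_adj {a b : V} : R.extensionGraph.Adj a b ↔
    R.graph.Adj a b ∧ (a ∈ R.nonroots ∨ b ∈ R.nonroots) := by
  simp only [extensionGraph, deleteEdges_adj, rootSubgraph, Subgraph.mem_edgeSet,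
    Subgraph.induce_adj, Subgraph.top_adj, mem_nonroots]
  tauto

theorem exists_nonroot_of_mem_extEdges {d : Sym2 V} (hd : d ∈ R.extEdges) :
    ∃ a ∈ d, a ∈ R.nonroots := by
  rw [mem_extEdges] at hd
  induction d with | _ a b
  rcases (R.extensionGraph_adj.1 hd).2 with h | h
  · exact ⟨a, by simp, h⟩
  · exact ⟨b, by simp, h⟩

theorem not_isDiag_of_mem_extEdges {d : Sym2 V} (hd : d ∈ R.extEdges) : ¬d.IsDiag :=
  R.extensionGraph.not_isDiag_of_mem_edgeSet (R.mem_extEdges.1 hd)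

theorem extEdges_eq_diff : (R.extEdges : Set (Sym2 V)) =
    R.graph.edgeSet \ R.rootSubgraph.edgeSet := by
  ext d
  simp [mem_extEdges, extensionGraph, edgeSet_deleteEdges]

theorem card_extEdges_add : R.extEdges.card + R.rootSubgraph.edgeSet.ncard =
    R.graph.edgeSet.ncard := by
  rw [← Set.ncard_coe_finset, extEdges_eq_diff]
  exact Set.ncard_sdiff_add_ncard_of_subset (Subgraph.edgeSet_subset _) (Set.toFinite _)

theorem card_nonroots_add : R.nonroots.card + R.rootSubgraph.verts.ncard = Nat.card V := by
  have h : (R.nonroots : Set V) = (R.rootSubgraph.verts)ᶜ := by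
    ext a; simp [mem_nonroots, rootSubgraph]
  rw [← Set.ncard_coe_finset, h, add_comm]
  exact Set.ncard_add_ncard_compl _

variable {R}

open Classical in
/-- Strict balance, as an inequality between the numbers of edges and vertices. -/
theorem StrictlyBalanced.card_mul_lt (hbal : R.StrictlyBalanced)
    {W : Finset V} (hW : W ⊆ R.nonroots) (hW0 : W.Nonempty) (hW1 : W ≠ R.nonroots) :
    (R.extEdges.filter fun d => ∀ a ∈ d, a ∈ R.nonroots → a ∈ W).card * R.nonroots.card <
      R.extEdges.card * W.card := by
  -- Strict balance is tested on the subgraph induced by the roots and `W`; its edges outside `G`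
  -- are the extension edges whose non-root ends all lie in `W`.
  set J : R.graph.Subgraph := (⊤ : R.graph.Subgraph).induce (Set.range R.root ∪ W) with hJ
  have hle : R.rootSubgraph ≤ J := Subgraph.induce_mono_right Set.subset_union_left
  have hlt : R.rootSubgraph < J := by
    refine lt_of_le_of_ne hle fun h => ?_
    obtain ⟨a, ha⟩ := hW0
    have h1 : a ∈ R.rootSubgraph.verts := by rw [h]; exact Or.inr ha
    exact R.mem_nonroots.1 (hW ha) h1
  have hlt' : J < ⊤ := by
    refine lt_of_le_of_ne le_top fun h => hW1 (subset_antisymm hW fun a ha => ?_)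
    have h1 : a ∈ J.verts := by rw [h]; trivial
    exact h1.resolve_left (R.mem_nonroots.1 ha)
  have hv : J.verts.ncard = W.card + R.rootSubgraph.verts.ncard := by
    rw [← Set.ncard_coe_finset, add_comm]
    refine Set.ncard_union_eq ?_ (Set.toFinite _) (Set.toFinite _)
    rw [Set.disjoint_right]
    exact fun a ha => R.mem_nonroots.1 (hW ha)
  have hE : J.edgeSet.ncard = (R.extEdges.filter fun d => ∀ a ∈ d, a ∈ R.nonroots → a ∈ W).card +
      R.rootSubgraph.edgeSet.ncard := by
    have h1 : ((R.extEdges.filter fun d => ∀ a ∈ d, a ∈ R.nonroots → a ∈ W : Finset (Sym2 V)) :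
        Set (Sym2 V)) = J.edgeSet \ R.rootSubgraph.edgeSet := by
      ext d
      induction d with | _ a b
      simp only [Finset.coe_filter, Set.mem_ofPred_eq, mem_extEdges, mem_edgeSet, Set.mem_sdiff,
        Subgraph.mem_edgeSet, extensionGraph_adj, mem_nonroots, hJ, rootSubgraph,
        Subgraph.induce_adj, Subgraph.top_adj, Set.mem_union, Sym2.mem_iff, Finset.mem_coe,
        forall_eq_or_imp, forall_eq]
      have ha : a ∈ W → a ∉ Set.range R.root := fun h => R.mem_nonroots.1 (hW h)
      have hb : b ∈ W → b ∉ Set.range R.root := fun h => R.mem_nonroots.1 (hW h)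
      tauto
    rw [← Set.ncard_coe_finset, h1]
    exact (Set.ncard_sdiff_add_ncard_of_subset (Subgraph.edgeSet_mono hle) (Set.toFinite _)).symm
  have h := hbal J hlt hlt'
  have hV : ((⊤ : R.graph.Subgraph).verts.ncard) = R.nonroots.card + R.rootSubgraph.verts.ncard := by
    rw [card_nonroots_add, Subgraph.verts_top, Set.ncard_univ]
  have hT : ((⊤ : R.graph.Subgraph).edgeSet.ncard) =
      R.extEdges.card + R.rootSubgraph.edgeSet.ncard := by
    rw [card_extEdges_add, Subgraph.edgeSet_top]
  have hn : 0 < R.nonroots.card := Finset.card_pos.2 (hW0.mono hW)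
  rw [density, density, hv, hE, hV, hT] at h
  push_cast at h
  simp only [add_sub_cancel_right] at h
  rw [div_lt_div_iff₀ (by exact_mod_cast hW0.card_pos) (by exact_mod_cast hn)] at h
  exact_mod_cast h

theorem card_extEdges_pos (hedges : R.rootSubgraph.edgeSet.ncard < R.graph.edgeSet.ncard) :
    0 < R.extEdges.card := by
  have := R.card_extEdges_add
  omega

theorem card_nonroots_pos (hedges : R.rootSubgraph.edgeSet.ncard < R.graph.edgeSet.ncard) :
    0 < R.nonroots.card := by
  obtain ⟨d, hd⟩ := Finset.card_pos.1 (card_extEdges_pos hedges)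
  obtain ⟨a, -, ha⟩ := R.exists_nonroot_of_mem_extEdges hd
  exact Finset.card_pos.2 ⟨a, ha⟩

/-- Removing an isolated non-root vertex would keep all edges with fewer vertices, against strict
balance. If it were the only non-root vertex, there would be no edges outside `G` at all. -/
theorem StrictlyBalanced.exists_adj (hbal : R.StrictlyBalanced)
    (hedges : R.rootSubgraph.edgeSet.ncard < R.graph.edgeSet.ncard) {a : V} (ha : a ∈ R.nonroots) :
    ∃ b, R.extensionGraph.Adj a b := by
  classical
  by_contra! hiso
  have hnot : ∀ d ∈ R.extEdges, a ∉ d := fun d hd had => by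
    obtain ⟨b, rfl⟩ := had
    exact hiso b (R.mem_extEdges.1 hd)
  have hne : R.nonroots.erase a ≠ R.nonroots := fun h => by
    have := h ▸ ha
    simp at this
  have hfilter : (R.extEdges.filter fun d => ∀ b ∈ d, b ∈ R.nonroots → b ∈ R.nonroots.erase a) =
      R.extEdges := by
    refine Finset.filter_true_of_mem fun d hd b hb hbn => Finset.mem_erase.2 ⟨?_, hbn⟩
    rintro rfl
    exact hnot d hd hb
  have hpos := card_extEdges_pos hedges
  rcases Finset.eq_empty_or_nonempty (R.nonroots.erase a) with h0 | h0
  · obtain ⟨d, hd⟩ := Finset.card_pos.1 hpos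
    obtain ⟨b, hb, hbn⟩ := R.exists_nonroot_of_mem_extEdges hd
    have hba : b ≠ a := by rintro rfl; exact hnot d hd hb
    exact absurd (Finset.mem_erase.2 ⟨hba, hbn⟩) (by simp [h0])
  · have h := hbal.card_mul_lt (Finset.erase_subset _ _) h0 hne
    rw [hfilter] at h
    have h2 := Finset.card_erase_le (s := R.nonroots) (a := a)
    exact absurd (Nat.lt_of_mul_lt_mul_left h) (not_lt.2 h2)

variable (R)

/-- The injective maps sending the roots to `x`. -/
noncomputable def placements {n : ℕ} (x : Fin R.numRoots ↪ Fin n) : Finset (V → Fin n) :=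
  (Set.toFinite {φ : V → Fin n | Function.Injective φ ∧ ∀ j, φ (R.root j) = x j}).toFinset

/-- The image of the edge set of the extension graph under a map of the vertices. -/
noncomputable def edgeImage {n : ℕ} (φ : V → Fin n) : Finset (Sym2 (Fin n)) :=
  R.extEdges.image (Sym2.map φ)

/-- The edge sets of the potential extensions of `x`. -/
noncomputable def family {n : ℕ} (x : Fin R.numRoots ↪ Fin n) : Finset (Finset (Sym2 (Fin n))) :=
  (R.placements x).image R.edgeImage

variable {R} {n : ℕ} {x : Fin R.numRoots ↪ Fin n} {φ : V → Fin n}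

theorem mem_placements : φ ∈ R.placements x ↔
    Function.Injective φ ∧ ∀ j, φ (R.root j) = x j := by
  simp [placements]

theorem card_edgeImage (hφ : Function.Injective φ) : (R.edgeImage φ).card = R.extEdges.card :=
  Finset.card_image_of_injective _ (Sym2.map.injective hφ)

theorem card_of_mem_family {j : Finset (Sym2 (Fin n))} (hj : j ∈ R.family x) :
    j.card = R.extEdges.card := by
  obtain ⟨φ, hφ, rfl⟩ := Finset.mem_image.1 hj
  exact card_edgeImage (mem_placements.1 hφ).1

theorem not_isDiag_of_mem_edgeImage (hφ : Function.Injective φ) {d : Sym2 (Fin n)}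
    (hd : d ∈ R.edgeImage φ) : ¬d.IsDiag := by
  obtain ⟨d', hd', rfl⟩ := Finset.mem_image.1 hd
  have := R.not_isDiag_of_mem_extEdges hd'
  induction d' with | _ a b
  simpa [hφ.eq_iff] using this

theorem not_isDiag_of_mem_family {j : Finset (Sym2 (Fin n))} (hj : j ∈ R.family x)
    {d : Sym2 (Fin n)} (hd : d ∈ j) : ¬d.IsDiag := by
  obtain ⟨φ, hφ, rfl⟩ := Finset.mem_image.1 hj
  exact not_isDiag_of_mem_edgeImage (mem_placements.1 hφ).1 hd

theorem edgeSet_toSubgraph {Γ : SimpleGraph (Fin n)} (f : Copy R.extensionGraph Γ) :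
    f.toSubgraph.edgeSet = R.edgeImage f := by
  rw [Copy.toSubgraph, Subgraph.edgeSet_map, Subgraph.edgeSet_top, edgeImage, Finset.coe_image]
  congr 1
  ext d
  exact R.mem_extEdges.symm

/-- Roots are always covered and no other vertex is isolated, so an extension, as a subgraph, is
recovered from its edge set. This turns the graph problem into one about subsets of a random set;
`s` may contain diagonal pairs, which no extension uses. -/
theorem extensionCount_eq_numIn (hbal : R.StrictlyBalanced)
    (hedges : R.rootSubgraph.edgeSet.ncard < R.graph.edgeSet.ncard) (Γ : SimpleGraph (Fin n))
    (s : Finset (Sym2 (Fin n))) (hs : Γ.edgeSet = (s : Set (Sym2 (Fin n))) \ Sym2.diagSet) :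
    R.extensionCount Γ x = BernoulliSet.numIn (R.family x) s := by
  classical
  have hinj : Set.InjOn Subgraph.edgeSet (R.extensions Γ x) := by
    have hverts : ∀ f g : Copy R.extensionGraph Γ, (∀ j, f (R.root j) = x j) →
        (∀ j, g (R.root j) = x j) → f.toSubgraph.edgeSet = g.toSubgraph.edgeSet →
        f.toSubgraph.verts ⊆ g.toSubgraph.verts := by
      rintro f g hf hg h _ ⟨a, -, rfl⟩
      by_cases ha : a ∈ R.nonroots
      · obtain ⟨b, hab⟩ := hbal.exists_adj hedges ha
        have h1 : s(f a, f b) ∈ f.toSubgraph.edgeSet := by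
          rw [edgeSet_toSubgraph]
          exact Finset.mem_coe.2 (Finset.mem_image.2 ⟨s(a, b), R.mem_extEdges.2 hab, rfl⟩)
        rw [h, Subgraph.mem_edgeSet] at h1
        exact g.toSubgraph.edge_vert h1
      · rw [mem_nonroots, not_not] at ha
        obtain ⟨j, rfl⟩ := ha
        exact ⟨R.root j, trivial, (hg j).trans (hf j).symm⟩
    rintro _ ⟨f, hf, rfl⟩ _ ⟨g, hg, rfl⟩ h
    refine Subgraph.ext (subset_antisymm (hverts f g hf hg h) (hverts g f hg hf h.symm)) ?_
    ext a b
    rw [← Subgraph.mem_edgeSet, ← Subgraph.mem_edgeSet, h]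
  rw [extensionCount, ← hinj.ncard_image, BernoulliSet.numIn, ← Set.ncard_coe_finset,
    ← (Finset.coe_injective.injOn).ncard_image (f := fun t : Finset (Sym2 (Fin n)) =>
      (t : Set (Sym2 (Fin n))))]
  congr 1
  ext t
  constructor
  · rintro ⟨_, ⟨f, hf, rfl⟩, rfl⟩
    refine ⟨R.edgeImage f, ?_, (edgeSet_toSubgraph f).symm⟩
    rw [Finset.mem_coe, Finset.mem_filter]
    refine ⟨Finset.mem_image.2 ⟨f, mem_placements.2 ⟨f.injective, hf⟩, rfl⟩, ?_⟩
    rw [← Finset.coe_subset, ← edgeSet_toSubgraph]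
    exact (Subgraph.edgeSet_subset _).trans (hs.le.trans Set.sdiff_subset)
  · rintro ⟨j, hj, rfl⟩
    rw [Finset.mem_coe, Finset.mem_filter] at hj
    obtain ⟨hj, hjs⟩ := hj
    obtain ⟨φ, hφ, rfl⟩ := Finset.mem_image.1 hj
    obtain ⟨hi, hr⟩ := mem_placements.1 hφ
    have hhom : ∀ {a b}, R.extensionGraph.Adj a b → Γ.Adj (φ a) (φ b) := fun {a b} hab => by
      rw [← mem_edgeSet, hs]
      have h1 : s(φ a, φ b) ∈ R.edgeImage φ :=
        Finset.mem_image.2 ⟨s(a, b), R.mem_extEdges.2 hab, rfl⟩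
      exact ⟨hjs h1, by simpa using hi.ne hab.ne⟩
    let f : Copy R.extensionGraph Γ := ⟨⟨φ, hhom⟩, hi⟩
    exact ⟨f.toSubgraph, ⟨f, hr, rfl⟩, edgeSet_toSubgraph f⟩

/-- The set of vertices covered by a set of edges. -/
def cover (U : Finset (Sym2 (Fin n))) : Finset (Fin n) := U.biUnion Sym2.toFinset

theorem mem_cover {U : Finset (Sym2 (Fin n))} {y : Fin n} : y ∈ cover U ↔ ∃ d ∈ U, y ∈ d := by
  simp [cover]

theorem card_cover_le (U : Finset (Sym2 (Fin n))) : (cover U).card ≤ 2 * U.card := by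
  rw [mul_comm, cover]
  refine Finset.card_biUnion_le_card_mul _ _ _ fun d _ => ?_
  rw [Sym2.card_toFinset]
  split_ifs <;> omega

/-- Sums over placements of products over the non-root vertices. -/
theorem sum_placements_prod_le [Fintype V] [DecidableEq V] (g : Fin n → ℝ) (hg : ∀ y, 0 ≤ g y)
    (A : Finset (V → Fin n)) (hA : A ⊆ R.placements x) :
    ∑ φ ∈ A, ∏ a ∈ R.nonroots, g (φ a) ≤ (∑ y, g y) ^ R.nonroots.card := by
  classical
  -- Injectivity is dropped: roots are pinned and the other vertices range freely, so the sum
  -- factorises.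
  let t : V → Finset (Fin n) := fun a =>
    if h : ∃ j, R.root j = a then {x h.choose} else Finset.univ
  have hsub : A ⊆ Fintype.piFinset t := fun φ hφ => by
    rw [Fintype.mem_piFinset]
    intro a
    simp only [t]
    split_ifs with h
    · rw [Finset.mem_singleton, ← (mem_placements.1 (hA hφ)).2, h.choose_spec]
    · simp
  calc ∑ φ ∈ A, ∏ a ∈ R.nonroots, g (φ a)
      ≤ ∑ φ ∈ Fintype.piFinset t, ∏ a ∈ R.nonroots, g (φ a) :=
        Finset.sum_le_sum_of_subset_of_nonneg hsub fun _ _ _ => Finset.prod_nonneg fun _ _ => hg _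
    _ = ∑ φ ∈ Fintype.piFinset t, ∏ a, if a ∈ R.nonroots then g (φ a) else 1 := by
        refine Finset.sum_congr rfl fun φ _ => ?_
        rw [Finset.prod_ite_mem, Finset.univ_inter]
    _ = ∏ a, ∑ y ∈ t a, if a ∈ R.nonroots then g y else 1 :=
        (Finset.prod_univ_sum t fun a y => if a ∈ R.nonroots then g y else 1).symm
    _ = ∏ a, if a ∈ R.nonroots then ∑ y, g y else 1 := by
        refine Finset.prod_congr rfl fun a _ => ?_
        by_cases ha : a ∈ R.nonroots
        · have h : ¬∃ j, R.root j = a := R.mem_nonroots.1 ha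
          simp [ha, t, h]
        · have h : ∃ j, R.root j = a := not_not.1 fun h => ha (R.mem_nonroots.2 h)
          simp only [ha, t, h, if_false, dif_pos]
          simp
    _ = (∑ y, g y) ^ R.nonroots.card := by
        rw [Finset.prod_ite_mem, Finset.univ_inter, Finset.prod_const]

theorem card_placements_le : ((R.placements x).card : ℝ) ≤ (n : ℝ) ^ R.nonroots.card := by
  classical
  cases nonempty_fintype V
  have := sum_placements_prod_le (R := R) (x := x) (fun _ => 1) (fun _ => zero_le_one)
    (R.placements x) subset_rfl
  simpa using this

theorem card_family_le : ((R.family x).card : ℝ) ≤ (n : ℝ) ^ R.nonroots.card :=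
  le_trans (Nat.cast_le.2 Finset.card_image_le) card_placements_le

theorem mem_cover_edgeImage (hbal : R.StrictlyBalanced)
    (hedges : R.rootSubgraph.edgeSet.ncard < R.graph.edgeSet.ncard) {a : V}
    (ha : a ∈ R.nonroots) : φ a ∈ cover (R.edgeImage φ) := by
  obtain ⟨b, hab⟩ := hbal.exists_adj hedges ha
  exact mem_cover.2 ⟨s(φ a, φ b), Finset.mem_image.2 ⟨s(a, b), R.mem_extEdges.2 hab, rfl⟩, by simp⟩

/-- The non-root vertices may be embedded arbitrarily outside `x`; their number is a descending
factorial, each factor of which is at least `n - Nat.card V`. -/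
theorem le_card_placements (x : Fin R.numRoots ↪ Fin n) :
    (n - Nat.card V) ^ R.nonroots.card ≤ (R.placements x).card := by
  classical
  cases nonempty_fintype V
  let T := {y : Fin n // y ∉ Set.range x}
  let F : ({a // a ∈ R.nonroots} ↪ T) → V → Fin n := fun f a =>
    if h : a ∈ R.nonroots then (f ⟨a, h⟩ : Fin n)
    else x (not_not.1 fun h' => h (R.mem_nonroots.2 h') : ∃ j, R.root j = a).choose
  have hFn : ∀ f a (h : a ∈ R.nonroots), F f a = f ⟨a, h⟩ := fun f a h => by simp [F, h]
  have hFr : ∀ f j, F f (R.root j) = x j := fun f j => by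
    have h : R.root j ∉ R.nonroots := by simp [mem_nonroots]
    have h2 : ∃ j', R.root j' = R.root j := ⟨j, rfl⟩
    simp only [F, h, dif_neg, not_false_eq_true]
    congr 1
    exact R.root.injective h2.choose_spec
  have hF : ∀ f, F f ∈ R.placements x := fun f => by
    refine mem_placements.2 ⟨fun a b hab => ?_, hFr f⟩
    by_cases ha : a ∈ R.nonroots <;> by_cases hb : b ∈ R.nonroots
    · rw [hFn f a ha, hFn f b hb] at hab
      simpa using f.injective (Subtype.ext hab)
    · obtain ⟨j, rfl⟩ := not_not.1 fun h' => hb (R.mem_nonroots.2 h')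
      rw [hFn f a ha, hFr] at hab
      exact absurd ⟨j, hab.symm⟩ (f ⟨a, ha⟩).2
    · obtain ⟨j, rfl⟩ := not_not.1 fun h' => ha (R.mem_nonroots.2 h')
      rw [hFn f b hb, hFr] at hab
      exact absurd ⟨j, hab⟩ (f ⟨b, hb⟩).2
    · obtain ⟨j, rfl⟩ := not_not.1 fun h' => ha (R.mem_nonroots.2 h')
      obtain ⟨j', rfl⟩ := not_not.1 fun h' => hb (R.mem_nonroots.2 h')
      rw [hFr, hFr] at hab
      rw [x.injective hab]
  have hFi : Function.Injective F := fun f g h => by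
    ext ⟨a, ha⟩
    rw [← hFn f a ha, h, hFn]
  have h1 : Fintype.card ({a // a ∈ R.nonroots} ↪ T) ≤ (R.placements x).card := by
    rw [← Finset.card_univ]
    exact Finset.card_le_card_of_injOn F (fun f _ => hF f) hFi.injOn
  refine le_trans ?_ h1
  rw [Fintype.card_embedding_eq, Fintype.card_coe]
  refine le_trans (Nat.pow_le_pow_left ?_ _) (Nat.pow_sub_le_descFactorial _ _)
  have h2 : Fintype.card T = n - R.numRoots := by
    have : Fintype.card {y : Fin n // ¬ y ∈ Set.range x} = _ := Fintype.card_subtype_compl _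
    rw [this, Fintype.card_fin]
    congr 1
    rw [← Nat.card_eq_fintype_card, Nat.card_coe_set_eq, ← Set.image_univ,
      Set.ncard_image_of_injective _ x.injective, Set.ncard_univ, Nat.card_eq_fintype_card,
      Fintype.card_fin]
  have h3 : R.nonroots.card + R.numRoots = Nat.card V := by
    rw [← card_nonroots_add]
    congr 1
    change _ = (Set.range R.root).ncard
    rw [← Set.image_univ, Set.ncard_image_of_injective _ R.root.injective, Set.ncard_univ]
    simp
  rw [h2]
  omega

/-- Every non-root vertex is sent into the at most `2 * e` vertices covered by the edge set, so few
placements share an edge set. Thus the family has order `n ^ v`. -/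
theorem card_placements_le_mul (hbal : R.StrictlyBalanced)
    (hedges : R.rootSubgraph.edgeSet.ncard < R.graph.edgeSet.ncard) :
    (R.placements x).card ≤ (2 * R.extEdges.card) ^ R.nonroots.card * (R.family x).card := by
  classical
  cases nonempty_fintype V
  refine Finset.card_le_mul_card_image _ _ fun j hj => ?_
  have hjc : (cover j).card ≤ 2 * R.extEdges.card := by
    rw [← card_of_mem_family hj]; exact card_cover_le j
  have h := sum_placements_prod_le (R := R) (x := x) (fun y => if y ∈ cover j then 1 else 0)
    (fun _ => by positivity) ((R.placements x).filter fun φ => R.edgeImage φ = j)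
    (Finset.filter_subset _ _)
  have h1 : ∀ φ ∈ (R.placements x).filter fun φ => R.edgeImage φ = j,
      ∏ a ∈ R.nonroots, (if φ a ∈ cover j then (1 : ℝ) else 0) = 1 := fun φ hφ => by
    refine Finset.prod_eq_one fun a ha => if_pos ?_
    rw [← (Finset.mem_filter.1 hφ).2]
    exact mem_cover_edgeImage hbal hedges ha
  rw [Finset.sum_congr rfl h1] at h
  simp only [Finset.sum_const, nsmul_eq_mul, mul_one, Finset.sum_boole] at h
  have h2 : (Finset.univ.filter fun y => y ∈ cover j) = cover j := by ext; simp
  rw [h2] at h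
  have h3 := Nat.pow_le_pow_left hjc R.nonroots.card
  exact le_trans (by exact_mod_cast h) h3

end RootedGraph

/-! ### Transfer to the binomial random graph, and the basic overlap estimate -/

namespace RootedGraph

open BernoulliSet

/-- The edge probabilities of the binomial random graph. -/
noncomputable def marginal (n : ℕ) (p : ℝ) : Sym2 (Fin n) → ℝ := fun d => if d.IsDiag then 0 else p

theorem marginal_mem (n : ℕ) {p : ℝ} (hp : p ∈ Set.Icc (0 : ℝ) 1) (d : Sym2 (Fin n)) :
    marginal n p d ∈ Set.Icc (0 : ℝ) 1 := by
  unfold marginal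
  split_ifs
  · simp
  · exact hp

theorem wt_marginal {n : ℕ} (p : ℝ) {S : Finset (Sym2 (Fin n))} (hS : ∀ d ∈ S, ¬d.IsDiag) :
    wt (marginal n p) S = p ^ S.card := by
  rw [wt, ← Finset.prod_const]
  exact Finset.prod_congr rfl fun d hd => by simp [marginal, hS d hd]

theorem weight_marginal {n : ℕ} (p : ℝ) {S : Finset (Sym2 (Fin n))} (hS : ∀ d ∈ S, ¬d.IsDiag) :
    weight (marginal n p) S = p ^ S.card * (1 - p) ^ (n.choose 2 - S.card) := by
  have h1 : ∀ d ∈ (Finset.univ : Finset (Sym2 (Fin n))),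
      (if d ∈ S then marginal n p d else 1 - marginal n p d) =
      (if d ∈ S then p else 1) *
        (if d ∈ (Finset.univ.filter fun d : Sym2 (Fin n) => ¬d.IsDiag) \ S then 1 - p else 1) := by
    intro d _
    by_cases hd : d ∈ S
    · simp [hd, marginal, hS d hd]
    · by_cases hdd : d.IsDiag <;> simp [hd, hdd, marginal]
  rw [weight, Finset.prod_congr rfl h1, Finset.prod_mul_distrib, Finset.prod_ite_mem,
    Finset.prod_ite_mem, Finset.univ_inter, Finset.univ_inter, Finset.prod_const, Finset.prod_const,
    Finset.card_sdiff_of_subset fun d hd => Finset.mem_filter.2 ⟨Finset.mem_univ d, hS d hd⟩]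
  congr 3
  have := Sym2.card_diagSet_compl (α := Fin n)
  rw [Fintype.card_fin] at this
  rw [← this, ← Set.toFinset_card]
  congr 1
  ext d
  simp

theorem weight_marginal_of_isDiag {n : ℕ} (p : ℝ) {S : Finset (Sym2 (Fin n))} {d : Sym2 (Fin n)}
    (hd : d ∈ S) (hdd : d.IsDiag) : weight (marginal n p) S = 0 :=
  Finset.prod_eq_zero (Finset.mem_univ d) (by simp [hd, hdd, marginal])

/-- Sets with a diagonal pair have weight zero; the remaining sets are the edge sets of graphs, with
matching weights. -/
theorem integral_binomialRandom {n : ℕ} (p : unitInterval) (F : SimpleGraph (Fin n) → ℝ) :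
    ∫ Γ, F Γ ∂(binomialRandom (Fin n) p) =
      expect (marginal n p) fun s => F (fromEdgeSet (s : Set (Sym2 (Fin n)))) := by
  classical
  have hsing : MeasurableSingletonClass (SimpleGraph (Fin n)) := ⟨fun Γ => by
    rw [← measurableEmbedding_edgeSet.measurableSet_image]
    simp⟩
  rw [integral_fintype .of_finite, expect]
  rw [← Finset.sum_filter_of_ne (p := fun s : Finset (Sym2 (Fin n)) => ∀ d ∈ s, ¬d.IsDiag)]
  · have hmem : ∀ (Γ : SimpleGraph (Fin n)) d, d ∈ (Set.toFinite Γ.edgeSet).toFinset → ¬d.IsDiag :=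
      fun Γ d hd => Γ.not_isDiag_of_mem_edgeSet ((Set.Finite.mem_toFinset _).1 hd)
    refine Finset.sum_bij' (fun Γ _ => (Set.toFinite Γ.edgeSet).toFinset)
      (fun s _ => fromEdgeSet s) ?_ ?_ ?_ ?_ ?_
    · exact fun Γ _ => Finset.mem_filter.2 ⟨Finset.mem_univ _, hmem Γ⟩
    · exact fun _ _ => Finset.mem_univ _
    · intro Γ _
      simp
    · intro s hs
      have hs' := (Finset.mem_filter.1 hs).2
      ext d
      rw [Set.Finite.mem_toFinset, edgeSet_fromEdgeSet]
      exact ⟨fun h => h.1, fun h => ⟨h, hs' d h⟩⟩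
    · intro Γ _
      rw [weight_marginal p (hmem Γ)]
      simp only [Set.Finite.coe_toFinset, fromEdgeSet_edgeSet, smul_eq_mul]
      congr 1
      rw [Measure.real, binomialRandom_singleton, Nat.card_eq_fintype_card, Fintype.card_fin,
        ← Set.ncard_coe_finset, Set.Finite.coe_toFinset]
      simp
  · intro s _ h d hd hdd
    rw [weight_marginal_of_isDiag _ hd hdd, zero_mul] at h
    exact h rfl

theorem real_binomialRandom {n : ℕ} (p : unitInterval) (A : Set (SimpleGraph (Fin n))) :
    (binomialRandom (Fin n) p).real A =
      prob (marginal n p) {s | fromEdgeSet (s : Set (Sym2 (Fin n))) ∈ A} := by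
  have hsing : MeasurableSingletonClass (SimpleGraph (Fin n)) := ⟨fun Γ => by
    rw [← measurableEmbedding_edgeSet.measurableSet_image]
    simp⟩
  rw [← integral_indicator_one (Set.toFinite A).measurableSet, integral_binomialRandom]
  rfl

set_option linter.unusedSectionVars false

variable {V : Type*} [Finite V] {R : RootedGraph V} {n : ℕ}

theorem wt_of_mem_family (p : ℝ) {x : Fin R.numRoots ↪ Fin n} {j : Finset (Sym2 (Fin n))}
    (hj : j ∈ R.family x) : wt (marginal n p) j = p ^ R.extEdges.card := by
  rw [wt_marginal p fun d hd => not_isDiag_of_mem_family hj hd, card_of_mem_family hj]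

theorem wt_sdiff_of_mem_family (p : ℝ) {x : Fin R.numRoots ↪ Fin n} {j : Finset (Sym2 (Fin n))}
    (hj : j ∈ R.family x) (U : Finset (Sym2 (Fin n))) :
    wt (marginal n p) (j \ U) = p ^ (j \ U).card :=
  wt_marginal p fun _ hd => not_isDiag_of_mem_family hj (Finset.sdiff_subset hd)

theorem sum_wt_family (p : ℝ) (x : Fin R.numRoots ↪ Fin n) :
    ∑ j ∈ R.family x, wt (marginal n p) j = (R.family x).card * p ^ R.extEdges.card := by
  rw [Finset.sum_congr rfl fun j hj => wt_of_mem_family p hj]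
  simp

theorem extensionCount_fromEdgeSet (hbal : R.StrictlyBalanced)
    (hedges : R.rootSubgraph.edgeSet.ncard < R.graph.edgeSet.ncard)
    (s : Finset (Sym2 (Fin n))) (x : Fin R.numRoots ↪ Fin n) :
    R.extensionCount (fromEdgeSet (s : Set (Sym2 (Fin n)))) x = numIn (R.family x) s :=
  extensionCount_eq_numIn hbal hedges _ s (edgeSet_fromEdgeSet _)

theorem mu_eq_sum_wt (hbal : R.StrictlyBalanced)
    (hedges : R.rootSubgraph.edgeSet.ncard < R.graph.edgeSet.ncard) (p : unitInterval)
    (x : Fin R.numRoots ↪ Fin n) : R.mu n p = ∑ j ∈ R.family x, wt (marginal n p) j := by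
  rw [← R.integral_extensionCount p x, integral_binomialRandom, ← expect_numIn]
  simp only [extensionCount_fromEdgeSet hbal hedges]

theorem mu_eq (hbal : R.StrictlyBalanced)
    (hedges : R.rootSubgraph.edgeSet.ncard < R.graph.edgeSet.ncard) (p : unitInterval)
    (x : Fin R.numRoots ↪ Fin n) : R.mu n p = (R.family x).card * (p : ℝ) ^ R.extEdges.card := by
  rw [mu_eq_sum_wt hbal hedges p x, sum_wt_family]

theorem concentrationProb_eq (hbal : R.StrictlyBalanced)
    (hedges : R.rootSubgraph.edgeSet.ncard < R.graph.edgeSet.ncard) (p : unitInterval) (ε : ℝ) :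
    R.concentrationProb n p ε = prob (marginal n p)
      {s | ∀ x, |(numIn (R.family x) s : ℝ) - R.mu n p| < ε * R.mu n p} := by
  rw [concentrationProb, real_binomialRandom]
  simp only [Set.mem_ofPred_eq, extensionCount_fromEdgeSet hbal hedges]

/-- The order of magnitude `n ^ v * p ^ e` of the expected number of extensions. -/
noncomputable def scale (R : RootedGraph V) (n : ℕ) (p : ℝ) : ℝ :=
  (n : ℝ) ^ R.nonroots.card * p ^ R.extEdges.card

theorem scale_nonneg {p : ℝ} (hp : 0 ≤ p) : 0 ≤ R.scale n p := by unfold scale; positivity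

theorem mu_le_scale (hbal : R.StrictlyBalanced)
    (hedges : R.rootSubgraph.edgeSet.ncard < R.graph.edgeSet.ncard) (p : unitInterval) :
    R.mu n p ≤ R.scale n p := by
  by_cases h : R.numRoots ≤ n
  · rw [mu_eq hbal hedges p (Fin.castLEEmb h), scale]
    have := p.2.1
    gcongr
    exact card_family_le
  · rw [mu, dif_neg h]
    exact scale_nonneg p.2.1

theorem mu_nonneg (p : unitInterval) : 0 ≤ R.mu n p := by
  rw [mu]
  split_ifs
  · exact integral_nonneg fun _ => Nat.cast_nonneg _
  · exact le_rfl

/-- A lower bound for `mu / scale`. -/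
noncomputable def ratio (R : RootedGraph V) : ℝ :=
  1 / (2 ^ R.nonroots.card * (2 * R.extEdges.card) ^ R.nonroots.card)

theorem ratio_pos (hedges : R.rootSubgraph.edgeSet.ncard < R.graph.edgeSet.ncard) :
    0 < R.ratio := by
  have := card_extEdges_pos hedges
  unfold ratio
  positivity

theorem ratio_mul_pow_le_card_family (hbal : R.StrictlyBalanced)
    (hedges : R.rootSubgraph.edgeSet.ncard < R.graph.edgeSet.ncard) (hn : 2 * Nat.card V ≤ n)
    (x : Fin R.numRoots ↪ Fin n) :
    R.ratio * (n : ℝ) ^ R.nonroots.card ≤ (R.family x).card := by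
  have he := card_extEdges_pos hedges
  have h1 := (le_card_placements x).trans (card_placements_le_mul (x := x) hbal hedges)
  have h2 : (n : ℝ) / 2 ≤ ((n - Nat.card V : ℕ) : ℝ) := by
    rw [Nat.cast_sub (by omega)]
    have : (2 : ℝ) * Nat.card V ≤ n := by exact_mod_cast hn
    linarith
  have h3 : ((n : ℝ) / 2) ^ R.nonroots.card ≤
      (2 * R.extEdges.card) ^ R.nonroots.card * (R.family x).card := by
    calc ((n : ℝ) / 2) ^ R.nonroots.card ≤ ((n - Nat.card V : ℕ) : ℝ) ^ R.nonroots.card := by gcongr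
      _ ≤ _ := by exact_mod_cast h1
  rw [ratio, one_div, inv_mul_le_iff₀ (by positivity), mul_assoc]
  rw [div_pow, div_le_iff₀' (by positivity)] at h3
  exact h3

theorem ratio_mul_scale_le_mu (hbal : R.StrictlyBalanced)
    (hedges : R.rootSubgraph.edgeSet.ncard < R.graph.edgeSet.ncard) (hn : 2 * Nat.card V ≤ n)
    (hr : R.numRoots ≤ n) (p : unitInterval) : R.ratio * R.scale n p ≤ R.mu n p := by
  rw [mu_eq hbal hedges p (Fin.castLEEmb hr), scale, ← mul_assoc]
  have := p.2.1
  gcongr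
  exact ratio_mul_pow_le_card_family hbal hedges hn _

/-- The exponent gained from each overlap. -/
noncomputable def gap (R : RootedGraph V) : ℝ := 1 / (2 * R.extEdges.card)

theorem gap_pos (hedges : R.rootSubgraph.edgeSet.ncard < R.graph.edgeSet.ncard) : 0 < R.gap := by
  have := card_extEdges_pos hedges
  unfold gap
  positivity

/-- Here strict balance becomes a polynomial gain. In the `e`-th power, integrality of the strict
inequality yields a spare factor `n` next to `scale ^ S`, and `S ≤ e` with `gap = 1 / (2 * e)` loses
at most `n ^ (1 / 2)`. What remains is `n ^ (1 / 2) = (n ^ gap) ^ e`. -/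
theorem rpow_gap_le {p : ℝ} (hp : p ∈ Set.Icc (0 : ℝ) 1) (hn : 1 ≤ n)
    (hedges : R.rootSubgraph.edgeSet.ncard < R.graph.edgeSet.ncard)
    (hscale : (n : ℝ) ^ (-R.gap) ≤ R.scale n p) {w S : ℕ} (hS : S ≤ R.extEdges.card)
    (h : S * R.nonroots.card < R.extEdges.card * w) :
    (n : ℝ) ^ R.gap ≤ (n : ℝ) ^ w * p ^ S := by
  have he := card_extEdges_pos hedges
  have hn0 : (0 : ℝ) < n := by exact_mod_cast hn
  have hn1 : (1 : ℝ) ≤ n := by exact_mod_cast hn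
  have hp0 := hp.1
  refine le_of_pow_le_pow_left₀ he.ne' (by positivity) ?_
  have h1 : ((n : ℝ) ^ R.gap) ^ R.extEdges.card = (n : ℝ) ^ (1 / 2 : ℝ) := by
    rw [← Real.rpow_natCast, ← Real.rpow_mul hn0.le, gap]
    congr 1
    have : (R.extEdges.card : ℝ) ≠ 0 := by positivity
    field_simp
  rw [h1]
  calc (n : ℝ) ^ (1 / 2 : ℝ) ≤ (n : ℝ) * ((n : ℝ) ^ (-R.gap)) ^ S := by
        rw [← Real.rpow_natCast, ← Real.rpow_mul hn0.le]
        nth_rewrite 2 [← Real.rpow_one (n : ℝ)]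
        rw [← Real.rpow_add hn0]
        refine Real.rpow_le_rpow_of_exponent_le hn1 ?_
        have h2 : R.gap * S ≤ 1 / 2 := by
          rw [gap, div_mul_eq_mul_div, one_mul, div_le_div_iff₀ (by positivity) two_pos]
          have : (S : ℝ) ≤ R.extEdges.card := by exact_mod_cast hS
          linarith
        linarith
    _ ≤ (n : ℝ) * (R.scale n p) ^ S := by gcongr
    _ = (n : ℝ) ^ (S * R.nonroots.card + 1) * p ^ (S * R.extEdges.card) := by
        rw [scale, mul_pow, ← pow_mul, ← pow_mul, mul_comm R.nonroots.card, mul_comm R.extEdges.card]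
        ring
    _ ≤ (n : ℝ) ^ (R.extEdges.card * w) * p ^ (S * R.extEdges.card) := by
        gcongr
        exact h
    _ = ((n : ℝ) ^ w * p ^ S) ^ R.extEdges.card := by
        rw [mul_pow, ← pow_mul, ← pow_mul, mul_comm w]

open Classical in
/-- The contribution of a placement that overlaps a vertex set `T`, relative to edges inside `T`. -/
theorem pow_card_sdiff_le (hbal : R.StrictlyBalanced)
    (hedges : R.rootSubgraph.edgeSet.ncard < R.graph.edgeSet.ncard) {p : ℝ}
    (hp : p ∈ Set.Icc (0 : ℝ) 1) (hn : 1 ≤ n)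
    (hscale : (n : ℝ) ^ (-R.gap) ≤ R.scale n p) {T : Finset (Fin n)}
    {U : Finset (Sym2 (Fin n))} (hU : cover U ⊆ T) {x : Fin R.numRoots ↪ Fin n} {φ : V → Fin n}
    (hφ : φ ∈ R.placements x) (hφT : ∃ a ∈ R.nonroots, φ a ∈ T) (hφU : ¬R.edgeImage φ ⊆ U) :
    p ^ (R.edgeImage φ \ U).card ≤
      p ^ R.extEdges.card * (n : ℝ) ^ (-R.gap) * ∏ a ∈ R.nonroots, (if φ a ∈ T then (n : ℝ) else 1) := by
  have hn0 : (0 : ℝ) < n := by exact_mod_cast hn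
  have hp0 := hp.1
  set W := R.nonroots.filter fun a => φ a ∈ T with hW
  have hinj := (mem_placements.1 hφ).1
  have hprod : ∏ a ∈ R.nonroots, (if φ a ∈ T then (n : ℝ) else 1) = (n : ℝ) ^ W.card := by
    rw [Finset.prod_ite, Finset.prod_const_one, mul_one, Finset.prod_const]
  set S := (R.edgeImage φ ∩ U).card with hS
  have hcard : (R.edgeImage φ \ U).card + S = R.extEdges.card := by
    rw [hS, Finset.card_sdiff_add_card_inter, card_edgeImage hinj]
  have hW0 : W.Nonempty := by
    obtain ⟨a, ha, haT⟩ := hφT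
    exact ⟨a, Finset.mem_filter.2 ⟨ha, haT⟩⟩
  -- If all non-root vertices land in `T`, strictness comes from an edge outside `U`; otherwise it
  -- comes from strict balance.
  have hlt : S * R.nonroots.card < R.extEdges.card * W.card := by
    by_cases hW1 : W = R.nonroots
    · rw [hW1]
      refine Nat.mul_lt_mul_of_pos_right ?_ (card_nonroots_pos hedges)
      have : 0 < (R.edgeImage φ \ U).card := Finset.card_pos.2 (Finset.sdiff_nonempty.2 hφU)
      omega
    · refine lt_of_le_of_lt (Nat.mul_le_mul_right _ ?_)
        (hbal.card_mul_lt (Finset.filter_subset _ _) hW0 hW1)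
      have hsub : R.edgeImage φ ∩ U ⊆
          (R.extEdges.filter fun d => ∀ a ∈ d, a ∈ R.nonroots → a ∈ W).image (Sym2.map φ) := by
        intro d hd
        obtain ⟨hd1, hd2⟩ := Finset.mem_inter.1 hd
        obtain ⟨d', hd', rfl⟩ := Finset.mem_image.1 hd1
        refine Finset.mem_image_of_mem _ (Finset.mem_filter.2 ⟨hd', fun a ha han => ?_⟩)
        refine Finset.mem_filter.2 ⟨han, hU (mem_cover.2 ⟨_, hd2, ?_⟩)⟩
        exact Sym2.mem_map.2 ⟨a, ha, rfl⟩
      exact (Finset.card_le_card hsub).trans Finset.card_image_le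
  have h := rpow_gap_le hp hn hedges hscale (by omega) hlt
  rw [hprod, ← hcard, pow_add]
  have h1 : (n : ℝ) ^ R.gap * (n : ℝ) ^ (-R.gap) = 1 := by
    rw [← Real.rpow_add hn0]; simp
  calc p ^ (R.edgeImage φ \ U).card
      = p ^ (R.edgeImage φ \ U).card * ((n : ℝ) ^ R.gap * (n : ℝ) ^ (-R.gap)) := by rw [h1, mul_one]
    _ ≤ p ^ (R.edgeImage φ \ U).card * (((n : ℝ) ^ W.card * p ^ S) * (n : ℝ) ^ (-R.gap)) := by
        gcongr
    _ = _ := by ring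

/-- The total weight of the placements overlapping a vertex set `T`, relative to edges inside `T`. -/
theorem sum_pow_card_sdiff_le (hbal : R.StrictlyBalanced)
    (hedges : R.rootSubgraph.edgeSet.ncard < R.graph.edgeSet.ncard) {p : ℝ}
    (hp : p ∈ Set.Icc (0 : ℝ) 1) (hn : 1 ≤ n)
    (hscale : (n : ℝ) ^ (-R.gap) ≤ R.scale n p) {T : Finset (Fin n)}
    {U : Finset (Sym2 (Fin n))} (hU : cover U ⊆ T) (x : Fin R.numRoots ↪ Fin n)
    {A : Finset (V → Fin n)} (hA : ∀ φ ∈ A, φ ∈ R.placements x ∧ (∃ a ∈ R.nonroots, φ a ∈ T) ∧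
      ¬R.edgeImage φ ⊆ U) :
    ∑ φ ∈ A, p ^ (R.edgeImage φ \ U).card ≤
      (T.card + 1) ^ R.nonroots.card * (R.scale n p * (n : ℝ) ^ (-R.gap)) := by
  classical
  cases nonempty_fintype V
  have hp0 := hp.1
  -- A vertex sent into `T` has `T.card` possibilities of weight `n` in place of `n` possibilities
  -- of weight one, so the sum over placements keeps its order `n ^ v`.
  have h1 : ∑ y : Fin n, (if y ∈ T then (n : ℝ) else 1) ≤ n * (T.card + 1) := by
    have h2 : ∀ y ∈ (Finset.univ : Finset (Fin n)),
        (if y ∈ T then (n : ℝ) else 1) ≤ (if y ∈ T then (n : ℝ) else 0) + 1 := fun y _ => by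
      split_ifs <;> linarith
    refine (Finset.sum_le_sum h2).trans (le_of_eq ?_)
    rw [Finset.sum_add_distrib, Finset.sum_ite_mem, Finset.univ_inter]
    simp
    ring
  calc ∑ φ ∈ A, p ^ (R.edgeImage φ \ U).card
      ≤ ∑ φ ∈ A, p ^ R.extEdges.card * (n : ℝ) ^ (-R.gap) *
          ∏ a ∈ R.nonroots, (if φ a ∈ T then (n : ℝ) else 1) :=
        Finset.sum_le_sum fun φ hφ => pow_card_sdiff_le hbal hedges hp hn hscale hU (hA φ hφ).1
          (hA φ hφ).2.1 (hA φ hφ).2.2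
    _ = p ^ R.extEdges.card * (n : ℝ) ^ (-R.gap) *
          ∑ φ ∈ A, ∏ a ∈ R.nonroots, (if φ a ∈ T then (n : ℝ) else 1) := by rw [Finset.mul_sum]
    _ ≤ p ^ R.extEdges.card * (n : ℝ) ^ (-R.gap) * (n * (T.card + 1)) ^ R.nonroots.card := by
        gcongr
        refine (sum_placements_prod_le (fun y => if y ∈ T then (n : ℝ) else 1)
          (fun y => by positivity) A fun φ hφ => (hA φ hφ).1).trans ?_
        gcongr
    _ = _ := by rw [scale, mul_pow]; ring

/-- Passing from edge sets to placements can only overcount. The overlap is required in vertices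
rather than edges because the case that is not grounded needs copies sharing just a vertex. -/
theorem sum_wt_sdiff_le_of_cover (hbal : R.StrictlyBalanced)
    (hedges : R.rootSubgraph.edgeSet.ncard < R.graph.edgeSet.ncard) {p : ℝ}
    (hp : p ∈ Set.Icc (0 : ℝ) 1) (hn : 1 ≤ n)
    (hscale : (n : ℝ) ^ (-R.gap) ≤ R.scale n p) (U : Finset (Sym2 (Fin n)))
    (x : Fin R.numRoots ↪ Fin n) {𝓐 : Finset (Finset (Sym2 (Fin n)))}
    (h𝓐 : ∀ j ∈ 𝓐, j ∈ R.family x ∧ ¬j ⊆ U)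
    (hcov : ∀ φ ∈ R.placements x, R.edgeImage φ ∈ 𝓐 → ∃ a ∈ R.nonroots, φ a ∈ cover U) :
    ∑ j ∈ 𝓐, wt (marginal n p) (j \ U) ≤
      (2 * U.card + 1) ^ R.nonroots.card * (R.scale n p * (n : ℝ) ^ (-R.gap)) := by
  classical
  have hp0 := hp.1
  have himg : 𝓐 = ((R.placements x).filter fun φ => R.edgeImage φ ∈ 𝓐).image R.edgeImage := by
    ext j
    refine ⟨fun hj => ?_, fun hj => ?_⟩
    · obtain ⟨φ, hφ, rfl⟩ := Finset.mem_image.1 (h𝓐 j hj).1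
      exact Finset.mem_image_of_mem _ (Finset.mem_filter.2 ⟨hφ, hj⟩)
    · obtain ⟨φ, hφ, rfl⟩ := Finset.mem_image.1 hj
      exact (Finset.mem_filter.1 hφ).2
  rw [Finset.sum_congr rfl fun j hj => wt_sdiff_of_mem_family p (h𝓐 j hj).1 U, himg]
  refine (Finset.sum_image_le_of_nonneg fun _ _ => by positivity).trans ?_
  refine (sum_pow_card_sdiff_le hbal hedges hp hn hscale subset_rfl x fun φ hφ => ?_).trans ?_
  · obtain ⟨h1, h2⟩ := Finset.mem_filter.1 hφ
    exact ⟨h1, hcov φ h1 h2, (h𝓐 _ h2).2⟩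
  · have h1 : ((cover U).card : ℝ) ≤ 2 * U.card := by exact_mod_cast card_cover_le U
    have h2 : 0 ≤ R.scale n p * (n : ℝ) ^ (-R.gap) :=
      mul_nonneg (scale_nonneg hp0) (by positivity)
    clear himg
    gcongr

/-- The total weight of the extensions that share some, but not all, edges with `U`. -/
theorem sum_wt_sdiff_le (hbal : R.StrictlyBalanced)
    (hedges : R.rootSubgraph.edgeSet.ncard < R.graph.edgeSet.ncard) {p : ℝ}
    (hp : p ∈ Set.Icc (0 : ℝ) 1) (hn : 1 ≤ n)
    (hscale : (n : ℝ) ^ (-R.gap) ≤ R.scale n p) (U : Finset (Sym2 (Fin n)))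
    (x : Fin R.numRoots ↪ Fin n) {𝓐 : Finset (Finset (Sym2 (Fin n)))}
    (h𝓐 : ∀ j ∈ 𝓐, j ∈ R.family x ∧ ¬Disjoint U j ∧ ¬j ⊆ U) :
    ∑ j ∈ 𝓐, wt (marginal n p) (j \ U) ≤
      (2 * U.card + 1) ^ R.nonroots.card * (R.scale n p * (n : ℝ) ^ (-R.gap)) := by
  refine sum_wt_sdiff_le_of_cover hbal hedges hp hn hscale U x
    (fun j hj => ⟨(h𝓐 j hj).1, (h𝓐 j hj).2.2⟩) fun φ _ hj => ?_
  obtain ⟨d, hdU, hd⟩ := Finset.not_disjoint_iff.1 (h𝓐 _ hj).2.1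
  obtain ⟨d', hd', rfl⟩ := Finset.mem_image.1 hd
  obtain ⟨a, had, ha⟩ := R.exists_nonroot_of_mem_extEdges hd'
  exact ⟨a, ha, mem_cover.2 ⟨_, hdU, Sym2.mem_map.2 ⟨a, had, rfl⟩⟩⟩

end RootedGraph

/-! ### Poisson approximation, tails and overlaps for extension counts -/

namespace BernoulliSet

set_option linter.unusedSectionVars false

variable {ι : Type*} [Fintype ι] [DecidableEq ι]

theorem overlap_eq (π : ι → ℝ) (𝓖 : Finset (Finset ι)) (i : Finset ι) :
    overlap π 𝓖 i = wt π i * ∑ j ∈ 𝓖 with ¬Disjoint i j, wt π (j \ i) := by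
  rw [overlap, Finset.mul_sum]
  exact Finset.sum_congr rfl fun j _ => wt_union π i j

/-- Poisson approximation of point probabilities, jointly with another counting variable. -/
theorem abs_expect_indicator_sub_le {π : ι → ℝ} (hπ : ∀ i, π i ∈ Set.Icc (0 : ℝ) 1)
    (𝓕 𝓖 : Finset (Finset ι)) (hμ : 0 < ∑ i ∈ 𝓕, wt π i) (m : ℕ) {g : ℕ → ℝ}
    (hg : ∀ k, |g k| ≤ 1) :
    |expect π (fun s => g (numIn 𝓖 s) * ((if numIn 𝓕 s = m then 1 else 0) -
        poissonWeight (∑ i ∈ 𝓕, wt π i) m))| ≤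
      2 * (1 + 1 / ∑ i ∈ 𝓕, wt π i) *
        ∑ i ∈ 𝓕, (overlap π (𝓕.erase i) i + wt π i ^ 2 + overlap π 𝓖 i) := by
  obtain ⟨f, hf, hstein⟩ := exists_stein_solution hμ m
  have h := abs_expect_stein_le hπ 𝓕 𝓖 hf hg
  simpa only [hstein] using h

end BernoulliSet

namespace RootedGraph

open BernoulliSet

set_option linter.unusedSectionVars false

variable {V : Type*} [Finite V] {R : RootedGraph V} {n : ℕ}

/-- The constant in the overlap bounds for a set of at most `N` edges. -/
noncomputable def overlapConst (R : RootedGraph V) (N : ℕ) : ℝ := (2 * N + 1) ^ R.nonroots.card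

theorem one_le_overlapConst (N : ℕ) : 1 ≤ R.overlapConst N := by
  refine one_le_pow₀ ?_
  have : (0 : ℝ) ≤ N := Nat.cast_nonneg _
  linarith

theorem not_subset_of_mem_family {x y : Fin R.numRoots ↪ Fin n} {i j : Finset (Sym2 (Fin n))}
    (hi : i ∈ R.family x) (hj : j ∈ R.family y) (h : j ≠ i) : ¬j ⊆ i := fun hs =>
  h (Finset.eq_of_subset_of_card_le hs (by rw [card_of_mem_family hi, card_of_mem_family hj]))

/-- The overlap estimate is applied with `U = i`; distinct members have equal size, so none contains
another. -/
theorem sum_overlap_erase_le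
    (hbal : R.StrictlyBalanced) (hedges : R.rootSubgraph.edgeSet.ncard < R.graph.edgeSet.ncard)
    {p : unitInterval} (hn : 1 ≤ n) (hscale : (n : ℝ) ^ (-R.gap) ≤ R.scale n p)
    (x : Fin R.numRoots ↪ Fin n) :
    ∑ i ∈ R.family x, overlap (marginal n p) ((R.family x).erase i) i ≤
    R.mu n p * (R.overlapConst R.extEdges.card * (R.scale n p * (n : ℝ) ^ (-R.gap))) := by
  rw [mu_eq_sum_wt hbal hedges p x, Finset.sum_mul]
  refine Finset.sum_le_sum fun i hi => ?_
  rw [overlap_eq]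
  refine mul_le_mul_of_nonneg_left ?_ (wt_nonneg (marginal_mem n p.2) i)
  have h := sum_wt_sdiff_le hbal hedges p.2 hn hscale i x
    (𝓐 := ((R.family x).erase i).filter fun j => ¬Disjoint i j) fun j hj => by
      rw [Finset.mem_filter, Finset.mem_erase] at hj
      exact ⟨hj.1.2, hj.2, not_subset_of_mem_family hi hj.1.2 hj.1.1⟩
  rwa [card_of_mem_family hi] at h

theorem sum_overlap_le
    (hbal : R.StrictlyBalanced) (hedges : R.rootSubgraph.edgeSet.ncard < R.graph.edgeSet.ncard)
    {p : unitInterval} (hn : 1 ≤ n) (hscale : (n : ℝ) ^ (-R.gap) ≤ R.scale n p)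
    (x : Fin R.numRoots ↪ Fin n) :
    ∑ i ∈ R.family x, overlap (marginal n p) (R.family x) i ≤
    R.mu n p * (1 + R.overlapConst R.extEdges.card * (R.scale n p * (n : ℝ) ^ (-R.gap))) := by
  have h := sum_overlap_erase_le hbal hedges hn hscale x
  have h1 : ∀ i ∈ R.family x, overlap (marginal n p) (R.family x) i ≤ wt (marginal n p) i +
      overlap (marginal n p) ((R.family x).erase i) i := fun i hi => by
    have h2 : (R.family x).filter (fun j => ¬Disjoint i j) ⊆
        insert i (((R.family x).erase i).filter fun j => ¬Disjoint i j) := fun j hj => by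
      rw [Finset.mem_filter] at hj
      rw [Finset.mem_insert, Finset.mem_filter, Finset.mem_erase]
      by_cases hji : j = i
      · exact Or.inl hji
      · exact Or.inr ⟨⟨hji, hj.1⟩, hj.2⟩
    refine (Finset.sum_le_sum_of_subset_of_nonneg h2 fun j _ _ =>
      wt_nonneg (marginal_mem n p.2) _).trans (le_of_eq ?_)
    rw [Finset.sum_insert (by simp), Finset.union_idempotent, overlap]
  refine (Finset.sum_le_sum h1).trans ?_
  rw [Finset.sum_add_distrib, ← mu_eq_sum_wt hbal hedges p x, mul_add, mul_one]
  linarith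

/-- Each weight is `p ^ e`, which is at most `scale * n ^ (-gap)` because `gap ≤ 1 ≤ v`. -/
theorem sum_wt_sq_le
    (hbal : R.StrictlyBalanced) (hedges : R.rootSubgraph.edgeSet.ncard < R.graph.edgeSet.ncard)
    {p : unitInterval} (hn : 1 ≤ n)
    (x : Fin R.numRoots ↪ Fin n) :
    ∑ i ∈ R.family x, wt (marginal n p) i ^ 2 ≤
    R.mu n p * (R.scale n p * (n : ℝ) ^ (-R.gap)) := by
  rw [mu_eq_sum_wt hbal hedges p x, Finset.sum_mul]
  refine Finset.sum_le_sum fun i hi => ?_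
  rw [pow_two]
  refine mul_le_mul_of_nonneg_left ?_ (wt_nonneg (marginal_mem n p.2) i)
  have hn0 : (0 : ℝ) < n := by exact_mod_cast hn
  rw [wt_of_mem_family _ hi, scale]
  have h1 : (1 : ℝ) ≤ (n : ℝ) ^ R.nonroots.card * (n : ℝ) ^ (-R.gap) := by
    rw [← Real.rpow_natCast, ← Real.rpow_add hn0]
    refine Real.one_le_rpow (by exact_mod_cast hn) ?_
    have h2 : (1 : ℝ) ≤ R.nonroots.card := by exact_mod_cast card_nonroots_pos hedges
    have h3 : R.gap ≤ 1 := by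
      have : (1 : ℝ) ≤ R.extEdges.card := by exact_mod_cast card_extEdges_pos hedges
      rw [gap, div_le_one (by positivity)]
      linarith
    linarith
  have h2 : (0 : ℝ) ≤ (p : ℝ) ^ R.extEdges.card := pow_nonneg p.2.1 _
  nlinarith

theorem mu_pos_of_scale
    (hbal : R.StrictlyBalanced) (hedges : R.rootSubgraph.edgeSet.ncard < R.graph.edgeSet.ncard)
    {p : unitInterval} (hn : 1 ≤ n) (hscale : (n : ℝ) ^ (-R.gap) ≤ R.scale n p)
    (x : Fin R.numRoots ↪ Fin n) (hn2 : 2 * Nat.card V ≤ n) : 0 < R.mu n p := by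
  have hn0 : (0 : ℝ) < n := by exact_mod_cast hn
  have hr : R.numRoots ≤ n := by simpa using Fintype.card_le_of_embedding x
  have h1 : 0 < R.scale n p := lt_of_lt_of_le (by positivity) hscale
  exact lt_of_lt_of_le (mul_pos (ratio_pos hedges) h1)
    (ratio_mul_scale_le_mu hbal hedges hn2 hr p)

/-- Poisson approximation for extension counts. -/
theorem abs_expect_extension_le
    (hbal : R.StrictlyBalanced) (hedges : R.rootSubgraph.edgeSet.ncard < R.graph.edgeSet.ncard)
    {p : unitInterval} (hn : 1 ≤ n) (hscale : (n : ℝ) ^ (-R.gap) ≤ R.scale n p)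
    (x : Fin R.numRoots ↪ Fin n) (hn2 : 2 * Nat.card V ≤ n) (𝓖 : Finset (Finset (Sym2 (Fin n))))
    {B : ℝ} (h𝓖 : ∑ i ∈ R.family x, overlap (marginal n p) 𝓖 i ≤ R.mu n p * B) (m : ℕ)
    {g : ℕ → ℝ} (hg : ∀ k, |g k| ≤ 1) :
    |expect (marginal n p) (fun s => g (numIn 𝓖 s) *
      ((if numIn (R.family x) s = m then 1 else 0) - poissonWeight (R.mu n p) m))| ≤
      2 * (1 + R.mu n p) *
        ((R.overlapConst R.extEdges.card + 1) * (R.scale n p * (n : ℝ) ^ (-R.gap)) + B) := by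
  have hμ := mu_pos_of_scale hbal hedges hn hscale x hn2
  have hμ' := mu_eq_sum_wt hbal hedges p x
  have h := abs_expect_indicator_sub_le (marginal_mem n p.2) (R.family x) 𝓖 (hμ' ▸ hμ) m hg
  rw [← hμ'] at h
  refine h.trans ?_
  rw [Finset.sum_add_distrib, Finset.sum_add_distrib]
  have h1 := sum_overlap_erase_le hbal hedges hn hscale x
  have h2 := sum_wt_sq_le hbal hedges (p := p) hn x
  calc 2 * (1 + 1 / R.mu n p) * _
      ≤ 2 * (1 + 1 / R.mu n p) * (R.mu n p * (R.overlapConst R.extEdges.card * (R.scale n p *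
          (n : ℝ) ^ (-R.gap))) + R.mu n p * (R.scale n p * (n : ℝ) ^ (-R.gap)) + R.mu n p * B) := by
        gcongr
    _ = _ := by field_simp; ring

/-- Janson's inequality for extension counts. -/
theorem prob_lower_tail_le
    (hbal : R.StrictlyBalanced) (hedges : R.rootSubgraph.edgeSet.ncard < R.graph.edgeSet.ncard)
    {p : unitInterval} (hn : 1 ≤ n) (hscale : (n : ℝ) ^ (-R.gap) ≤ R.scale n p)
    (x : Fin R.numRoots ↪ Fin n) (hn2 : 2 * Nat.card V ≤ n) {ε : ℝ} (hε : 0 ≤ ε) :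
    prob (marginal n p) {s | (numIn (R.family x) s : ℝ) ≤ R.mu n p - ε * R.mu n p} ≤
      Real.exp (-(ε ^ 2 * R.mu n p / (2 * (1 + R.overlapConst R.extEdges.card *
        (R.scale n p * (n : ℝ) ^ (-R.gap)))))) := by
  have hμ := mu_pos_of_scale hbal hedges hn hscale x hn2
  have hK : 0 ≤ R.overlapConst R.extEdges.card * (R.scale n p * (n : ℝ) ^ (-R.gap)) := by
    have := one_le_overlapConst (R := R) R.extEdges.card
    have := scale_nonneg (R := R) (n := n) p.2.1
    positivity
  have h := prob_numIn_le_sub (marginal_mem n p.2) (R.family x) (a := ε * R.mu n p)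
    (by positivity) (by positivity) (sum_overlap_le hbal hedges hn hscale x)
  rw [← mu_eq_sum_wt hbal hedges p x] at h
  refine h.trans (le_of_eq ?_)
  congr 2
  field_simp

/-- The upper tail of extension counts. -/
theorem prob_upper_tail_le
    (hbal : R.StrictlyBalanced) (hedges : R.rootSubgraph.edgeSet.ncard < R.graph.edgeSet.ncard)
    {p : unitInterval} (hn : 1 ≤ n) (hscale : (n : ℝ) ^ (-R.gap) ≤ R.scale n p)
    (x : Fin R.numRoots ↪ Fin n) {a b t : ℝ} (ha : 0 < a) (hb : 0 < b) (k L : ℕ)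
    (ht : b + R.extEdges.card * k * (a + 2 ^ (1 + R.extEdges.card * L)) ≤ t) :
    prob (marginal n p) {s | t ≤ (numIn (R.family x) s : ℝ)} ≤
      (R.mu n p / b) ^ k + n ^ 2 * (R.overlapConst (1 + R.extEdges.card * L) *
        (R.scale n p * (n : ℝ) ^ (-R.gap)) / a) ^ L := by
  set D : ℝ := a + 2 ^ (1 + R.extEdges.card * L)
  have hπ := marginal_mem n p.2
  have hcard : ∀ j ∈ R.family x, j.card ≤ R.extEdges.card := fun j hj => (card_of_mem_family hj).le
  have h1 := prob_upper_tail_mul_pow_le hπ hcard hb.le (show 0 ≤ D by positivity) k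
  rw [← mu_eq_sum_wt hbal hedges p x, ← le_div_iff₀ (by positivity), ← div_pow] at h1
  have h2 : ∀ f, prob (marginal n p) {s | D ≤ (numIn ((R.family x).filter (f ∈ ·)) s : ℝ)} ≤
      (R.overlapConst (1 + R.extEdges.card * L) * (R.scale n p * (n : ℝ) ^ (-R.gap)) / a) ^ L := by
    intro f
    rw [div_pow, le_div_iff₀ (by positivity)]
    refine prob_degree_mul_pow_le hπ hcard ha f L fun U hfU hU => ?_
    refine (sum_wt_sdiff_le hbal hedges p.2 hn hscale U x fun j hj => ?_).trans ?_
    · rw [Finset.mem_filter] at hj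
      exact ⟨hj.1, Finset.not_disjoint_iff.2 ⟨f, hfU, hj.2.1⟩, hj.2.2⟩
    · have h3 : (U.card : ℝ) ≤ (1 + R.extEdges.card * L : ℕ) := by exact_mod_cast hU
      have h4 : 0 ≤ R.scale n p * (n : ℝ) ^ (-R.gap) :=
        mul_nonneg (scale_nonneg p.2.1) (by positivity)
      unfold overlapConst
      gcongr
  -- Either every edge lies in at most `D` extensions, and disjoint sequences bound the tail, or
  -- some edge has large degree. The latter is a union bound over at most `n ^ 2` pairs.
  have h3 : {s | t ≤ (numIn (R.family x) s : ℝ)} ⊆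
      {s | b + R.extEdges.card * k * D ≤ numIn (R.family x) s ∧
        ∀ f, (numIn ((R.family x).filter (f ∈ ·)) s : ℝ) ≤ D} ∪
      {s | ∃ f ∈ (Finset.univ : Finset (Sym2 (Fin n))),
        s ∈ {s | D ≤ (numIn ((R.family x).filter (f ∈ ·)) s : ℝ)}} := by
    intro s hs
    by_cases h : ∀ f, (numIn ((R.family x).filter (f ∈ ·)) s : ℝ) ≤ D
    · exact Or.inl ⟨ht.trans hs, h⟩
    · push Not at h
      obtain ⟨f, hf⟩ := h
      exact Or.inr ⟨f, Finset.mem_univ f, hf.le⟩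
  refine (prob_mono hπ h3).trans ((prob_union_le hπ _ _).trans (add_le_add h1 ?_))
  refine (prob_biUnion_le hπ _ _).trans ((Finset.sum_le_sum fun f _ => h2 f).trans ?_)
  rw [Finset.sum_const, nsmul_eq_mul]
  refine mul_le_mul_of_nonneg_right ?_ ((prob_nonneg hπ _).trans (h2 s(⟨0, hn⟩, ⟨0, hn⟩)))
  rw [Finset.card_univ, Sym2.card, Fintype.card_fin]
  have : (n + 1).choose 2 ≤ n ^ 2 := by
    rw [Nat.choose_two_right, Nat.add_sub_cancel]
    refine Nat.div_le_of_le_mul ?_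
    nlinarith
  exact_mod_cast this

/-- Two disjoint root tuples of a grounded rooted graph share few extensions. -/
theorem card_family_inter_le (hg : R.Grounded) (hn : 1 ≤ n) {x y : Fin R.numRoots ↪ Fin n}
    (hxy : ∀ a b, x a ≠ y b) :
    ((R.family x ∩ R.family y).card : ℝ) ≤ 2 ^ R.nonroots.card * (n : ℝ) ^ R.nonroots.card / n := by
  classical
  cases nonempty_fintype V
  have hn0 : (0 : ℝ) < n := by exact_mod_cast hn
  have hn1 : (1 : ℝ) ≤ n := by exact_mod_cast hn
  obtain ⟨r, w, hw, hadj⟩ := hg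
  -- A common member contains an edge at `y r`, where `r` is a root with a non-root neighbour. As `y
  -- r` is not a root of `x`, some non-root vertex is pinned to it, which costs a factor `n`.
  set A := (R.placements x).filter fun φ => ∃ a ∈ R.nonroots, φ a = y r with hA
  have hsub : R.family x ∩ R.family y ⊆ A.image R.edgeImage := fun j hj => by
    obtain ⟨hjx, hjy⟩ := Finset.mem_inter.1 hj
    obtain ⟨φ, hφ, rfl⟩ := Finset.mem_image.1 hjx
    obtain ⟨ψ, hψ, hψφ⟩ := Finset.mem_image.1 hjy
    refine Finset.mem_image_of_mem _ (Finset.mem_filter.2 ⟨hφ, ?_⟩)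
    have h1 : s(ψ (R.root r), ψ w) ∈ R.edgeImage ψ := Finset.mem_image.2
      ⟨s(R.root r, w), R.mem_extEdges.2
        (R.extensionGraph_adj.2 ⟨hadj, Or.inr (R.mem_nonroots.2 hw)⟩), rfl⟩
    rw [hψφ] at h1
    obtain ⟨d, hd, hdeq⟩ := Finset.mem_image.1 h1
    have h2 : y r ∈ Sym2.map φ d := by
      rw [hdeq, (mem_placements.1 hψ).2]; simp
    obtain ⟨a, had, ha⟩ := Sym2.mem_map.1 h2
    refine ⟨a, ?_, ha⟩
    by_contra hna
    obtain ⟨j, rfl⟩ := not_not.1 fun h' => hna (R.mem_nonroots.2 h')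
    rw [(mem_placements.1 hφ).2] at ha
    exact hxy _ _ ha
  have h1 := sum_placements_prod_le (R := R) (x := x) (fun z => if z = y r then (n : ℝ) else 1)
    (fun _ => by positivity) A (Finset.filter_subset _ _)
  have h2 : ∀ φ ∈ A, (n : ℝ) ≤ ∏ a ∈ R.nonroots, if φ a = y r then (n : ℝ) else 1 := by
    intro φ hφ
    obtain ⟨-, a, ha, haf⟩ := Finset.mem_filter.1 hφ
    rw [← Finset.mul_prod_erase _ _ ha, if_pos haf]
    refine le_mul_of_one_le_right hn0.le ?_
    refine le_trans (le_of_eq Finset.prod_const_one.symm)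
      (Finset.prod_le_prod (fun _ _ => zero_le_one) fun b _ => ?_)
    split_ifs <;> linarith
  have h3 : ∑ z : Fin n, (if z = y r then (n : ℝ) else 1) ≤ 2 * n := by
    have h4 : ∀ z ∈ (Finset.univ : Finset (Fin n)),
        (if z = y r then (n : ℝ) else 1) ≤ (if z = y r then (n : ℝ) else 0) + 1 := fun z _ => by
      split_ifs <;> linarith
    refine (Finset.sum_le_sum h4).trans (le_of_eq ?_)
    rw [Finset.sum_add_distrib, Finset.sum_ite_eq']
    simp
    ring
  have h5 := Finset.card_nsmul_le_sum A _ _ h2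
  rw [nsmul_eq_mul] at h5
  rw [le_div_iff₀ hn0, ← mul_pow]
  calc ((R.family x ∩ R.family y).card : ℝ) * n ≤ A.card * n := by
        gcongr
        exact (Finset.card_le_card hsub).trans Finset.card_image_le
    _ ≤ _ := h5.trans h1
    _ ≤ _ := by gcongr

/-- Pairs of different edge sets obey the overlap estimate; the last term accounts for the members
common to both families. -/
theorem sum_overlap_disjoint_le (hbal : R.StrictlyBalanced)
    (hedges : R.rootSubgraph.edgeSet.ncard < R.graph.edgeSet.ncard) (hg : R.Grounded)
    {p : unitInterval} (hn : 1 ≤ n) (hscale : (n : ℝ) ^ (-R.gap) ≤ R.scale n p)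
    {x y : Fin R.numRoots ↪ Fin n} (hxy : ∀ a b, x a ≠ y b) :
    ∑ i ∈ R.family x, overlap (marginal n p) (R.family y) i ≤
      R.mu n p * (R.overlapConst R.extEdges.card * (R.scale n p * (n : ℝ) ^ (-R.gap))) +
        2 ^ R.nonroots.card * R.scale n p / n := by
  have hπ := marginal_mem n p.2
  have h1 : ∀ i ∈ R.family x, overlap (marginal n p) (R.family y) i ≤
      wt (marginal n p) i * (R.overlapConst R.extEdges.card * (R.scale n p * (n : ℝ) ^ (-R.gap))) +
        if i ∈ R.family y then (p : ℝ) ^ R.extEdges.card else 0 := by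
    intro i hi
    have h := sum_wt_sdiff_le hbal hedges p.2 hn hscale i y
      (𝓐 := (R.family y).filter fun j => ¬Disjoint i j ∧ j ≠ i) fun j hj => by
        rw [Finset.mem_filter] at hj
        exact ⟨hj.1, hj.2.1, not_subset_of_mem_family hi hj.1 hj.2.2⟩
    rw [card_of_mem_family hi] at h
    have h2 : ∑ j ∈ R.family y with ¬Disjoint i j, wt (marginal n p) (j \ i) ≤
        ∑ j ∈ R.family y with (¬Disjoint i j ∧ j ≠ i), wt (marginal n p) (j \ i) +
          if i ∈ R.family y then 1 else 0 := by
      have h3 : (R.family y).filter (fun j => ¬Disjoint i j) ⊆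
          (R.family y).filter (fun j => ¬Disjoint i j ∧ j ≠ i) ∪ (R.family y).filter (· = i) := by
        intro j hj
        rw [Finset.mem_filter] at hj
        by_cases hji : j = i
        · exact Finset.mem_union_right _ (Finset.mem_filter.2 ⟨hj.1, hji⟩)
        · exact Finset.mem_union_left _ (Finset.mem_filter.2 ⟨hj.1, hj.2, hji⟩)
      refine (Finset.sum_le_sum_of_subset_of_nonneg h3 fun j _ _ => wt_nonneg hπ _).trans ?_
      rw [Finset.sum_union]
      · gcongr
        rw [Finset.filter_eq']
        split_ifs <;> simp [wt]
      · exact Finset.disjoint_filter.2 fun j _ h => h.2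
    rw [overlap_eq]
    calc wt (marginal n p) i * ∑ j ∈ R.family y with ¬Disjoint i j, wt (marginal n p) (j \ i)
        ≤ wt (marginal n p) i * (R.overlapConst R.extEdges.card *
            (R.scale n p * (n : ℝ) ^ (-R.gap)) + if i ∈ R.family y then 1 else 0) :=
          mul_le_mul_of_nonneg_left (h2.trans (add_le_add_left h _)) (wt_nonneg hπ i)
      _ = _ := by
          rw [mul_add]
          congr 1
          split_ifs
          · rw [mul_one, wt_of_mem_family _ hi]
          · rw [mul_zero]
  refine (Finset.sum_le_sum h1).trans ?_
  rw [Finset.sum_add_distrib, ← Finset.sum_mul, ← mu_eq_sum_wt hbal hedges p x]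
  gcongr
  rw [← Finset.sum_filter, Finset.sum_const, nsmul_eq_mul, Finset.filter_mem_eq_inter, scale]
  have := pow_nonneg p.2.1 R.extEdges.card
  calc ((R.family x ∩ R.family y).card : ℝ) * (p : ℝ) ^ R.extEdges.card
      ≤ 2 ^ R.nonroots.card * (n : ℝ) ^ R.nonroots.card / n * (p : ℝ) ^ R.extEdges.card := by
        gcongr
        exact card_family_inter_le hg hn hxy
    _ = _ := by ring

/-! ### Comparing extension counts when the rooted graph is not grounded -/

theorem mem_nonroots_of_not_grounded (hg : ¬R.Grounded) {d : Sym2 V} (hd : d ∈ R.extEdges) {a : V}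
    (ha : a ∈ d) : a ∈ R.nonroots := by
  obtain ⟨b, rfl⟩ := ha
  obtain ⟨hadj, hab⟩ := R.extensionGraph_adj.1 (R.mem_extEdges.1 hd)
  by_contra hna
  obtain ⟨j, rfl⟩ := not_not.1 fun h' => hna (R.mem_nonroots.2 h')
  exact hg ⟨j, b, R.mem_nonroots.1 (hab.resolve_left hna), hadj⟩

theorem exists_eq_of_mem_cover (hg : ¬R.Grounded) {φ : V → Fin n} {u : Fin n}
    (hu : u ∈ cover (R.edgeImage φ)) : ∃ a ∈ R.nonroots, φ a = u := by
  obtain ⟨d, hd, hud⟩ := mem_cover.1 hu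
  obtain ⟨d', hd', rfl⟩ := Finset.mem_image.1 hd
  obtain ⟨a, ha, rfl⟩ := Sym2.mem_map.1 hud
  exact ⟨a, mem_nonroots_of_not_grounded hg hd' ha, rfl⟩

theorem notMem_cover_of_mem_family (hg : ¬R.Grounded) {x : Fin R.numRoots ↪ Fin n}
    {j : Finset (Sym2 (Fin n))} (hj : j ∈ R.family x) (r : Fin R.numRoots) : x r ∉ cover j := by
  obtain ⟨φ, hφ, rfl⟩ := Finset.mem_image.1 hj
  intro hr
  obtain ⟨a, ha, har⟩ := exists_eq_of_mem_cover hg hr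
  obtain ⟨hinj, hroot⟩ := mem_placements.1 hφ
  rw [← hroot r] at har
  exact R.mem_nonroots.1 ha ⟨r, (hinj har).symm⟩

/-- If the rooted graph is not grounded, the extensions of `y` are the extensions avoiding `y`. -/
theorem mem_family_of_notMem_cover (hbal : R.StrictlyBalanced)
    (hedges : R.rootSubgraph.edgeSet.ncard < R.graph.edgeSet.ncard) (hg : ¬R.Grounded)
    {x y : Fin R.numRoots ↪ Fin n} {j : Finset (Sym2 (Fin n))} (hj : j ∈ R.family x)
    (hy : ∀ r, y r ∉ cover j) : j ∈ R.family y := by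
  classical
  obtain ⟨φ, hφ, rfl⟩ := Finset.mem_image.1 hj
  obtain ⟨hinj, hroot⟩ := mem_placements.1 hφ
  have hex : ∀ {a}, a ∉ R.nonroots → ∃ r, R.root r = a := fun h =>
    not_not.1 fun h' => h (R.mem_nonroots.2 h')
  let ψ : V → Fin n := fun a => if h : a ∈ R.nonroots then φ a else y (hex h).choose
  have hψn : ∀ a ∈ R.nonroots, ψ a = φ a := fun a ha => by simp [ψ, ha]
  have hψr : ∀ r, ψ (R.root r) = y r := fun r => by
    have h : R.root r ∉ R.nonroots := by simp [mem_nonroots]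
    simp only [ψ, h, dif_neg, not_false_eq_true]
    congr 1
    exact R.root.injective (hex h).choose_spec
  have hne : ∀ a ∈ R.nonroots, ∀ r, φ a ≠ y r := fun a ha r h =>
    hy r (h ▸ mem_cover_edgeImage hbal hedges ha)
  have hψ : ψ ∈ R.placements y := by
    refine mem_placements.2 ⟨fun a b hab => ?_, hψr⟩
    by_cases ha : a ∈ R.nonroots <;> by_cases hb : b ∈ R.nonroots
    · rw [hψn a ha, hψn b hb] at hab
      exact hinj hab
    · obtain ⟨r, rfl⟩ := hex hb
      rw [hψn a ha, hψr] at hab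
      exact absurd hab (hne a ha r)
    · obtain ⟨r, rfl⟩ := hex ha
      rw [hψn b hb, hψr] at hab
      exact absurd hab.symm (hne b hb r)
    · obtain ⟨r, rfl⟩ := hex ha
      obtain ⟨r', rfl⟩ := hex hb
      rw [hψr, hψr] at hab
      rw [y.injective hab]
  refine Finset.mem_image.2 ⟨ψ, hψ, Finset.image_congr fun d hd => ?_⟩
  refine Sym2.map_congr fun a ha => hψn a (mem_nonroots_of_not_grounded hg hd ha)

theorem cover_nonempty_of_mem_family
    (hedges : R.rootSubgraph.edgeSet.ncard < R.graph.edgeSet.ncard)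
    {x : Fin R.numRoots ↪ Fin n} {j : Finset (Sym2 (Fin n))} (hj : j ∈ R.family x) :
    (cover j).Nonempty := by
  have h : 0 < j.card := by rw [card_of_mem_family hj]; exact card_extEdges_pos hedges
  obtain ⟨d, hd⟩ := Finset.card_pos.1 h
  obtain ⟨a, ha⟩ : ∃ a, a ∈ d := ⟨_, Sym2.out_fst_mem d⟩
  exact ⟨a, mem_cover.2 ⟨d, hd, ha⟩⟩

/-- There is a root tuple avoiding a small set of vertices. -/
theorem exists_root_tuple_avoiding (T : Finset (Fin n)) (h : T.card + R.numRoots ≤ n) :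
    ∃ y : Fin R.numRoots ↪ Fin n, ∀ r, y r ∉ T := by
  have h1 : R.numRoots ≤ Tᶜ.card := by
    rw [Finset.card_compl, Fintype.card_fin]; omega
  let f := Tᶜ.orderEmbOfCardLe h1
  exact ⟨f.toEmbedding, fun r => Finset.mem_compl.1 (Finset.orderEmbOfCardLe_mem _ h1 r)⟩

/-- If the rooted graph is not grounded, then the extension counts cannot all have the same small
positive value. -/
theorem lt_of_forall_numIn_eq (hbal : R.StrictlyBalanced)
    (hedges : R.rootSubgraph.edgeSet.ncard < R.graph.edgeSet.ncard) (hg : ¬R.Grounded)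
    (hroots : 0 < R.numRoots) {s : Finset (Sym2 (Fin n))} {k : ℕ} (hk : 0 < k)
    (hs : ∀ x, numIn (R.family x) s = k) (hr : R.numRoots ≤ n) :
    n < 2 * R.extEdges.card * (k + 1) + R.numRoots := by
  classical
  by_contra! hn
  set P : (Fin R.numRoots ↪ Fin n) → Finset (Finset (Sym2 (Fin n))) :=
    fun x => (R.family x).filter (· ⊆ s) with hP
  have hcard : ∀ x, (P x).card = k := hs
  have hcov : ∀ x, ((P x).biUnion cover).card ≤ k * (2 * R.extEdges.card) := fun x => by
    rw [← hcard x]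
    refine Finset.card_biUnion_le_card_mul _ _ _ fun j hj => ?_
    rw [← card_of_mem_family (Finset.mem_filter.1 hj).1]
    exact card_cover_le j
  -- Take a tuple `z` avoiding `j` and all extensions of `x` that are present. Then `P x ⊆ P z` with
  -- equal sizes, so `P x = P z`, which contains `j`.
  have hsub : ∀ x y, P y ⊆ P x := by
    intro x y j hj
    have hjf := (Finset.mem_filter.1 hj).1
    have hjc : (cover j).card ≤ 2 * R.extEdges.card := by
      rw [← card_of_mem_family hjf]; exact card_cover_le j
    obtain ⟨z, hz⟩ := exists_root_tuple_avoiding (R := R) ((P x).biUnion cover ∪ cover j) (by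
      have := Finset.card_union_le ((P x).biUnion cover) (cover j)
      have := hcov x
      nlinarith)
    have h1 : P x ⊆ P z := fun i hi => by
      refine Finset.mem_filter.2 ⟨?_, (Finset.mem_filter.1 hi).2⟩
      refine mem_family_of_notMem_cover hbal hedges hg (Finset.mem_filter.1 hi).1 fun r hr => ?_
      exact hz r (Finset.mem_union_left _ (Finset.mem_biUnion.2 ⟨i, hi, hr⟩))
    have h2 : j ∈ P z := by
      refine Finset.mem_filter.2 ⟨?_, (Finset.mem_filter.1 hj).2⟩
      exact mem_family_of_notMem_cover hbal hedges hg hjf fun r hr =>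
        hz r (Finset.mem_union_right _ hr)
    rw [Finset.eq_of_subset_of_card_le h1 (by rw [hcard, hcard])]
    exact h2
  let x₀ : Fin R.numRoots ↪ Fin n := Fin.castLEEmb hr
  obtain ⟨j, hj⟩ := Finset.card_pos.1 ((hcard x₀).symm ▸ hk)
  obtain ⟨u, hu⟩ := cover_nonempty_of_mem_family hedges (Finset.mem_filter.1 hj).1
  -- A tuple with a root on a vertex of `j`: now `j` cannot extend `y`, although all tuples have the
  -- same extensions.
  let y : Fin R.numRoots ↪ Fin n := x₀.trans (Equiv.swap (x₀ ⟨0, hroots⟩) u).toEmbedding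
  have hy : y ⟨0, hroots⟩ = u := by simp [y]
  have h3 := hsub y x₀ hj
  exact notMem_cover_of_mem_family hg (Finset.mem_filter.1 h3).1 ⟨0, hroots⟩ (hy ▸ hu)

open Classical in
/-- The ordered pairs of distinct extensions of `x` that share a vertex. -/
noncomputable def touchingPairs (R : RootedGraph V) {n : ℕ} (x : Fin R.numRoots ↪ Fin n) :
    Finset (Finset (Sym2 (Fin n)) × Finset (Sym2 (Fin n))) :=
  (R.family x ×ˢ R.family x).filter fun q => q.2 ≠ q.1 ∧ ¬Disjoint (cover q.1) (cover q.2)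

/-- The number of pairs in `touchingPairs` contained in `s`. -/
noncomputable def touchingCount (R : RootedGraph V) {n : ℕ} (x : Fin R.numRoots ↪ Fin n)
    (s : Finset (Sym2 (Fin n))) : ℝ :=
  ∑ q ∈ R.touchingPairs x, if q.1 ∪ q.2 ⊆ s then 1 else 0

/-- Without grounded edges a shared vertex is the image of a non-root vertex, so the overlap
estimate in its vertex form applies. -/
theorem expect_touchingCount_le (hbal : R.StrictlyBalanced)
    (hedges : R.rootSubgraph.edgeSet.ncard < R.graph.edgeSet.ncard) (hg : ¬R.Grounded)
    {p : unitInterval} (hn : 1 ≤ n) (hscale : (n : ℝ) ^ (-R.gap) ≤ R.scale n p)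
    (x : Fin R.numRoots ↪ Fin n) :
    expect (marginal n p) (R.touchingCount x) ≤
      R.mu n p * (R.overlapConst R.extEdges.card * (R.scale n p * (n : ℝ) ^ (-R.gap))) := by
  classical
  have h1 : expect (marginal n p) (R.touchingCount x) =
      ∑ q ∈ R.touchingPairs x, wt (marginal n p) (q.1 ∪ q.2) := by
    change expect (marginal n p) (fun s => ∑ q ∈ R.touchingPairs x, if q.1 ∪ q.2 ⊆ s then 1 else 0) = _
    rw [expect_sum]
    exact Finset.sum_congr rfl fun q _ => expect_ite_subset_one _ _
  rw [h1, touchingPairs, Finset.sum_filter, Finset.sum_product, mu_eq_sum_wt hbal hedges p x,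
    Finset.sum_mul]
  refine Finset.sum_le_sum fun i hi => ?_
  rw [← Finset.sum_filter, Finset.sum_congr rfl fun j _ => wt_union _ i j, ← Finset.mul_sum]
  refine mul_le_mul_of_nonneg_left ?_ (wt_nonneg (marginal_mem n p.2) i)
  have h := sum_wt_sdiff_le_of_cover hbal hedges p.2 hn hscale i x
    (𝓐 := (R.family x).filter fun j => j ≠ i ∧ ¬Disjoint (cover i) (cover j))
    (fun j hj => by
      rw [Finset.mem_filter] at hj
      exact ⟨hj.1, not_subset_of_mem_family hi hj.1 hj.2.1⟩)
    (fun φ _ hj => by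
      obtain ⟨u, hui, huj⟩ := Finset.not_disjoint_iff.1 (Finset.mem_filter.1 hj).2.2
      obtain ⟨a, ha, rfl⟩ := exists_eq_of_mem_cover hg huj
      exact ⟨a, ha, hui⟩)
  rwa [card_of_mem_family hi] at h

/-- Extensions of `x` that do not extend `y` cover some `y r`. If `d` of them cover the same vertex,
they form `d * (d - 1)` ordered touching pairs. A pair has at most `4 * e` vertices, so it avoids
one of the `m` disjoint tuples `X l` and is counted there. Hence `d * (d - 1) ≤ τ ^ 2` and `d ≤ 1 +
τ`. A bounded number of reference tuples thus controls all tuples at once. -/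
theorem numIn_le_add_of_touching (hbal : R.StrictlyBalanced)
    (hedges : R.rootSubgraph.edgeSet.ncard < R.graph.edgeSet.ncard) (hg : ¬R.Grounded) {m : ℕ}
    (hm : 4 * R.extEdges.card < m) (X : Fin m → (Fin R.numRoots ↪ Fin n))
    (hX : ∀ l l', l ≠ l' → ∀ a b, X l a ≠ X l' b) {s : Finset (Sym2 (Fin n))} {τ : ℝ} (hτ : 0 ≤ τ)
    (hs : ∑ l, R.touchingCount (X l) s ≤ τ ^ 2) (x y : Fin R.numRoots ↪ Fin n) :
    (numIn (R.family x) s : ℝ) ≤ numIn (R.family y) s + R.numRoots * (1 + τ) := by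
  classical
  set D : Fin n → Finset (Finset (Sym2 (Fin n))) :=
    fun u => ((R.family x).filter (· ⊆ s)).filter fun j => u ∈ cover j with hD
  have hDcard : ∀ u, ((D u).card : ℝ) ≤ 1 + τ := by
    intro u
    have h1 : (D u).offDiag ⊆ Finset.univ.biUnion fun l =>
        (R.touchingPairs (X l)).filter fun q => q.1 ∪ q.2 ⊆ s := by
      rintro ⟨i, j⟩ hij
      obtain ⟨hi, hj, hne⟩ := Finset.mem_offDiag.1 hij
      simp only [hD, Finset.mem_filter] at hi hj
      have hc : (cover i ∪ cover j).card < m := by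
        have h1 := Finset.card_union_le (cover i) (cover j)
        have h2 := card_cover_le i
        have h3 := card_cover_le j
        rw [card_of_mem_family hi.1.1] at h2
        rw [card_of_mem_family hj.1.1] at h3
        omega
      obtain ⟨l, hl⟩ : ∃ l, ∀ r, X l r ∉ cover i ∪ cover j := by
        by_contra! hcon
        choose f hf using hcon
        have hinj : Function.Injective fun l => X l (f l) := fun l l' h => by
          by_contra hne
          exact hX l l' hne _ _ h
        have := Finset.card_le_card_of_injOn (s := Finset.univ) (t := cover i ∪ cover j)
          (fun l => X l (f l)) (fun l _ => hf l) hinj.injOn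
        rw [Finset.card_univ, Fintype.card_fin] at this
        omega
      refine Finset.mem_biUnion.2 ⟨l, Finset.mem_univ l, Finset.mem_filter.2
        ⟨Finset.mem_filter.2 ⟨Finset.mem_product.2 ⟨?_, ?_⟩, Ne.symm hne,
          Finset.not_disjoint_iff.2 ⟨u, hi.2, hj.2⟩⟩, Finset.union_subset hi.1.2 hj.1.2⟩⟩
      · exact mem_family_of_notMem_cover hbal hedges hg hi.1.1 fun r hr =>
          hl r (Finset.mem_union_left _ hr)
      · exact mem_family_of_notMem_cover hbal hedges hg hj.1.1 fun r hr =>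
          hl r (Finset.mem_union_right _ hr)
    have h2 := (Finset.card_le_card h1).trans Finset.card_biUnion_le
    rw [Finset.offDiag_card] at h2
    have h3 : ((D u).card : ℝ) * (D u).card - (D u).card ≤ τ ^ 2 := by
      refine le_trans ?_ hs
      have h4 : ∀ l, R.touchingCount (X l) s =
          ((R.touchingPairs (X l)).filter fun q => q.1 ∪ q.2 ⊆ s).card := fun l => by
        simp [touchingCount]
      simp only [h4]
      have h5 : (D u).card * (D u).card ≤
          ∑ l, ((R.touchingPairs (X l)).filter fun q => q.1 ∪ q.2 ⊆ s).card + (D u).card := by omega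
      have h6 : ((D u).card : ℝ) * (D u).card ≤
          ∑ l, (((R.touchingPairs (X l)).filter fun q => q.1 ∪ q.2 ⊆ s).card : ℝ) + (D u).card := by
        exact_mod_cast h5
      linarith
    by_contra! hcon
    nlinarith
  have hsub : (R.family x).filter (· ⊆ s) ⊆ (R.family y).filter (· ⊆ s) ∪
      Finset.univ.biUnion fun r => D (y r) := by
    intro j hj
    by_cases h : ∀ r, y r ∉ cover j
    · refine Finset.mem_union_left _ (Finset.mem_filter.2 ⟨?_, (Finset.mem_filter.1 hj).2⟩)
      exact mem_family_of_notMem_cover hbal hedges hg (Finset.mem_filter.1 hj).1 h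
    · push Not at h
      obtain ⟨r, hr⟩ := h
      exact Finset.mem_union_right _ (Finset.mem_biUnion.2 ⟨r, Finset.mem_univ r,
        Finset.mem_filter.2 ⟨hj, hr⟩⟩)
  have h1 := (Finset.card_le_card hsub).trans ((Finset.card_union_le _ _).trans
    (Nat.add_le_add_left Finset.card_biUnion_le _))
  have h2 : (((R.family x).filter (· ⊆ s)).card : ℝ) ≤ ((R.family y).filter (· ⊆ s)).card +
      ∑ r, ((D (y r)).card : ℝ) := by exact_mod_cast h1
  refine h2.trans ?_
  unfold numIn
  gcongr
  refine (Finset.sum_le_sum fun r _ => hDcard (y r)).trans (le_of_eq ?_)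
  simp
  ring

/-- Pairwise disjoint root tuples. -/
theorem exists_disjoint_root_tuples {m : ℕ} (h : m * R.numRoots ≤ n) :
    ∃ X : Fin m → (Fin R.numRoots ↪ Fin n), ∀ l l', l ≠ l' → ∀ a b, X l a ≠ X l' b := by
  refine ⟨fun l => ⟨fun a => Fin.castLE h (finProdFinEquiv (l, a)), fun a b hab => ?_⟩, ?_⟩
  · have := finProdFinEquiv.injective (Fin.castLE_injective h hab)
    simpa using this
  · intro l l' hl a b hab
    have := finProdFinEquiv.injective (Fin.castLE_injective h hab)
    exact hl (Prod.mk.inj this).1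

end RootedGraph

/-! ### Asymptotic estimates and concentration above the logarithmic threshold -/

theorem eventually_le_natCast_rpow (K : ℝ) {δ : ℝ} (hδ : 0 < δ) :
    ∀ᶠ n : ℕ in atTop, K ≤ (n : ℝ) ^ δ :=
  ((tendsto_rpow_atTop hδ).comp tendsto_natCast_atTop_atTop).eventually_ge_atTop K

theorem eventually_mul_log_le_natCast_rpow (K : ℝ) {δ : ℝ} (hδ : 0 < δ) :
    ∀ᶠ n : ℕ in atTop, K * Real.log n ≤ (n : ℝ) ^ δ := by
  have hK : 0 < |K| + 1 := by positivity
  have h := ((isLittleO_log_rpow_atTop hδ).comp_tendsto tendsto_natCast_atTop_atTop).bound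
    (show 0 < 1 / (|K| + 1) by positivity)
  filter_upwards [h] with n hn
  simp only [Function.comp, Real.norm_eq_abs] at hn
  rw [abs_of_nonneg (Real.rpow_nonneg (Nat.cast_nonneg n) δ), one_div, inv_mul_eq_div,
    le_div_iff₀' hK] at hn
  calc K * Real.log n ≤ |K * Real.log n| := le_abs_self _
    _ = |K| * |Real.log n| := abs_mul _ _
    _ ≤ (|K| + 1) * |Real.log n| := by
        have := abs_nonneg (Real.log n)
        nlinarith
    _ ≤ _ := hn

namespace RootedGraph

open BernoulliSet

set_option linter.unusedSectionVars false

variable {V : Type*} [Finite V] {R : RootedGraph V}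

theorem rpow_neg_le_sq {n : ℕ} (hn : 1 ≤ n) (hg : 0 < R.gap) {ε : ℝ}
    (hε : (n : ℝ) ^ (-(R.gap / 64)) ≤ ε) : (n : ℝ) ^ (-(R.gap / 4)) ≤ ε ^ 2 := by
  have hn0 : (0 : ℝ) < n := by exact_mod_cast hn
  have hn1 : (1 : ℝ) ≤ n := by exact_mod_cast hn
  calc (n : ℝ) ^ (-(R.gap / 4)) ≤ (n : ℝ) ^ (-(R.gap / 64) * 2) :=
        Real.rpow_le_rpow_of_exponent_le hn1 (by linarith)
    _ = ((n : ℝ) ^ (-(R.gap / 64))) ^ 2 := by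
        rw [Real.rpow_mul hn0.le]; norm_cast
    _ ≤ ε ^ 2 := by gcongr

/-- Each of the two summands takes half of `ε ^ 2 * μ`. The `D` part is absorbed by `C = 2 * M * D`.
The other part loses `n ^ (-gap / 2)` against `Λ`, while `ε ^ 2` loses only `n ^ (-gap / 4)`, so the
logarithm and all constants, including `K`, are beaten for large `n`. -/
theorem exists_forall_log_mul_le (hbal : R.StrictlyBalanced)
    (hedges : R.rootSubgraph.edgeSet.ncard < R.graph.edgeSet.ncard) {M D K : ℝ} (hM : 0 < M)
    (hD : 0 < D) :
    ∃ C : ℝ, 0 < C ∧ ∀ᶠ n : ℕ in atTop, ∀ (p : unitInterval) (ε : ℝ),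
      (n : ℝ) ^ (-(R.gap / 64)) ≤ ε → C * Real.log n ≤ ε ^ 2 * R.mu n p →
        M * Real.log n * (D + K * (R.scale n p * (n : ℝ) ^ (-(R.gap / 2)))) ≤ ε ^ 2 * R.mu n p := by
  have hgap := gap_pos hedges
  have hrat := ratio_pos hedges
  refine ⟨2 * M * D, by positivity, ?_⟩
  filter_upwards [eventually_mul_log_le_natCast_rpow (2 * M * K / R.ratio)
    (show 0 < R.gap / 4 by linarith), eventually_ge_atTop 1, eventually_ge_atTop (2 * Nat.card V),
    eventually_ge_atTop R.numRoots] with n h1 hn1 hnV hnr p ε hε h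
  have hn0 : (0 : ℝ) < n := by exact_mod_cast hn1
  have hΛ := ratio_mul_scale_le_mu hbal hedges hnV hnr p
  have hε2 := rpow_neg_le_sq hn1 hgap hε
  have hμ := mu_nonneg (R := R) (n := n) p
  have hsc := scale_nonneg (R := R) (n := n) p.2.1
  have h3 : (n : ℝ) ^ (-(R.gap / 2)) = (n : ℝ) ^ (-(R.gap / 4)) * (n : ℝ) ^ (-(R.gap / 4)) := by
    rw [← Real.rpow_add hn0]; ring_nf
  have h4 : (n : ℝ) ^ (R.gap / 4) * (n : ℝ) ^ (-(R.gap / 4)) = 1 := by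
    rw [← Real.rpow_add hn0]; simp
  have hq : (0 : ℝ) ≤ (n : ℝ) ^ (-(R.gap / 4)) := by positivity
  set q := (n : ℝ) ^ (-(R.gap / 4))
  have h5 : 2 * (M * K * Real.log n) ≤ (n : ℝ) ^ (R.gap / 4) * R.ratio := by
    rw [div_mul_eq_mul_div, div_le_iff₀ hrat] at h1
    linarith
  have h6 : 2 * (M * K * Real.log n * (R.scale n p * (q * q))) ≤ ε ^ 2 * R.mu n p := by
    calc 2 * (M * K * Real.log n * (R.scale n p * (q * q)))
        = 2 * (M * K * Real.log n) * (R.scale n p * q * q) := by ring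
      _ ≤ (n : ℝ) ^ (R.gap / 4) * R.ratio * (R.scale n p * q * q) := by gcongr
      _ = ((n : ℝ) ^ (R.gap / 4) * q) * (q * (R.ratio * R.scale n p)) := by ring
      _ = q * (R.ratio * R.scale n p) := by rw [h4, one_mul]
      _ ≤ ε ^ 2 * R.mu n p := by gcongr
  rw [h3]
  nlinarith

theorem gap_le_half (hedges : R.rootSubgraph.edgeSet.ncard < R.graph.edgeSet.ncard) :
    R.gap ≤ 1 / 2 := by
  have : (1 : ℝ) ≤ R.extEdges.card := by exact_mod_cast card_extEdges_pos hedges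
  rw [gap, div_le_div_iff₀ (by positivity) two_pos]
  linarith

theorem rpow_neg_gap_le_scale (hbal : R.StrictlyBalanced)
    (hedges : R.rootSubgraph.edgeSet.ncard < R.graph.edgeSet.ncard) {n : ℕ} (hn : 1 ≤ n)
    {p : unitInterval} (h : 1 ≤ R.mu n p) : (n : ℝ) ^ (-R.gap) ≤ R.scale n p := by
  have hgap := gap_pos hedges
  have h1 : (n : ℝ) ^ (-R.gap) ≤ 1 :=
    Real.rpow_le_one_of_one_le_of_nonpos (by exact_mod_cast hn) (by linarith)
  exact h1.trans (h.trans (mu_le_scale hbal hedges p))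

theorem inv_one_add_pow_le {ε : ℝ} (hε : 0 ≤ ε) (hε1 : ε ≤ 1) (k : ℕ) :
    (1 / (1 + ε / 2)) ^ k ≤ Real.exp (-(k * (ε / 4))) := by
  have h : 1 / (1 + ε / 2) ≤ Real.exp (-(ε / 4)) := by
    have h1 := Real.add_one_le_exp (-(ε / 4))
    refine le_trans ?_ h1
    rw [div_le_iff₀ (by positivity)]
    nlinarith
  calc (1 / (1 + ε / 2)) ^ k ≤ Real.exp (-(ε / 4)) ^ k := by gcongr
    _ = _ := by rw [← Real.exp_nat_mul]; ring_nf

set_option maxHeartbeats 600000 in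
/-- Concentration of all extension counts when `ε ^ 2 * μ` is at least a large multiple of
`log n`. -/
theorem exists_le_concentrationProb (hbal : R.StrictlyBalanced)
    (hedges : R.rootSubgraph.edgeSet.ncard < R.graph.edgeSet.ncard) :
    ∃ C K : ℝ, 0 < C ∧ ∀ᶠ n : ℕ in atTop, ∀ (p : unitInterval) (ε : ℝ),
      (n : ℝ) ^ (-(R.gap / 64)) ≤ ε → ε ≤ 1 → C * Real.log n ≤ ε ^ 2 * R.mu n p →
        1 - K / n ≤ R.concentrationProb n p ε := by
  have hgap := gap_pos hedges
  have he : (0 : ℝ) < R.extEdges.card := by exact_mod_cast card_extEdges_pos hedges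
  set e := R.extEdges.card with he_def
  set r := R.numRoots with hr_def
  -- `L` is so large that `n ^ 2 * (n ^ (-gap / 2)) ^ L ≤ n ^ (-(r + 1))`: the large-degree event
  -- survives the union over pairs and then over tuples.
  obtain ⟨L, hL⟩ := exists_nat_ge ((r + 3 : ℝ) / (R.gap / 2))
  rw [div_le_iff₀ (by linarith)] at hL
  set N := 1 + e * L with hN
  set D₀ : ℝ := 1 + 2 ^ N with hD₀
  set B := R.overlapConst N with hB
  set B' := R.overlapConst e with hB'
  have hB1 := one_le_overlapConst (R := R) N
  have hB'1 := one_le_overlapConst (R := R) e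
  -- The constants `2 * (r + 1)` and `8 * e * (r + 1)` are what makes the lower and the upper tail
  -- of order `n ^ (-(r + 1))`.
  obtain ⟨C₁, hC₁, h₁⟩ := exists_forall_log_mul_le hbal hedges
    (show (0 : ℝ) < 2 * (r + 1) by positivity) one_pos (K := B')
  obtain ⟨C₂, hC₂, h₂⟩ := exists_forall_log_mul_le hbal hedges
    (show (0 : ℝ) < 8 * e * (r + 1) by positivity) (show 0 < D₀ by positivity) (K := 1)
  refine ⟨C₁ + C₂ + 1, 3 + B ^ L, by positivity, ?_⟩
  filter_upwards [h₁, h₂, eventually_ge_atTop 3, eventually_ge_atTop (2 * Nat.card V)]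
    with n h₁ h₂ hn3 hnV p ε hε hε1 hC
  have hn1 : 1 ≤ n := by omega
  have hn0 : (0 : ℝ) < n := by exact_mod_cast hn1
  have hn1' : (1 : ℝ) ≤ n := by exact_mod_cast hn1
  have hlog : 1 ≤ Real.log n := by
    rw [Real.le_log_iff_exp_le hn0]
    have : (3 : ℝ) ≤ n := by exact_mod_cast hn3
    linarith [Real.exp_one_lt_d9]
  have hε0 : 0 < ε := lt_of_lt_of_le (by positivity) hε
  have hμ0 := mu_nonneg (R := R) (n := n) p
  have hεμ : 1 ≤ ε ^ 2 * R.mu n p := by nlinarith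
  have hμ1 : 1 ≤ R.mu n p := by
    have : ε ^ 2 ≤ 1 := pow_le_one₀ hε0.le hε1
    nlinarith
  have hscale := rpow_neg_gap_le_scale hbal hedges hn1 hμ1
  have hsc := scale_nonneg (R := R) (n := n) p.2.1
  specialize h₁ p ε hε (by nlinarith)
  specialize h₂ p ε hε (by nlinarith)
  rw [one_mul] at h₂
  set Λ := R.scale n p with hΛ
  set μ := R.mu n p with hμ
  have hπ := marginal_mem n p.2
  have hpow : Real.exp (-((r + 1) * Real.log n)) = ((n : ℝ) ^ (r + 1))⁻¹ := by
    rw [Real.exp_neg, ← Nat.cast_succ, ← Real.log_pow, Real.exp_log (by positivity)]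
  have hhalf : (n : ℝ) ^ (-R.gap) ≤ (n : ℝ) ^ (-(R.gap / 2)) :=
    Real.rpow_le_rpow_of_exponent_le hn1' (by linarith)
  have hlow : ∀ x : Fin R.numRoots ↪ Fin n,
      prob (marginal n p) {s | (numIn (R.family x) s : ℝ) ≤ μ - ε * μ} ≤ ((n : ℝ) ^ (r + 1))⁻¹ := by
    intro x
    refine (prob_lower_tail_le hbal hedges hn1 hscale x hnV hε0.le).trans ?_
    rw [← hpow]
    refine Real.exp_le_exp.2 (neg_le_neg ?_)
    have hBΛ : 0 ≤ B' * (Λ * (n : ℝ) ^ (-R.gap)) := by positivity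
    rw [le_div_iff₀ (by positivity)]
    refine le_trans ?_ h₁
    calc (r + 1) * Real.log n * (2 * (1 + B' * (Λ * (n : ℝ) ^ (-R.gap))))
        ≤ (r + 1) * Real.log n * (2 * (1 + B' * (Λ * (n : ℝ) ^ (-(R.gap / 2))))) := by gcongr
      _ = _ := by ring
  have hup : ∀ x : Fin R.numRoots ↪ Fin n,
      prob (marginal n p) {s | μ + ε * μ ≤ (numIn (R.family x) s : ℝ)} ≤
        (2 + B ^ L) * ((n : ℝ) ^ (r + 1))⁻¹ := by
    intro x
    -- Half of the gap goes into the degree threshold; the remaining `n ^ (-gap / 2)` makes large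
    -- degrees unlikely.
    set a : ℝ := 1 + Λ * (n : ℝ) ^ (-(R.gap / 2)) with ha
    have haΛ : 0 ≤ Λ * (n : ℝ) ^ (-(R.gap / 2)) := by positivity
    have ha1 : 1 ≤ a := by linarith
    set D : ℝ := a + 2 ^ N with hD
    have hDpos : 0 < D := by positivity
    have hDeq : D₀ + Λ * (n : ℝ) ^ (-(R.gap / 2)) = D := by rw [hD, ha, hD₀]; ring
    -- The longest sequence for which blocked extensions cost at most `ε * μ / 2`, half of the
    -- allowed deviation.
    set k := ⌊ε * μ / (2 * e * D)⌋₊ with hk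
    have hk1 : (k : ℝ) ≤ ε * μ / (2 * e * D) := Nat.floor_le (by positivity)
    have hk2 : ε * μ / (2 * e * D) < k + 1 := Nat.lt_floor_add_one _
    have h := prob_upper_tail_le hbal hedges hn1 hscale x (a := a) (b := (1 + ε / 2) * μ)
      (t := μ + ε * μ) (by linarith) (by positivity) k L (by
        have : (e : ℝ) * k * D ≤ ε * μ / 2 := by
          calc (e : ℝ) * k * D ≤ e * (ε * μ / (2 * e * D)) * D := by gcongr
            _ = ε * μ / 2 := by field_simp
        change (1 + ε / 2) * μ + (e : ℝ) * k * D ≤ _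
        linarith)
    refine h.trans ?_
    rw [add_mul 2 (B ^ L)]
    refine add_le_add ?_ ?_
    · have h3 : μ / ((1 + ε / 2) * μ) = 1 / (1 + ε / 2) := by field_simp
      rw [h3]
      refine (inv_one_add_pow_le hε0.le hε1 k).trans ?_
      -- The `1 / 4` pays for the rounding in `k`, since `ε ≤ 1`.
      have h4 : (r + 1) * Real.log n ≤ 1 / 4 + k * (ε / 4) := by
        rw [hDeq] at h₂
        have h5 : (r + 1) * Real.log n ≤ ε * μ / (2 * e * D) * (ε / 4) := by
          rw [div_mul_div_comm, le_div_iff₀ (by positivity)]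
          calc (r + 1) * Real.log n * (2 * e * D * 4) = 8 * e * (r + 1) * Real.log n * D := by ring
            _ ≤ ε ^ 2 * μ := h₂
            _ = ε * μ * ε := by ring
        have h6 : ε * μ / (2 * e * D) * (ε / 4) ≤ (k + 1) * (ε / 4) := by gcongr
        linarith
      calc Real.exp (-(k * (ε / 4))) ≤ Real.exp (1 / 4 + -((r + 1) * Real.log n)) :=
            Real.exp_le_exp.2 (by linarith)
        _ = Real.exp (1 / 4) * ((n : ℝ) ^ (r + 1))⁻¹ := by rw [Real.exp_add, hpow]
        _ ≤ 2 * ((n : ℝ) ^ (r + 1))⁻¹ := by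
            gcongr
            have h7 : Real.exp (1 / 4) ^ 4 ≤ 2 ^ 4 := by
              rw [← Real.exp_nat_mul]
              norm_num
              linarith [Real.exp_one_lt_d9]
            exact le_of_pow_le_pow_left₀ (by norm_num) (by norm_num) h7
    · have h8 : B * (Λ * (n : ℝ) ^ (-R.gap)) / a ≤ B * (n : ℝ) ^ (-(R.gap / 2)) := by
        rw [div_le_iff₀ (by linarith)]
        have h9 : (n : ℝ) ^ (-R.gap) = (n : ℝ) ^ (-(R.gap / 2)) * (n : ℝ) ^ (-(R.gap / 2)) := by
          rw [← Real.rpow_add hn0]; ring_nf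
        rw [h9, ha]
        have h10 : (0 : ℝ) ≤ (n : ℝ) ^ (-(R.gap / 2)) := by positivity
        have h11 : 0 ≤ B := by linarith
        nlinarith [mul_nonneg h11 h10]
      have h12 : ((n : ℝ) ^ (-(R.gap / 2))) ^ L ≤ ((n : ℝ) ^ (r + 3))⁻¹ := by
        rw [← Real.rpow_natCast, ← Real.rpow_mul hn0.le, ← Real.rpow_natCast,
          ← Real.rpow_neg hn0.le]
        refine Real.rpow_le_rpow_of_exponent_le hn1' ?_
        push_cast
        linarith
      have h13 : 0 ≤ B * (Λ * (n : ℝ) ^ (-R.gap)) / a := by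
        have : 0 ≤ B := by linarith
        positivity
      calc (n : ℝ) ^ 2 * (B * (Λ * (n : ℝ) ^ (-R.gap)) / a) ^ L
          ≤ (n : ℝ) ^ 2 * (B * (n : ℝ) ^ (-(R.gap / 2))) ^ L := by gcongr
        _ = B ^ L * ((n : ℝ) ^ 2 * ((n : ℝ) ^ (-(R.gap / 2))) ^ L) := by rw [mul_pow]; ring
        _ ≤ B ^ L * ((n : ℝ) ^ 2 * ((n : ℝ) ^ (r + 3))⁻¹) := by
            have : 0 ≤ B := by linarith
            gcongr
        _ = B ^ L * ((n : ℝ) ^ (r + 1))⁻¹ := by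
            congr 1
            rw [show r + 3 = 2 + (r + 1) by ring, pow_add]
            field_simp
  rw [concentrationProb_eq hbal hedges]
  set A : Set (Finset (Sym2 (Fin n))) :=
    {s | ∀ x, |(numIn (R.family x) s : ℝ) - μ| < ε * μ} with hA
  have hbad : prob (marginal n p) Aᶜ ≤ (3 + B ^ L) / n := by
    have hsub : Aᶜ ⊆ {s | ∃ x ∈ (Finset.univ : Finset (Fin R.numRoots ↪ Fin n)),
        s ∈ {s | (numIn (R.family x) s : ℝ) ≤ μ - ε * μ} ∪
          {s | μ + ε * μ ≤ (numIn (R.family x) s : ℝ)}} := by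
      intro s hs
      simp only [hA, Set.mem_compl_iff, Set.mem_ofPred_eq, not_forall, not_lt] at hs
      obtain ⟨x, hx⟩ := hs
      refine ⟨x, Finset.mem_univ x, ?_⟩
      rcases le_abs.1 hx with h | h
      · exact Or.inr (show μ + ε * μ ≤ (numIn (R.family x) s : ℝ) by linarith)
      · exact Or.inl (show (numIn (R.family x) s : ℝ) ≤ μ - ε * μ by linarith)
    refine (prob_mono hπ hsub).trans ((prob_biUnion_le hπ _ _).trans ?_)
    have hx : ∀ x ∈ (Finset.univ : Finset (Fin R.numRoots ↪ Fin n)), prob (marginal n p)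
        ({s | (numIn (R.family x) s : ℝ) ≤ μ - ε * μ} ∪
          {s | μ + ε * μ ≤ (numIn (R.family x) s : ℝ)}) ≤ (3 + B ^ L) * ((n : ℝ) ^ (r + 1))⁻¹ := by
      intro x _
      refine (prob_union_le hπ _ _).trans ((add_le_add (hlow x) (hup x)).trans (le_of_eq ?_))
      ring
    refine (Finset.sum_le_card_nsmul _ _ _ hx).trans ?_
    rw [nsmul_eq_mul, Finset.card_univ, Fintype.card_embedding_eq, Fintype.card_fin,
      Fintype.card_fin]
    have h14 : ((n.descFactorial R.numRoots : ℕ) : ℝ) ≤ (n : ℝ) ^ r := by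
      exact_mod_cast Nat.descFactorial_le_pow n R.numRoots
    have : 0 ≤ B := by linarith
    calc _ ≤ (n : ℝ) ^ r * ((3 + B ^ L) * ((n : ℝ) ^ (r + 1))⁻¹) := by gcongr
      _ = (3 + B ^ L) / n := by
          rw [pow_succ]
          field_simp
  rw [prob_compl] at hbad
  linarith

/-! ### Both thresholds in the case that is not grounded -/

/-- The small power of `n` in which all polynomial error terms are expressed. -/
noncomputable def unitPow (R : RootedGraph V) (n : ℕ) : ℝ := (n : ℝ) ^ (R.gap / 64)

theorem one_le_unitPow (hedges : R.rootSubgraph.edgeSet.ncard < R.graph.edgeSet.ncard) {n : ℕ}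
    (hn : 1 ≤ n) : 1 ≤ R.unitPow n :=
  Real.one_le_rpow (by exact_mod_cast hn) (by have := gap_pos hedges; positivity)

theorem inv_unitPow (n : ℕ) : (R.unitPow n)⁻¹ = (n : ℝ) ^ (-(R.gap / 64)) :=
  (Real.rpow_neg (Nat.cast_nonneg n) _).symm

theorem rpow_neg_gap_eq (n : ℕ) : (n : ℝ) ^ (-R.gap) = (R.unitPow n ^ 64)⁻¹ := by
  rw [unitPow, ← Real.rpow_natCast, ← Real.rpow_mul (Nat.cast_nonneg n), ← Real.rpow_neg (Nat.cast_nonneg n)]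
  congr 1
  push_cast
  ring

theorem unitPow_pow_le (hedges : R.rootSubgraph.edgeSet.ncard < R.graph.edgeSet.ncard) {n : ℕ}
    (hn : 1 ≤ n) : R.unitPow n ^ 64 ≤ n := by
  rw [unitPow, ← Real.rpow_natCast, ← Real.rpow_mul (Nat.cast_nonneg n)]
  nth_rewrite 2 [← Real.rpow_one (n : ℝ)]
  refine Real.rpow_le_rpow_of_exponent_le (by exact_mod_cast hn) ?_
  have := gap_le_half hedges
  push_cast
  linarith

/-- If the expected number of extensions is small, some extension count vanishes. -/
theorem concentrationProb_le_mu (hbal : R.StrictlyBalanced)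
    (hedges : R.rootSubgraph.edgeSet.ncard < R.graph.edgeSet.ncard) {n : ℕ} (hr : R.numRoots ≤ n)
    (p : unitInterval) {ε : ℝ} (hε : ε ≤ 1) : R.concentrationProb n p ε ≤ R.mu n p := by
  let x : Fin R.numRoots ↪ Fin n := Fin.castLEEmb hr
  have hπ := marginal_mem n p.2
  rw [concentrationProb_eq hbal hedges, ← mul_one (prob _ _)]
  have hμ0 := mu_nonneg (R := R) (n := n) p
  refine (prob_mul_le_expect hπ (F := fun s => (numIn (R.family x) s : ℝ))
    (fun s => Nat.cast_nonneg _) fun s hs => ?_).trans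
    (by rw [expect_numIn, ← mu_eq_sum_wt hbal hedges])
  have h := hs x
  by_contra! hlt
  have h0 : numIn (R.family x) s = 0 := by
    have : numIn (R.family x) s < 1 := by exact_mod_cast hlt
    omega
  rw [h0, Nat.cast_zero, zero_sub, abs_neg, abs_of_nonneg hμ0] at h
  nlinarith

/-- The joint Chen–Stein estimate with an empty second family and `g = 1`. -/
theorem abs_prob_sub_poissonWeight_le (hbal : R.StrictlyBalanced)
    (hedges : R.rootSubgraph.edgeSet.ncard < R.graph.edgeSet.ncard) {n : ℕ} {p : unitInterval}
    (hn : 1 ≤ n) (hscale : (n : ℝ) ^ (-R.gap) ≤ R.scale n p) (x : Fin R.numRoots ↪ Fin n)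
    (hn2 : 2 * Nat.card V ≤ n) (m : ℕ) :
    |prob (marginal n p) {s | numIn (R.family x) s = m} - poissonWeight (R.mu n p) m| ≤
      2 * (1 + R.mu n p) *
        ((R.overlapConst R.extEdges.card + 1) * (R.scale n p * (n : ℝ) ^ (-R.gap))) := by
  have h := abs_expect_extension_le hbal hedges hn hscale x hn2 ∅ (B := 0) (by simp [overlap]) m
    (g := fun _ => 1) (fun _ => by simp)
  simp only [one_mul, add_zero] at h
  rw [expect_sub, expect_const] at h
  have h1 : (fun s : Finset (Sym2 (Fin n)) => if numIn (R.family x) s = m then (1 : ℝ) else 0) =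
      {s | numIn (R.family x) s = m}.indicator fun _ => 1 := by
    ext s
    simp [Set.indicator_apply]
  rwa [h1] at h

/-- Concentration of all extension counts in the case that is not grounded. -/
theorem exists_le_concentrationProb_of_not_grounded (hbal : R.StrictlyBalanced)
    (hedges : R.rootSubgraph.edgeSet.ncard < R.graph.edgeSet.ncard) (hg : ¬R.Grounded)
    (hroots : 0 < R.numRoots) :
    ∃ K : ℝ, 0 < K ∧ ∀ᶠ n : ℕ in atTop, ∀ (p : unitInterval) (ε : ℝ),
      (n : ℝ) ^ (-(R.gap / 64)) ≤ ε → ε ≤ 1 → K ≤ ε ^ 2 * R.mu n p →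
        1 - (K / (ε ^ 2 * R.mu n p) + K * (R.unitPow n ^ 32)⁻¹) ≤ R.concentrationProb n p ε := by
  have hrat := ratio_pos hedges
  set B := R.overlapConst R.extEdges.card with hB
  have hB1 : 1 ≤ B := one_le_overlapConst _
  -- One more than the number of vertices that two extensions can cover, so some reference tuple
  -- avoids any touching pair.
  set m := 4 * R.extEdges.card + 1 with hm
  set r : ℝ := (R.numRoots : ℝ) with hr
  have hr0 : 0 < r := Nat.cast_pos.2 hroots
  refine ⟨4 * r + 5 + 4 * B / R.ratio + 16 * m * B * r ^ 2 / R.ratio, by positivity, ?_⟩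
  filter_upwards [eventually_ge_atTop 1, eventually_ge_atTop (2 * Nat.card V),
    eventually_ge_atTop (m * R.numRoots), eventually_ge_atTop R.numRoots]
    with n hn1 hnV hnm hnr p ε hε hε1 hK
  set K := 4 * r + 5 + 4 * B / R.ratio + 16 * m * B * r ^ 2 / R.ratio with hKdef
  have hK1 : 0 ≤ 4 * B / R.ratio := by positivity
  have hK2 : 0 ≤ 16 * m * B * r ^ 2 / R.ratio := by positivity
  have hn0 : (0 : ℝ) < n := by exact_mod_cast hn1
  have hε0 : 0 < ε := lt_of_lt_of_le (by positivity) hε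
  have hμ0 := mu_nonneg (R := R) (n := n) p
  have hε2 : ε ^ 2 ≤ ε := by nlinarith
  have hεμ : K ≤ ε * R.mu n p := hK.trans (mul_le_mul_of_nonneg_right hε2 hμ0)
  have hμ1 : 1 ≤ R.mu n p := by nlinarith
  have hscale := rpow_neg_gap_le_scale hbal hedges hn1 hμ1
  have hΛ := ratio_mul_scale_le_mu hbal hedges hnV hnr p
  have hw := one_le_unitPow hedges hn1
  set w := R.unitPow n with hwdef
  rw [← inv_unitPow] at hε
  set μ := R.mu n p with hμ
  set t := R.scale n p * (n : ℝ) ^ (-R.gap) with ht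
  have ht0 : 0 ≤ t := mul_nonneg (scale_nonneg p.2.1) (by positivity)
  -- `t` is at most `μ * w ^ (-64)` up to a constant, and `ε ^ 2 ≥ w ^ (-2)`; the exponent 32 leaves
  -- ample room.
  have htle : t / (ε ^ 2 * μ) ≤ (w ^ 32)⁻¹ / R.ratio := by
    rw [div_le_div_iff₀ (by positivity) hrat, ht, rpow_neg_gap_eq]
    have h1 : (w ^ 64)⁻¹ ≤ (w ^ 32)⁻¹ * ε ^ 2 := by
      have h2 : (w ^ 2)⁻¹ ≤ ε ^ 2 := by rw [← inv_pow]; gcongr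
      have h3 : (w ^ 64)⁻¹ ≤ (w ^ 32)⁻¹ * (w ^ 2)⁻¹ := by
        rw [← mul_inv, ← pow_add]
        gcongr
        norm_num
      exact h3.trans (by gcongr)
    calc R.scale n p * (w ^ 64)⁻¹ * R.ratio = (R.ratio * R.scale n p) * (w ^ 64)⁻¹ := by ring
      _ ≤ μ * ((w ^ 32)⁻¹ * ε ^ 2) := by gcongr
      _ = _ := by ring
  obtain ⟨X, hX⟩ := exists_disjoint_root_tuples (R := R) hnm
  have hπ := marginal_mem n p.2
  let x₀ := X ⟨0, by omega⟩
  -- Comparing with `x₀` then costs `r + ε * μ / 4 ≤ ε * μ / 2`, and the deviation at `x₀` takes the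
  -- other half.
  set τ := ε * μ / (4 * r) with hτ
  have hτ0 : 0 < τ := by positivity
  set S₁ : Set (Finset (Sym2 (Fin n))) := {s | ε * μ / 2 ≤ |(numIn (R.family x₀) s : ℝ) - μ|}
  set S₂ : Set (Finset (Sym2 (Fin n))) := {s | τ ^ 2 ≤ ∑ l, R.touchingCount (X l) s}
  have hS₁ : prob (marginal n p) S₁ ≤ 4 / (ε ^ 2 * μ) + 4 * B / R.ratio * (w ^ 32)⁻¹ := by
    have h1 := prob_mul_le_expect hπ (A := S₁) (c := (ε * μ / 2) ^ 2)
      (F := fun s => ((numIn (R.family x₀) s : ℝ) - μ) ^ 2) (fun _ => sq_nonneg _) fun s hs => by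
        rw [← sq_abs ((numIn (R.family x₀) s : ℝ) - μ)]
        have : ε * μ / 2 ≤ |(numIn (R.family x₀) s : ℝ) - μ| := hs
        gcongr
    have h2 := variance_numIn_le hπ (R.family x₀)
    rw [← mu_eq_sum_wt hbal hedges p x₀] at h2
    have h3 := (h1.trans h2).trans (sum_overlap_le hbal hedges hn1 hscale x₀)
    rw [← le_div_iff₀ (by positivity)] at h3
    refine h3.trans ?_
    calc μ * (1 + B * t) / (ε * μ / 2) ^ 2 = 4 / (ε ^ 2 * μ) + 4 * B * (t / (ε ^ 2 * μ)) := by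
          field_simp
          ring
      _ ≤ 4 / (ε ^ 2 * μ) + 4 * B * ((w ^ 32)⁻¹ / R.ratio) := by gcongr
      _ = _ := by ring
  have hS₂ : prob (marginal n p) S₂ ≤ 16 * m * B * r ^ 2 / R.ratio * (w ^ 32)⁻¹ := by
    have h1 := prob_mul_le_expect hπ (A := S₂) (c := τ ^ 2)
      (F := fun s => ∑ l, R.touchingCount (X l) s) (fun s => Finset.sum_nonneg fun l _ =>
        Finset.sum_nonneg fun _ _ => by positivity) fun s hs => hs
    rw [expect_sum] at h1
    have h2 := h1.trans (Finset.sum_le_sum fun l _ =>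
      expect_touchingCount_le hbal hedges hg hn1 hscale (X l))
    rw [Finset.sum_const, Finset.card_univ, Fintype.card_fin, nsmul_eq_mul,
      ← le_div_iff₀ (by positivity)] at h2
    refine h2.trans ?_
    calc (m : ℝ) * (μ * (B * t)) / τ ^ 2 = 16 * m * B * r ^ 2 * (t / (ε ^ 2 * μ)) := by
          rw [hτ]
          field_simp
          ring
      _ ≤ 16 * m * B * r ^ 2 * ((w ^ 32)⁻¹ / R.ratio) := by gcongr
      _ = _ := by ring
  rw [concentrationProb_eq hbal hedges]
  set A : Set (Finset (Sym2 (Fin n))) :=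
    {s | ∀ x, |(numIn (R.family x) s : ℝ) - μ| < ε * μ} with hA
  have hsub : Aᶜ ⊆ S₁ ∪ S₂ := by
    intro s hs
    by_contra hcon
    rw [Set.mem_union, not_or] at hcon
    obtain ⟨h1, h2⟩ := hcon
    have h1 : |(numIn (R.family x₀) s : ℝ) - μ| < ε * μ / 2 := not_le.1 h1
    have h2 : ∑ l, R.touchingCount (X l) s ≤ τ ^ 2 := (not_le.1 h2).le
    refine hs fun x => ?_
    have h3 := numIn_le_add_of_touching hbal hedges hg (by omega) X hX hτ0.le h2 x x₀
    have h4 := numIn_le_add_of_touching hbal hedges hg (by omega) X hX hτ0.le h2 x₀ x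
    have h5 : r * (1 + τ) = r + ε * μ / 4 := by rw [hτ]; field_simp
    rw [← hr, h5] at h3 h4
    rw [abs_lt] at h1 ⊢
    constructor <;> linarith
  have h := (prob_mono hπ hsub).trans (prob_union_le hπ _ _)
  rw [prob_compl] at h
  have h4 : 4 / (ε ^ 2 * μ) ≤ K / (ε ^ 2 * μ) := by gcongr; linarith
  have h5 : (4 * B / R.ratio + 16 * m * B * r ^ 2 / R.ratio) * (w ^ 32)⁻¹ ≤ K * (w ^ 32)⁻¹ := by
    gcongr
    linarith
  rw [add_mul] at h5
  linarith

set_option maxHeartbeats 1000000 in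
/-- Failure of concentration in the case that is not grounded. -/
theorem exists_concentrationProb_le_of_not_grounded (hbal : R.StrictlyBalanced)
    (hedges : R.rootSubgraph.edgeSet.ncard < R.graph.edgeSet.ncard) (hg : ¬R.Grounded)
    (hroots : 0 < R.numRoots) :
    ∃ K : ℝ, ∀ᶠ n : ℕ in atTop, ∀ (p : unitInterval) (ε : ℝ),
      (n : ℝ) ^ (-(R.gap / 64)) ≤ ε → ε ≤ 1 → ε ^ 2 * R.mu n p ≤ 1 / 16 →
        R.concentrationProb n p ε ≤ K * √(ε ^ 2 * R.mu n p) + K * (R.unitPow n ^ 32)⁻¹ := by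
  have hrat := ratio_pos hedges
  have he : (0 : ℝ) < R.extEdges.card := by exact_mod_cast card_extEdges_pos hedges
  set e := R.extEdges.card with hedef
  set B := R.overlapConst e with hB
  have hB1 : 1 ≤ B := one_le_overlapConst _
  refine ⟨8 + 2 * e + 16 * (B + 1) / R.ratio, ?_⟩
  filter_upwards [eventually_ge_atTop 1, eventually_ge_atTop (2 * Nat.card V),
    eventually_ge_atTop (2 * (2 * e + R.numRoots)), eventually_ge_atTop R.numRoots,
    eventually_le_natCast_rpow 2 (gap_pos hedges)]
    with n hn1 hnV hne hnr hn2 p ε hε hε1 hsmall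
  set K := 8 + 2 * (e : ℝ) + 16 * (B + 1) / R.ratio with hKdef
  have hK1 : 0 ≤ 16 * (B + 1) / R.ratio := by positivity
  have hn0 : (0 : ℝ) < n := by exact_mod_cast hn1
  have hε0 : 0 < ε := lt_of_lt_of_le (by positivity) hε
  have hμ0 := mu_nonneg (R := R) (n := n) p
  have hw := one_le_unitPow hedges hn1
  have hwn := unitPow_pow_le hedges hn1
  set w := R.unitPow n with hwdef
  have hw0 : 0 < w := by linarith
  rw [← inv_unitPow, ← hwdef] at hε
  have hεw : 1 ≤ ε * w := by
    rw [inv_le_iff_one_le_mul₀ hw0] at hε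
    linarith
  set μ := R.mu n p with hμ
  have hπ := marginal_mem n p.2
  have hsqrt : 0 ≤ √(ε ^ 2 * μ) := Real.sqrt_nonneg _
  have hΛ0 : 0 ≤ R.scale n p := scale_nonneg p.2.1
  have hw32 : 0 ≤ (w ^ 32)⁻¹ := by positivity
  let x₀ : Fin R.numRoots ↪ Fin n := Fin.castLEEmb hnr
  rw [concentrationProb_eq hbal hedges, ← hμ]
  -- For `ε * μ < 1 / 2` the window has length below one, so all counts equal one integer, positive
  -- because `ε ≤ 1`. That integer is at least `n / (4 * e)`, which Markov's inequality excludes as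
  -- `μ ≤ w / 2`. Otherwise one count and its point probabilities suffice.
  rcases lt_or_ge (ε * μ) (1 / 2) with hcase | hcase
  · have hsub : {s | ∀ x, |(numIn (R.family x) s : ℝ) - μ| < ε * μ} ⊆
        {s | (n : ℝ) / (4 * e) ≤ numIn (R.family x₀) s} := by
      intro s hs
      set k := numIn (R.family x₀) s with hk
      have hall : ∀ x, numIn (R.family x) s = k := fun x => by
        have h1 := abs_lt.1 (hs x)
        have h2 := abs_lt.1 (hs x₀)
        have h3 : (numIn (R.family x) s : ℝ) < k + 1 := by linarith
        have h4 : (k : ℝ) < numIn (R.family x) s + 1 := by linarith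
        have h3' : numIn (R.family x) s < k + 1 := by exact_mod_cast h3
        have h4' : k < numIn (R.family x) s + 1 := by exact_mod_cast h4
        omega
      have hk0 : 0 < k := by
        by_contra hk0
        have h1 := hs x₀
        rw [← hk, Nat.eq_zero_of_not_pos hk0, Nat.cast_zero, zero_sub, abs_neg,
          abs_of_nonneg hμ0] at h1
        nlinarith
      have h1 := lt_of_forall_numIn_eq hbal hedges hg hroots hk0 hall hnr
      have h2 : n ≤ 4 * e * k := by nlinarith
      change (n : ℝ) / (4 * e) ≤ k
      rw [div_le_iff₀' (by positivity)]
      exact_mod_cast h2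
    have h1 := prob_mul_le_expect hπ (A := {s | (n : ℝ) / (4 * e) ≤ numIn (R.family x₀) s})
      (F := fun s => (numIn (R.family x₀) s : ℝ)) (c := n / (4 * e))
      (fun _ => Nat.cast_nonneg _) fun s hs => hs
    rw [expect_numIn, ← mu_eq_sum_wt hbal hedges p x₀, ← hμ, ← le_div_iff₀ (by positivity)] at h1
    refine (prob_mono hπ hsub).trans (h1.trans ?_)
    have h2 : μ ≤ w / 2 := by nlinarith
    have h3 : μ / (n / (4 * e)) ≤ 2 * e * (w ^ 32)⁻¹ := by
      rw [div_le_iff₀ (by positivity)]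
      have h4 : w ≤ (w ^ 32)⁻¹ * n := by
        rw [inv_mul_eq_div, le_div_iff₀ (by positivity)]
        refine le_trans ?_ hwn
        rw [← pow_succ']
        exact pow_le_pow_right₀ hw (by norm_num)
      calc μ ≤ w / 2 := h2
        _ ≤ ((w ^ 32)⁻¹ * n) / 2 := by linarith
        _ = 2 * e * (w ^ 32)⁻¹ * (n / (4 * e)) := by field_simp; ring
    have h5 : 2 * e * (w ^ 32)⁻¹ ≤ K * (w ^ 32)⁻¹ := by gcongr; linarith
    have h6 : 0 ≤ K * √(ε ^ 2 * μ) := by positivity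
    linarith
  · have hε8 : ε ≤ 1 / 8 := by nlinarith
    have hμ12 : 1 / 2 ≤ μ := by nlinarith
    have hμpos : 0 < μ := by linarith
    have hscale : (n : ℝ) ^ (-R.gap) ≤ R.scale n p := by
      refine le_trans ?_ (hμ12.trans (mu_le_scale hbal hedges p))
      rw [Real.rpow_neg hn0.le, one_div]
      exact inv_anti₀ two_pos hn2
    have hΛ := ratio_mul_scale_le_mu hbal hedges hnV hnr p
    have hμw : μ ≤ w ^ 2 := by
      have h1 : 1 ≤ (ε * w) ^ 2 := one_le_pow₀ hεw
      calc μ ≤ μ * (ε * w) ^ 2 := le_mul_of_one_le_right hμ0 h1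
        _ = (ε ^ 2 * μ) * w ^ 2 := by ring
        _ ≤ 1 * w ^ 2 := by gcongr; linarith
        _ = w ^ 2 := one_mul _
    have hw2 : 1 ≤ w ^ 2 := one_le_pow₀ hw
    -- At most `2 * ε * μ + 1 ≤ 4 * ε * μ` values, all at least `μ / 4`, each of probability at most
    -- `2 / √μ` plus a polynomially small error.
    set I := Finset.Icc ⌈μ - ε * μ⌉₊ ⌊μ + ε * μ⌋₊ with hI
    have hIcard : (I.card : ℝ) ≤ 4 * (ε * μ) := by
      rw [hI, Nat.card_Icc]
      have h1 : (⌊μ + ε * μ⌋₊ : ℝ) ≤ μ + ε * μ := Nat.floor_le (by positivity)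
      have h2 : μ - ε * μ ≤ (⌈μ - ε * μ⌉₊ : ℝ) := Nat.le_ceil _
      rcases le_total ⌈μ - ε * μ⌉₊ (⌊μ + ε * μ⌋₊ + 1) with h | h
      · rw [Nat.cast_sub h]
        push_cast
        linarith
      · rw [Nat.sub_eq_zero_of_le h]
        push_cast
        linarith
    have hsub : {s | ∀ x, |(numIn (R.family x) s : ℝ) - μ| < ε * μ} ⊆
        {s | ∃ m ∈ I, s ∈ {s | numIn (R.family x₀) s = m}} := by
      intro s hs
      have h1 := abs_lt.1 (hs x₀)
      refine ⟨numIn (R.family x₀) s, Finset.mem_Icc.2 ⟨Nat.ceil_le.2 (by linarith),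
        Nat.le_floor (by linarith)⟩, rfl⟩
    have hpt : ∀ m ∈ I, prob (marginal n p) {s | numIn (R.family x₀) s = m} ≤
        2 / √μ + 4 * (B + 1) / R.ratio * w ^ 4 * (w ^ 64)⁻¹ := by
      intro m hm
      have hm1 : μ / 4 ≤ (m : ℝ) := by
        have h1 : μ - ε * μ ≤ (m : ℝ) := Nat.ceil_le.1 (Finset.mem_Icc.1 hm).1
        nlinarith
      have hm0 : 1 ≤ m := by
        have : (0 : ℝ) < m := by linarith
        exact_mod_cast this
      have h1 := (abs_le.1 (abs_prob_sub_poissonWeight_le hbal hedges hn1 hscale x₀ hnV m)).2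
      have h2 : poissonWeight μ m ≤ 2 / √μ := by
        refine (poissonWeight_le hμpos hm0).trans ?_
        have h3 : √μ / 2 ≤ √m := by
          rw [show √μ / 2 = √(μ / 4) by
            rw [Real.sqrt_div hμ0, show (4 : ℝ) = 2 ^ 2 by norm_num, Real.sqrt_sq two_pos.le]]
          exact Real.sqrt_le_sqrt hm1
        have h4 : 0 < √μ := Real.sqrt_pos.2 hμpos
        rw [div_le_div_iff₀ (by linarith) h4]
        linarith
      have h5 : 2 * (1 + μ) * ((B + 1) * (R.scale n p * (n : ℝ) ^ (-R.gap))) ≤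
          4 * (B + 1) / R.ratio * w ^ 4 * (w ^ 64)⁻¹ := by
        rw [rpow_neg_gap_eq, ← hwdef]
        have h6 : R.scale n p ≤ w ^ 2 / R.ratio := by
          rw [le_div_iff₀' hrat]
          exact hΛ.trans hμw
        calc 2 * (1 + μ) * ((B + 1) * (R.scale n p * (w ^ 64)⁻¹))
            ≤ 2 * (w ^ 2 + w ^ 2) * ((B + 1) * (w ^ 2 / R.ratio * (w ^ 64)⁻¹)) := by gcongr
          _ = _ := by ring
      linarith
    refine (prob_mono hπ hsub).trans ((prob_biUnion_le hπ _ _).trans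
      ((Finset.sum_le_card_nsmul _ _ _ hpt).trans ?_))
    rw [nsmul_eq_mul]
    have hsq : √(ε ^ 2 * μ) = ε * √μ := by
      rw [Real.sqrt_mul (by positivity), Real.sqrt_sq hε0.le]
    have h7 : μ / √μ = √μ := Real.div_sqrt
    calc (I.card : ℝ) * (2 / √μ + 4 * (B + 1) / R.ratio * w ^ 4 * (w ^ 64)⁻¹)
        ≤ 4 * (ε * μ) * (2 / √μ + 4 * (B + 1) / R.ratio * w ^ 4 * (w ^ 64)⁻¹) := by
          gcongr
      _ = 8 * (ε * (μ / √μ)) + 16 * (B + 1) / R.ratio * ((ε * μ) * w ^ 4 * (w ^ 64)⁻¹) := by ring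
      _ ≤ K * √(ε ^ 2 * μ) + K * (w ^ 32)⁻¹ := by
          rw [h7, ← hsq]
          have h8 : ε * μ * w ^ 4 * (w ^ 64)⁻¹ ≤ (w ^ 32)⁻¹ := by
            calc ε * μ * w ^ 4 * (w ^ 64)⁻¹ ≤ 1 * w ^ 2 * w ^ 4 * (w ^ 64)⁻¹ := by gcongr
              _ = (w ^ 58)⁻¹ := by field_simp
              _ ≤ (w ^ 32)⁻¹ := by
                  gcongr
                  norm_num
          have h9 : 8 ≤ K := by linarith
          have h10 : 16 * (B + 1) / R.ratio ≤ K := by linarith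
          gcongr

end RootedGraph

/-! ### Failure of concentration in the grounded case -/

namespace BernoulliSet

variable {ι : Type*} [Fintype ι] [DecidableEq ι]

/-- Second moment bound for the event that none of `M` nearly uncorrelated counts equals `k`. -/
theorem prob_forall_ne_mul_le {π : ι → ℝ} (hπ : ∀ i, π i ∈ Set.Icc (0 : ℝ) 1) {M : ℕ}
    (N : Fin M → Finset ι → ℕ) (k : ℕ) {q δ : ℝ} (hq0 : 0 ≤ q) (hq1 : q ≤ 1) (hδ : 0 ≤ δ)
    (h : ∀ l l', l ≠ l' → expect π (fun s => ((if N l s = k then 1 else 0) - q) *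
      ((if N l' s = k then 1 else 0) - q)) ≤ δ) :
    prob π {s | ∀ l, N l s ≠ k} * (M * q) ^ 2 ≤ M + M ^ 2 * δ := by
  set Z : Fin M → Finset ι → ℝ := fun l s => (if N l s = k then 1 else 0) - q with hZ
  have hpair : ∀ l l', expect π (fun s => Z l s * Z l' s) ≤ (if l = l' then 1 else 0) + δ := by
    intro l l'
    by_cases hl : l = l'
    · subst hl
      refine (expect_mono hπ (G := fun _ => 1) fun s => ?_).trans ?_
      · simp only [hZ]
        split_ifs <;> nlinarith
      · rw [expect_const]
        simp [hδ]
    · simpa [hl] using h l l' hl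
  refine (prob_mul_le_expect hπ (F := fun s => ∑ l, ∑ l', Z l s * Z l' s) (fun s => ?_)
    fun s hs => ?_).trans ?_
  · rw [← Finset.sum_mul_sum]
    exact mul_self_nonneg _
  -- When no count equals `k`, the squared sum of the `Z l` is exactly `(M * q) ^ 2`, far above its
  -- mean.
  · have hs' : ∀ l, Z l s = -q := fun l => by simp [hZ, show N l s ≠ k from hs l]
    simp only [hs', Finset.sum_const, Finset.card_univ, Fintype.card_fin, nsmul_eq_mul]
    exact le_of_eq (by ring)
  · rw [expect_sum]
    calc ∑ l, expect π (fun s => ∑ l', Z l s * Z l' s)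
        = ∑ l, ∑ l', expect π (fun s => Z l s * Z l' s) :=
          Finset.sum_congr rfl fun l _ => expect_sum _ _ _
      _ ≤ ∑ l : Fin M, ∑ l' : Fin M, ((if l = l' then 1 else 0) + δ) :=
          Finset.sum_le_sum fun l _ => Finset.sum_le_sum fun l' _ => hpair l l'
      _ = M + M ^ 2 * δ := by
          simp [Finset.sum_add_distrib]
          ring

/-- Some value far from the mean has a large Poisson weight. -/
theorem exists_le_poissonWeight {l ε : ℝ} (hl : 0 < l) (hε0 : 0 ≤ ε) (hε1 : ε ≤ 1) :
    ∃ k : ℕ, ε * l ≤ |(k : ℝ) - l| ∧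
      Real.exp (-(2 * (ε ^ 2 * l) + 3)) / (3 * (1 + l)) ≤ poissonWeight l k := by
  have hεl : 0 ≤ ε ^ 2 * l := by positivity
  -- For `l ≤ 1` the value zero is already far enough and has weight at least `exp (-1)`. For larger
  -- `l` the first integer above `(1 + ε) * l` is used; rounding adds at most one, and `(ε * l + 1)
  -- ^ 2 ≤ 2 * (ε * l) ^ 2 + 2`.
  rcases le_or_gt l 1 with h | h
  · refine ⟨0, ?_, ?_⟩
    · rw [Nat.cast_zero, zero_sub, abs_neg, abs_of_pos hl]
      nlinarith
    · have h0 : poissonWeight l 0 = Real.exp (-l) := by simp [poissonWeight]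
      rw [h0]
      refine (div_le_self (Real.exp_pos _).le (by linarith)).trans (Real.exp_le_exp.2 ?_)
      linarith
  · have hk1 := Nat.le_ceil ((1 + ε) * l)
    have hk2 := Nat.ceil_lt_add_one (show 0 ≤ (1 + ε) * l by positivity)
    set k := ⌈(1 + ε) * l⌉₊
    have hkpos : (0 : ℝ) < k := lt_of_lt_of_le (by positivity) hk1
    refine ⟨k, ?_, le_trans ?_ (le_poissonWeight hl (by exact_mod_cast hkpos))⟩
    · exact le_trans (by linarith) (le_abs_self _)
    · have hk3 : (k : ℝ) ≤ 3 * (1 + l) := by nlinarith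
      have hsq : ((k : ℝ) - l) ^ 2 / l ≤ 2 * (ε ^ 2 * l) + 2 := by
        rw [div_le_iff₀ hl]
        have h1 : 0 ≤ (k : ℝ) - l := by nlinarith
        have h2 : (k : ℝ) - l ≤ ε * l + 1 := by linarith
        calc ((k : ℝ) - l) ^ 2 ≤ (ε * l + 1) ^ 2 := by gcongr
          _ ≤ (2 * (ε ^ 2 * l) + 2) * l := by nlinarith [sq_nonneg (ε * l - 1)]
      have hexp : Real.exp (-(2 * (ε ^ 2 * l) + 3)) * Real.exp 1 =
          Real.exp (-(2 * (ε ^ 2 * l) + 2)) := by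
        rw [← Real.exp_add]
        ring_nf
      rw [div_le_div_iff₀ (by positivity) (by positivity), ← mul_assoc, hexp]
      gcongr

end BernoulliSet

namespace RootedGraph

open BernoulliSet

set_option linter.unusedSectionVars false

variable {V : Type*} [Finite V] {R : RootedGraph V}

/-- Extension counts of disjoint root tuples are nearly uncorrelated. -/
theorem expect_mul_le_of_disjoint (hbal : R.StrictlyBalanced)
    (hedges : R.rootSubgraph.edgeSet.ncard < R.graph.edgeSet.ncard) (hg : R.Grounded) {n : ℕ}
    {p : unitInterval} (hn : 1 ≤ n) (hscale : (n : ℝ) ^ (-R.gap) ≤ R.scale n p)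
    (hn2 : 2 * Nat.card V ≤ n) {x y : Fin R.numRoots ↪ Fin n} (hxy : ∀ a b, x a ≠ y b) (k : ℕ) :
    expect (marginal n p) (fun s =>
      ((if numIn (R.family y) s = k then 1 else 0) - poissonWeight (R.mu n p) k) *
        ((if numIn (R.family x) s = k then 1 else 0) - poissonWeight (R.mu n p) k)) ≤
      2 * (1 + R.mu n p) *
        ((2 * R.overlapConst R.extEdges.card + 1) * (R.scale n p * (n : ℝ) ^ (-R.gap)) +
          2 ^ R.nonroots.card / R.ratio / n) := by
  have hrat := ratio_pos hedges
  have hμ0 := mu_nonneg (R := R) (n := n) p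
  have hμ := mu_pos_of_scale hbal hedges hn hscale x hn2
  have hr : R.numRoots ≤ n := by simpa using Fintype.card_le_of_embedding x
  have hn0 : (0 : ℝ) < n := by exact_mod_cast hn
  set q := poissonWeight (R.mu n p) k with hq
  have hq0 : 0 ≤ q := poissonWeight_nonneg hμ0 k
  have hq1 : q ≤ 1 := poissonWeight_le_one hμ0 k
  set t := R.scale n p * (n : ℝ) ^ (-R.gap) with ht
  -- The test function `g` is the centred indicator for the count at `y`, so the Chen–Stein bound is
  -- directly a covariance-type bound.
  have h := abs_expect_extension_le hbal hedges hn hscale x hn2 (R.family y)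
    (B := R.overlapConst R.extEdges.card * t + 2 ^ R.nonroots.card / R.ratio / n)
    ((sum_overlap_disjoint_le hbal hedges hg hn hscale hxy).trans ?_) k
    (g := fun j => (if j = k then 1 else 0) - q) (fun j => ?_)
  · refine (le_abs_self _).trans (h.trans (le_of_eq ?_))
    ring
  · rw [mul_add]
    refine add_le_add le_rfl ?_
    have hΛ : R.scale n p ≤ R.mu n p / R.ratio := by
      rw [le_div_iff₀' hrat]
      exact ratio_mul_scale_le_mu hbal hedges hn2 hr p
    calc 2 ^ R.nonroots.card * R.scale n p / n
        ≤ 2 ^ R.nonroots.card * (R.mu n p / R.ratio) / n := by gcongr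
      _ = _ := by ring
  · rw [abs_le]
    split_ifs <;> constructor <;> linarith

set_option maxHeartbeats 1000000 in
/-- Failure of concentration in the grounded case. -/
theorem exists_concentrationProb_le_of_grounded (hbal : R.StrictlyBalanced)
    (hedges : R.rootSubgraph.edgeSet.ncard < R.graph.edgeSet.ncard) (hg : R.Grounded)
    (hroots : 0 < R.numRoots) :
    ∃ K : ℝ, ∀ᶠ n : ℕ in atTop, ∀ (p : unitInterval) (ε : ℝ),
      (n : ℝ) ^ (-(R.gap / 64)) ≤ ε → ε ≤ 1 → ε ^ 2 * R.mu n p ≤ R.gap / 64 * Real.log n →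
        R.concentrationProb n p ε ≤ K * (R.unitPow n ^ 32)⁻¹ := by
  have hrat := ratio_pos hedges
  have hgap := gap_pos hedges
  set B := R.overlapConst R.extEdges.card with hB
  have hB1 : 1 ≤ B := one_le_overlapConst _
  set r : ℝ := (R.numRoots : ℝ) with hr
  have hr0 : 0 < r := Nat.cast_pos.2 hroots
  set K₁ : ℝ := 4 * (2 * B + 1 + 2 ^ R.nonroots.card) / R.ratio with hK₁
  have hK₁0 : 0 ≤ K₁ := by positivity
  refine ⟨1 + 2 * r + K₁, ?_⟩
  filter_upwards [eventually_ge_atTop 1, eventually_ge_atTop (2 * Nat.card V),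
    eventually_ge_atTop (2 * R.numRoots),
    eventually_le_natCast_rpow (6 * Real.exp 3) (show 0 < R.gap / 64 by linarith)]
    with n hn1 hnV hnr hwbig p ε hε hε1 hsmall
  have hn0 : (0 : ℝ) < n := by exact_mod_cast hn1
  have hε0 : 0 < ε := lt_of_lt_of_le (by positivity) hε
  have hμ0 := mu_nonneg (R := R) (n := n) p
  have hΛ0 : 0 ≤ R.scale n p := scale_nonneg p.2.1
  have hw := one_le_unitPow hedges hn1
  have hwn := unitPow_pow_le hedges hn1
  have hlogw : Real.log (R.unitPow n) = R.gap / 64 * Real.log n := Real.log_rpow hn0 _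
  rw [← inv_unitPow] at hε
  change 6 * Real.exp 3 ≤ R.unitPow n at hwbig
  rw [← hlogw] at hsmall
  have hgapw := rpow_neg_gap_eq (R := R) n
  set w := R.unitPow n with hwdef
  have hw0 : 0 < w := by linarith
  have hεw : 1 ≤ ε * w := by
    rw [inv_le_iff_one_le_mul₀ hw0] at hε
    linarith
  have hw32 : 0 ≤ (w ^ 32)⁻¹ := by positivity
  -- Below this range the overlap estimate is unavailable, but then `μ` is so small that a fixed
  -- count is almost surely zero.
  rcases lt_or_ge (R.scale n p) ((n : ℝ) ^ (-R.gap)) with hcase | hscale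
  · have h1 := concentrationProb_le_mu (n := n) hbal hedges (by omega) p hε1
    have h2 := mu_le_scale (n := n) hbal hedges p
    rw [hgapw] at hcase
    have h3 : (w ^ 64)⁻¹ ≤ (w ^ 32)⁻¹ := by
      gcongr
      norm_num
    have h4 : (w ^ 32)⁻¹ ≤ (1 + 2 * r + K₁) * (w ^ 32)⁻¹ :=
      le_mul_of_one_le_left hw32 (by linarith)
    linarith
  have hμpos : 0 < R.mu n p :=
    mu_pos_of_scale hbal hedges hn1 hscale (Fin.castLEEmb (by omega)) hnV
  have hΛ := ratio_mul_scale_le_mu hbal hedges hnV (by omega) p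
  obtain ⟨k, hk, hqk⟩ := exists_le_poissonWeight hμpos hε0.le hε1
  -- As many disjoint root tuples as fit into `[n]`.
  obtain ⟨M, hM⟩ : ∃ M, M = n / R.numRoots := ⟨_, rfl⟩
  obtain ⟨X, hX⟩ := exists_disjoint_root_tuples (R := R) (n := n) (m := M)
    (hM ▸ Nat.div_mul_le_self _ _)
  have hMn : (n : ℝ) ≤ 2 * r * M := by
    have h1 : n < R.numRoots * (M + 1) := hM ▸ Nat.lt_mul_div_succ n hroots
    have h2 : n ≤ 2 * R.numRoots * M := by
      have h3 : 1 ≤ M := hM ▸ (Nat.one_le_div_iff hroots).2 (by omega)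
      nlinarith
    rw [hr]
    exact_mod_cast h2
  have hM0 : (0 : ℝ) < M := by
    by_contra! h
    nlinarith
  have hcov := fun l l' (hl : l ≠ l') =>
    expect_mul_le_of_disjoint hbal hedges hg hn1 hscale hnV (hX l' l hl.symm) k
  rw [concentrationProb_eq hbal hedges]
  set μ := R.mu n p with hμ
  set q := poissonWeight μ k with hq
  rw [hgapw] at hcov
  have hμw : μ ≤ w ^ 3 := by
    have h1 : 1 ≤ (ε * w) ^ 2 := one_le_pow₀ hεw
    have h2 : Real.log w ≤ w := (Real.log_le_sub_one_of_pos hw0).trans (by linarith)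
    calc μ ≤ μ * (ε * w) ^ 2 := le_mul_of_one_le_right hμ0 h1
      _ = (ε ^ 2 * μ) * w ^ 2 := by ring
      _ ≤ w * w ^ 2 := by gcongr; linarith
      _ = w ^ 3 := by ring
  have hw3 : 1 ≤ w ^ 3 := one_le_pow₀ hw
  -- The constant `c = gap / 64` makes `ε ^ 2 * μ ≤ log w`. The Gaussian factor then costs `w ^ 2`,
  -- the factor `1 + μ` costs `w ^ 3`, and the numerical constants one more `w`. This is negligible
  -- against `M` and the correlation error.
  have hqw : (w ^ 6)⁻¹ ≤ q := by
    refine le_trans ?_ hqk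
    have h1 : Real.exp (-(2 * Real.log w + 3)) = (w ^ 2 * Real.exp 3)⁻¹ := by
      rw [Real.exp_neg, Real.exp_add, two_mul, Real.exp_add, Real.exp_log hw0, sq]
    calc (w ^ 6)⁻¹ ≤ (w ^ 2 * Real.exp 3 * (6 * w ^ 3))⁻¹ := by
          gcongr
          calc w ^ 2 * Real.exp 3 * (6 * w ^ 3) = (6 * Real.exp 3) * w ^ 5 := by ring
            _ ≤ w * w ^ 5 := by gcongr
            _ = w ^ 6 := by ring
      _ = Real.exp (-(2 * Real.log w + 3)) / (6 * w ^ 3) := by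
          rw [h1, mul_inv, div_eq_mul_inv]
      _ ≤ _ := by
          have h2 : 3 * (1 + μ) ≤ 6 * w ^ 3 := by linarith
          gcongr
  have hδ : 2 * (1 + μ) * ((2 * B + 1) * (R.scale n p * (w ^ 64)⁻¹) +
      2 ^ R.nonroots.card / R.ratio / n) ≤ K₁ * (w ^ 58)⁻¹ := by
    have h1 : R.scale n p ≤ w ^ 3 / R.ratio := by
      rw [le_div_iff₀' hrat]
      exact hΛ.trans hμw
    have h2 : 2 ^ R.nonroots.card / R.ratio / n ≤
        2 ^ R.nonroots.card * (w ^ 3 / R.ratio * (w ^ 64)⁻¹) := by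
      calc 2 ^ R.nonroots.card / R.ratio / n ≤ 2 ^ R.nonroots.card / R.ratio / w ^ 64 := by gcongr
        _ = 2 ^ R.nonroots.card * (1 / R.ratio * (w ^ 64)⁻¹) := by ring
        _ ≤ _ := by gcongr
    calc _ ≤ 2 * (w ^ 3 + w ^ 3) * ((2 * B + 1) * (w ^ 3 / R.ratio * (w ^ 64)⁻¹) +
          2 ^ R.nonroots.card * (w ^ 3 / R.ratio * (w ^ 64)⁻¹)) := by gcongr
      _ = K₁ * (w ^ 6 * (w ^ 64)⁻¹) := by rw [hK₁]; ring
      _ = K₁ * (w ^ 58)⁻¹ := by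
          congr 1
          field_simp
  have hmain := prob_forall_ne_mul_le (marginal_mem n p.2) (fun l => numIn (R.family (X l))) k
    (q := q) (δ := K₁ * (w ^ 58)⁻¹) (poissonWeight_nonneg hμ0 k) (poissonWeight_le_one hμ0 k)
    (by positivity) fun l l' hl => (hcov l l' hl).trans hδ
  have hsub : {s | ∀ x, |(numIn (R.family x) s : ℝ) - μ| < ε * μ} ⊆
      {s | ∀ l, numIn (R.family (X l)) s ≠ k} := fun s hs l hl => by
    have h1 := hs (X l)
    rw [hl] at h1
    linarith
  refine (prob_mono (marginal_mem n p.2) hsub).trans ?_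
  have hMq : 0 < (M * (w ^ 6)⁻¹) ^ 2 := by positivity
  have h1 := (mul_le_mul_of_nonneg_left (show (M * (w ^ 6)⁻¹) ^ 2 ≤ (M * q) ^ 2 by gcongr)
    (prob_nonneg (marginal_mem n p.2) {s | ∀ l, numIn (R.family (X l)) s ≠ k})).trans hmain
  rw [← le_div_iff₀ hMq] at h1
  refine h1.trans ?_
  have h2 : w ^ 12 / M ≤ 2 * r * (w ^ 32)⁻¹ := by
    rw [div_le_iff₀ hM0, mul_right_comm, ← div_eq_mul_inv, le_div_iff₀ (by positivity), ← pow_add]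
    exact (pow_le_pow_right₀ hw (by norm_num)).trans (hwn.trans hMn)
  have h3 : (w ^ 46)⁻¹ ≤ (w ^ 32)⁻¹ := by
    gcongr
    norm_num
  calc ((M : ℝ) + M ^ 2 * (K₁ * (w ^ 58)⁻¹)) / (M * (w ^ 6)⁻¹) ^ 2
      = w ^ 12 / M + K₁ * (w ^ 46)⁻¹ := by field_simp
    _ ≤ 2 * r * (w ^ 32)⁻¹ + K₁ * (w ^ 32)⁻¹ := by gcongr
    _ ≤ (1 + 2 * r + K₁) * (w ^ 32)⁻¹ := by linarith

/-! ### Passage to the limit and the optimal constant -/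

theorem tendsto_inv_unitPow (hedges : R.rootSubgraph.edgeSet.ncard < R.graph.edgeSet.ncard) :
    Tendsto (fun n => (R.unitPow n ^ 32)⁻¹) atTop (𝓝 0) := by
  have h : Tendsto R.unitPow atTop atTop :=
    (tendsto_rpow_atTop (by have := gap_pos hedges; positivity)).comp tendsto_natCast_atTop_atTop
  exact ((tendsto_pow_atTop (by norm_num)).comp h).inv_tendsto_atTop

theorem concentrationProb_nonneg (n : ℕ) (p : unitInterval) (ε : ℝ) :
    0 ≤ R.concentrationProb n p ε := measureReal_nonneg

theorem concentrationProb_le_one (hbal : R.StrictlyBalanced)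
    (hedges : R.rootSubgraph.edgeSet.ncard < R.graph.edgeSet.ncard) (n : ℕ) (p : unitInterval)
    (ε : ℝ) : R.concentrationProb n p ε ≤ 1 := by
  rw [concentrationProb_eq hbal hedges]
  exact prob_le_one (marginal_mem n p.2) _

/-- Since `μ` is the size of the family times `p ^ e`, it suffices to take an `e`-th root; the upper
bound on `t` keeps `p ≤ 1`. Needed to realise a prescribed multiple of `log n` as a mean. -/
theorem exists_mu_eq (hbal : R.StrictlyBalanced)
    (hedges : R.rootSubgraph.edgeSet.ncard < R.graph.edgeSet.ncard) {n : ℕ}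
    (hnV : 2 * Nat.card V ≤ n) (hr : R.numRoots ≤ n) {t : ℝ} (ht0 : 0 < t)
    (ht : t ≤ R.ratio * (n : ℝ) ^ R.nonroots.card) : ∃ p : unitInterval, R.mu n p = t := by
  let x : Fin R.numRoots ↪ Fin n := Fin.castLEEmb hr
  have he : R.extEdges.card ≠ 0 := (card_extEdges_pos hedges).ne'
  have hcard := ht.trans (ratio_mul_pow_le_card_family hbal hedges hnV x)
  have hpos : (0 : ℝ) < (R.family x).card := ht0.trans_le hcard
  have h0 : 0 ≤ t / (R.family x).card := by positivity
  have h1 : t / (R.family x).card ≤ 1 := (div_le_one hpos).2 hcard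
  refine ⟨⟨(t / (R.family x).card) ^ (R.extEdges.card : ℝ)⁻¹, by positivity,
    Real.rpow_le_one h0 h1 (by positivity)⟩, ?_⟩
  rw [mu_eq hbal hedges _ x, Real.rpow_inv_natCast_pow h0 he, mul_div_cancel₀ _ hpos.ne']

theorem tendsto_concentrationProb_zero_of_grounded (hbal : R.StrictlyBalanced)
    (hedges : R.rootSubgraph.edgeSet.ncard < R.graph.edgeSet.ncard) (hroots : 0 < R.numRoots)
    (hg : R.Grounded) {p : ℕ → unitInterval} {ε : ℕ → ℝ}
    (hε : ∀ᶠ n : ℕ in atTop, (n : ℝ) ^ (-(R.gap / 64)) ≤ ε n ∧ ε n ≤ 1)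
    (h : ∀ᶠ n : ℕ in atTop, ε n ^ 2 * R.mu n (p n) ≤ R.gap / 64 * Real.log n) :
    Tendsto (fun n : ℕ => R.concentrationProb n (p n) (ε n)) atTop (𝓝 0) := by
  obtain ⟨K, hK⟩ := exists_concentrationProb_le_of_grounded hbal hedges hg hroots
  refine squeeze_zero' (Eventually.of_forall fun n => concentrationProb_nonneg _ _ _) ?_
    (by simpa using (tendsto_inv_unitPow hedges).const_mul K)
  filter_upwards [hK, hε, h] with n hn hε h
  exact hn _ _ hε.1 hε.2 h

theorem tendsto_concentrationProb_zero_of_not_grounded (hbal : R.StrictlyBalanced)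
    (hedges : R.rootSubgraph.edgeSet.ncard < R.graph.edgeSet.ncard) (hroots : 0 < R.numRoots)
    (hg : ¬R.Grounded) {p : ℕ → unitInterval} {ε : ℕ → ℝ}
    (hε : ∀ᶠ n : ℕ in atTop, (n : ℝ) ^ (-(R.gap / 64)) ≤ ε n ∧ ε n ≤ 1)
    (h : Tendsto (fun n : ℕ => ε n ^ 2 * R.mu n (p n)) atTop (𝓝 0)) :
    Tendsto (fun n : ℕ => R.concentrationProb n (p n) (ε n)) atTop (𝓝 0) := by
  obtain ⟨K, hK⟩ := exists_concentrationProb_le_of_not_grounded hbal hedges hg hroots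
  refine squeeze_zero' (Eventually.of_forall fun n => concentrationProb_nonneg _ _ _) ?_
    (by simpa using (h.sqrt.const_mul K).add ((tendsto_inv_unitPow hedges).const_mul K))
  filter_upwards [hK, hε, h.eventually_le_const (show (0 : ℝ) < 1 / 16 by norm_num)]
    with n hn hε h
  exact hn _ _ hε.1 hε.2 h

theorem tendsto_concentrationProb_one_of_not_grounded (hbal : R.StrictlyBalanced)
    (hedges : R.rootSubgraph.edgeSet.ncard < R.graph.edgeSet.ncard) (hroots : 0 < R.numRoots)
    (hg : ¬R.Grounded) {p : ℕ → unitInterval} {ε : ℕ → ℝ}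
    (hε : ∀ᶠ n : ℕ in atTop, (n : ℝ) ^ (-(R.gap / 64)) ≤ ε n ∧ ε n ≤ 1)
    (h : Tendsto (fun n : ℕ => ε n ^ 2 * R.mu n (p n)) atTop atTop) :
    Tendsto (fun n : ℕ => R.concentrationProb n (p n) (ε n)) atTop (𝓝 1) := by
  obtain ⟨K, _, hK⟩ := exists_le_concentrationProb_of_not_grounded hbal hedges hg hroots
  refine tendsto_of_tendsto_of_tendsto_of_le_of_le' (by
    simpa using ((h.const_div_atTop K).add ((tendsto_inv_unitPow hedges).const_mul K)).const_sub 1)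
    tendsto_const_nhds ?_
    (Eventually.of_forall fun n => concentrationProb_le_one hbal hedges _ _ _)
  filter_upwards [hK, hε, h.eventually_ge_atTop K] with n hn hε h
  exact hn _ _ hε.1 hε.2 h

end RootedGraph

theorem theorem1 {V : Type*} [Finite V] (R : RootedGraph V) (hroots : 0 < R.numRoots)
    (hedges : R.rootSubgraph.edgeSet.ncard < R.graph.edgeSet.ncard)
    (hbal : R.StrictlyBalanced) :
    ∃ c C α : ℝ, 0 < c ∧ 0 < C ∧ 0 < α ∧
      (∀ (p : ℕ → unitInterval) (ε : ℕ → ℝ),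
        (∀ᶠ n : ℕ in atTop, (n : ℝ) ^ (-α) ≤ ε n ∧ ε n ≤ 1) →
        (R.Grounded →
          ((∀ᶠ n : ℕ in atTop, ε n ^ 2 * R.mu n (p n) ≤ c * Real.log n) →
            Tendsto (fun n : ℕ => R.concentrationProb n (p n) (ε n)) atTop (𝓝 0)) ∧
          ((∀ᶠ n : ℕ in atTop, C * Real.log n ≤ ε n ^ 2 * R.mu n (p n)) →
            Tendsto (fun n : ℕ => R.concentrationProb n (p n) (ε n)) atTop (𝓝 1))) ∧
        (¬ R.Grounded →
          (Tendsto (fun n : ℕ => ε n ^ 2 * R.mu n (p n)) atTop (𝓝 0) →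
            Tendsto (fun n : ℕ => R.concentrationProb n (p n) (ε n)) atTop (𝓝 0)) ∧
          (Tendsto (fun n : ℕ => ε n ^ 2 * R.mu n (p n)) atTop atTop →
            Tendsto (fun n : ℕ => R.concentrationProb n (p n) (ε n)) atTop (𝓝 1)))) ∧
      (R.Grounded → ∀ ε : ℝ, 0 < ε → ε ≤ 1 →
        R.SufficientConstant ε (C / ε ^ 2) ∧
        ∀ K : ℝ, R.SufficientConstant ε K → c / ε ^ 2 ≤ K) := by
  have hgap := RootedGraph.gap_pos hedges
  have hα : 0 < R.gap / 64 := by linarith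
  have hrat := RootedGraph.ratio_pos hedges
  obtain ⟨C, K₀, hC, hA⟩ := RootedGraph.exists_le_concentrationProb hbal hedges
  have hone : ∀ (p : ℕ → unitInterval) (ε : ℕ → ℝ),
      (∀ᶠ n : ℕ in atTop, (n : ℝ) ^ (-(R.gap / 64)) ≤ ε n ∧ ε n ≤ 1) →
      (∀ᶠ n : ℕ in atTop, C * Real.log n ≤ ε n ^ 2 * R.mu n (p n)) →
        Tendsto (fun n : ℕ => R.concentrationProb n (p n) (ε n)) atTop (𝓝 1) := by
    intro p ε hε h
    refine tendsto_of_tendsto_of_tendsto_of_le_of_le' (by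
      simpa using (tendsto_const_div_atTop_nhds_zero_nat K₀).const_sub 1) tendsto_const_nhds ?_
      (Eventually.of_forall fun n => RootedGraph.concentrationProb_le_one hbal hedges _ _ _)
    filter_upwards [hA, hε, h] with n hn hε h
    exact hn _ _ hε.1 hε.2 h
  refine ⟨R.gap / 64, C, R.gap / 64, hα, hC, hα, fun p ε hε => ⟨fun hg =>
    ⟨RootedGraph.tendsto_concentrationProb_zero_of_grounded hbal hedges hroots hg hε, hone p ε hε⟩, fun hg =>
    ⟨RootedGraph.tendsto_concentrationProb_zero_of_not_grounded hbal hedges hroots hg hε,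
      RootedGraph.tendsto_concentrationProb_one_of_not_grounded hbal hedges hroots hg hε⟩⟩, ?_⟩
  intro hg ε hε0 hε1
  have hε2 : 0 < ε ^ 2 := by positivity
  have hε : ∀ᶠ n : ℕ in atTop, (n : ℝ) ^ (-(R.gap / 64)) ≤ ε ∧ ε ≤ 1 := by
    filter_upwards [eventually_le_natCast_rpow ε⁻¹ hα] with n hn
    refine ⟨?_, hε1⟩
    rw [Real.rpow_neg (Nat.cast_nonneg n)]
    exact inv_le_of_inv_le₀ hε0 hn
  refine ⟨fun p hp => hone p (fun _ => ε) hε ?_, fun K hK => ?_⟩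
  · filter_upwards [hp] with n hn
    rwa [div_mul_eq_mul_div, div_le_iff₀' hε2] at hn
  · by_contra! hlt
    -- With mean `K' * log n`, sufficiency of `K < K'` would give limit one, while `K' < c / ε ^ 2`
    -- gives limit zero. The maximum with zero makes the prescribed mean positive even if `K` is
    -- not.
    obtain ⟨K', hK', hKc⟩ := exists_between (max_lt hlt (show 0 < R.gap / 64 / ε ^ 2 by positivity))
    obtain ⟨hKK', hK'0⟩ := max_lt_iff.1 hK'
    have hp : ∀ᶠ n : ℕ in atTop, ∃ p : unitInterval, R.mu n p = K' * Real.log n := by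
      filter_upwards [eventually_ge_atTop 2, eventually_ge_atTop (2 * Nat.card V),
        eventually_ge_atTop R.numRoots,
        eventually_mul_log_le_natCast_rpow (K' / R.ratio) one_pos] with n hn2 hnV hnr hlog
      have hn : (1 : ℝ) < n := by exact_mod_cast hn2
      refine RootedGraph.exists_mu_eq hbal hedges hnV hnr (mul_pos hK'0 (Real.log_pos hn)) ?_
      rw [Real.rpow_one, div_mul_eq_mul_div, div_le_iff₀' hrat] at hlog
      refine hlog.trans (mul_le_mul_of_nonneg_left ?_ hrat.le)
      exact le_self_pow₀ hn.le ((RootedGraph.card_nonroots_pos hedges).ne')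
    obtain ⟨p, hp⟩ := hp.choice
    have hlog : ∀ᶠ n : ℕ in atTop, 0 ≤ Real.log n := Eventually.of_forall fun n =>
      Real.log_natCast_nonneg n
    refine zero_ne_one (tendsto_nhds_unique
      (RootedGraph.tendsto_concentrationProb_zero_of_grounded hbal hedges hroots hg (p := p) hε ?_)
      (hK p ?_))
    · filter_upwards [hp, hlog] with n hn hlog
      rw [lt_div_iff₀' hε2] at hKc
      rw [hn, ← mul_assoc]
      gcongr
    · filter_upwards [hp, hlog] with n hn hlog
      rw [hn]
      gcongr
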